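/- Let $(M,g)$ be a smooth (Hausdorff, second countable) Riemannian 6-manifold with a smooth $SU(3)$-structure $(I,\omega,\Omega)$: $I$ is an almost complex structure with $g(I\cdot,I\cdot)=g$, $\omega=g(I\cdot,\cdot)$ is its Hermitian form, and $\Omega$ is a $(3,0)$-form such that every point has a $g$-orthonormal basis $u_1,Iu_1,u_2,Iu_2,u_3,Iu_3$ of the tangent space with $\Omega=\theta_1\wedge\theta_2\wedge\theta_3$, $\theta_i=u_i^*+\sqrt{-1}\,(Iu_i)^*$ (so that $\omega=\tfrac{\sqrt{-1}}{2}\sum_i\theta_i\wedge\bar\theta_i$). Assume that $M$ is nearly Kähler, i.e. for some nonzero real constant $\lambda$ $$d\omega=3\lambda\,\mathrm{Re}\,\Omega,\qquad d\,\mathrm{Im}\,\Omega=-2\lambda\,\omega\wedge\omega .$$ On the algebra $\Lambda^*(M)$ of smooth complex-valued differential forms let $N=d^{2,-1}$ and $\bar N=d^{-1,2}$ be the components of the de Rham differential $d$ mapping $\Lambda^{p,q}(M)$ to $\Lambda^{p+2,q-1}(M)$ and to $\Lambda^{p-1,q+2}(M)$, let $L_\omega(\eta)=\omega\wedge\eta$,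 and let $N^*$, $\bar N^*$ and $\Lambda_\omega$ be the Hermitian adjoints of $N$, $\bar N$ and $L_\omega$ with respect to the pointwise Hermitian product on forms induced by $g$. Then these (pointwise) adjoints exist, and $$[L_\omega,N^*]=2\sqrt{-1}\,\bar N,\qquad [L_\omega,\bar N^*]=-2\sqrt{-1}\,N,$$ $$[\Lambda_\omega,N]=2\sqrt{-1}\,\bar N^*,\qquad [\Lambda_\omega,\bar N]=-2\sqrt{-1}\,N^* .$$ -/

import Mathlib

open scoped Manifold ContDiff Bundle Topology
open Bundle

noncomputable section

namespace NearlyKahler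

/-! ### Linear algebra of complex-valued alternating forms on a real vector space -/

section LinearAlgebra

variable {V : Type*} [AddCommGroup V] [Module ℝ V] [TopologicalSpace V]

/-- The product `a(v_1, …, v_p) b(v_{p+1}, …, v_{p+q})`, as a multilinear map. -/
def mulForms {p q n : ℕ} (h : p + q = n) (a : V [⋀^Fin p]→L[ℝ] ℂ) (b : V [⋀^Fin q]→L[ℝ] ℂ) :
    ContinuousMultilinearMap ℝ (fun _ : Fin n => V) ℂ where
  toMultilinearMap := ((LinearMap.mul' ℝ ℂ).compMultilinearMap
    (MultilinearMap.domCoprod a.toAlternatingMap.toMultilinearMap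
      b.toAlternatingMap.toMultilinearMap)).domDomCongr (finSumFinEquiv.trans (finCongr h))
  cont := by
    change Continuous fun v : Fin n → V =>
      a (fun i => v (Fin.cast h (Fin.castAdd q i))) * b (fun j => v (Fin.cast h (Fin.natAdd p j)))
    exact (a.cont.comp (by fun_prop)).mul (b.cont.comp (by fun_prop))

theorem mulForms_apply {p q n : ℕ} (h : p + q = n) (a : V [⋀^Fin p]→L[ℝ] ℂ)
    (b : V [⋀^Fin q]→L[ℝ] ℂ) (v : Fin n → V) :
    mulForms h a b v = a (fun i => v (Fin.cast h (Fin.castAdd q i))) *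
      b (fun j => v (Fin.cast h (Fin.natAdd p j))) := rfl

/-- The wedge product
`(a ∧ b)(v) = 1/(p! q!) ∑_σ sign(σ) a(v_{σ1}, …, v_{σp}) b(v_{σ(p+1)}, …, v_{σ(p+q)})`. -/
def wedge [IsTopologicalAddGroup V] [ContinuousConstSMul ℝ V] {p q n : ℕ} (h : p + q = n)
    (a : V [⋀^Fin p]→L[ℝ] ℂ) (b : V [⋀^Fin q]→L[ℝ] ℂ) : V [⋀^Fin n]→L[ℝ] ℂ :=
  ((p.factorial : ℂ) * (q.factorial : ℂ))⁻¹ •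
    ContinuousMultilinearMap.alternatization (mulForms h a b)

/-- The real part of a complex-valued form. -/
def reForm {k : ℕ} (a : V [⋀^Fin k]→L[ℝ] ℂ) : V [⋀^Fin k]→L[ℝ] ℂ :=
  (Complex.ofRealCLM.comp Complex.reCLM).compContinuousAlternatingMap a

/-- The imaginary part of a complex-valued form. -/
def imForm {k : ℕ} (a : V [⋀^Fin k]→L[ℝ] ℂ) : V [⋀^Fin k]→L[ℝ] ℂ :=
  (Complex.ofRealCLM.comp Complex.imCLM).compContinuousAlternatingMap a

/-- `Λ^{p,q}`, inside the complex `k`-forms: the complex span of the products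
`ξ_1 ∧ ⋯ ∧ ξ_p ∧ η_1 ∧ ⋯ ∧ η_q` with `ξ_i` of type `(1,0)` (that is `ξ ∘ J = √-1 ξ`) and `η_j` of
type `(0,1)` (that is `η ∘ J = -√-1 η`), where `p + q = k`.  A product of `k` complex-valued
one-forms is evaluated as a determinant. -/
def formsOfType (J : V →L[ℝ] V) (p q k : ℕ) : Submodule ℂ (V [⋀^Fin k]→L[ℝ] ℂ) :=
  Submodule.span ℂ {a | p + q = k ∧ ∃ ξ : Fin k → (V →L[ℝ] ℂ),
    (∀ i : Fin k, (i : ℕ) < p → ∀ v, ξ i (J v) = Complex.I * ξ i v) ∧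
    (∀ i : Fin k, p ≤ (i : ℕ) → ∀ v, ξ i (J v) = -Complex.I * ξ i v) ∧
    ∀ v, a v = Matrix.det (Matrix.of fun i j => ξ i (v j))}

variable [IsTopologicalAddGroup V] [ContinuousConstSMul ℝ V]

/-- The circle action `exp (t J) = cos t + sin t · J` on `V`. -/
def rot (J : V →L[ℝ] V) (t : ℝ) : V →L[ℝ] V :=
  Real.cos t • ContinuousLinearMap.id ℝ V + Real.sin t • J

/-- The projection of a `k`-form to its component of type `(p,q)`; it vanishes unless `p, q ≥ 0` and
`p + q = k`.  The circle action `exp (t J)` multiplies the forms of type `(p,q)` by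
`exp (√-1 (p - q) t)`, and on `k`-forms any two of these weights differ by at most `2 k`, so that
averaging over the roots of unity of order `2 k + 1` extracts a single type; see
`typeProj_of_mem`. -/
def typeProj (J : V →L[ℝ] V) (p q : ℤ) {k : ℕ} (a : V [⋀^Fin k]→L[ℝ] ℂ) :
    V [⋀^Fin k]→L[ℝ] ℂ :=
  if 0 ≤ p ∧ 0 ≤ q ∧ p + q = k then
    ((2 * k + 1 : ℕ) : ℂ)⁻¹ • ∑ j ∈ Finset.range (2 * k + 1),
      Complex.exp (-(((p - q : ℤ) : ℂ) * (2 * Real.pi * j / (2 * k + 1 : ℕ)) * Complex.I)) •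
        a.compContinuousLinearMap (rot J (2 * Real.pi * j / (2 * k + 1 : ℕ)))
  else 0

theorem typeProj_add (J : V →L[ℝ] V) (p q : ℤ) {k : ℕ} (a b : V [⋀^Fin k]→L[ℝ] ℂ) :
    typeProj J p q (a + b) = typeProj J p q a + typeProj J p q b := by
  unfold typeProj
  split_ifs
  · ext v
    simp [mul_add, Finset.sum_add_distrib]
  · simp

theorem typeProj_smul (J : V →L[ℝ] V) (p q : ℤ) {k : ℕ} (c : ℂ) (a : V [⋀^Fin k]→L[ℝ] ℂ) :
    typeProj J p q (c • a) = c • typeProj J p q a := by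
  unfold typeProj
  split_ifs
  · ext v
    simp only [ContinuousAlternatingMap.smul_apply, ContinuousAlternatingMap.sum_apply, smul_eq_mul,
      Finset.mul_sum, ContinuousAlternatingMap.compContinuousLinearMap_apply]
    refine Finset.sum_congr rfl fun j _ => ?_
    ring
  · ext v
    simp

theorem exp_prod_type {k : ℕ} (p : ℕ) (hp : p ≤ k) (t : ℂ) :
    ∏ i : Fin k, (if (i : ℕ) < p then Complex.exp (t * Complex.I)
      else Complex.exp (-(t * Complex.I))) =
      Complex.exp (((p : ℂ) - ((k - p : ℕ) : ℂ)) * t * Complex.I) := by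
  obtain ⟨q, rfl⟩ := Nat.exists_eq_add_of_le hp
  rw [Fin.prod_univ_add]
  simp only [Fin.val_castAdd, Fin.is_lt, if_true, Fin.val_natAdd, Finset.prod_const,
    Finset.card_univ, Fintype.card_fin, add_tsub_cancel_left]
  have : ∀ i : ℕ, ¬ (p + i < p) := by omega
  simp only [this, if_false, Finset.prod_const, Finset.card_univ, Fintype.card_fin]
  rw [← Complex.exp_nat_mul, ← Complex.exp_nat_mul, ← Complex.exp_add]
  congr 1
  ring

theorem comp_rot_of_generator (J : V →L[ℝ] V) {p q k : ℕ} (h : p + q = k)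
    (a : V [⋀^Fin k]→L[ℝ] ℂ) (ξ : Fin k → (V →L[ℝ] ℂ))
    (h₁ : ∀ i : Fin k, (i : ℕ) < p → ∀ v, ξ i (J v) = Complex.I * ξ i v)
    (h₂ : ∀ i : Fin k, p ≤ (i : ℕ) → ∀ v, ξ i (J v) = -Complex.I * ξ i v)
    (ha : ∀ v, a v = Matrix.det (Matrix.of fun i j => ξ i (v j))) (t : ℝ) :
    a.compContinuousLinearMap (rot J t) =
      Complex.exp (((p : ℂ) - (q : ℂ)) * t * Complex.I) • a := by
  ext v
  have key : ∀ i j, ξ i (rot J t (v j)) = (if (i : ℕ) < p then Complex.exp (t * Complex.I)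
      else Complex.exp (-(t * Complex.I))) * ξ i (v j) := by
    intro i j
    have e₁ : Complex.exp (t * Complex.I) = Real.cos t + Real.sin t * Complex.I := by
      rw [Complex.exp_mul_I]; simp
    have e₂ : Complex.exp (-(t * Complex.I)) = Real.cos t - Real.sin t * Complex.I := by
      rw [← neg_mul, Complex.exp_mul_I]; simp [sub_eq_add_neg]
    simp only [rot, add_apply, smul_apply, map_add,
      map_smul, ContinuousLinearMap.id_apply, Complex.real_smul]
    split_ifs with hi
    · rw [h₁ i hi, e₁]; ring
    · rw [h₂ i (not_lt.mp hi), e₂]; ring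
  have hq : k - p = q := by omega
  simp only [ContinuousAlternatingMap.compContinuousLinearMap_apply,
    ContinuousAlternatingMap.smul_apply, ha, smul_eq_mul]
  have : (Matrix.of fun i j : Fin k => ξ i ((⇑(rot J t) ∘ v) j)) = Matrix.of fun i j : Fin k =>
      (if (i : ℕ) < p then Complex.exp (t * Complex.I)
      else Complex.exp (-(t * Complex.I))) * (Matrix.of fun i j : Fin k => ξ i (v j)) i j := by
    ext i j
    simp [key]
  rw [this, Matrix.det_mul_column, exp_prod_type p (by omega), hq]

theorem sum_exp_weight {k : ℕ} (w : ℤ) (hw : w.natAbs ≤ 2 * k) :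
    ∑ j ∈ Finset.range (2 * k + 1),
      Complex.exp ((w : ℂ) * (2 * Real.pi * j / (2 * k + 1 : ℕ)) * Complex.I) =
      if w = 0 then ((2 * k + 1 : ℕ) : ℂ) else 0 := by
  split_ifs with h
  · subst h; simp
  · set z := Complex.exp ((w : ℂ) * (2 * Real.pi / (2 * k + 1 : ℕ)) * Complex.I) with hz
    have hm : ((2 * k + 1 : ℕ) : ℂ) ≠ 0 := by exact_mod_cast Nat.succ_ne_zero (2 * k)
    have hpow : ∀ j : ℕ, Complex.exp ((w : ℂ) * (2 * Real.pi * j / (2 * k + 1 : ℕ)) * Complex.I)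
        = z ^ j := by
      intro j
      rw [hz, ← Complex.exp_nat_mul]
      congr 1
      ring
    have hz1 : z ≠ 1 := by
      intro h1
      rw [hz, Complex.exp_eq_one_iff] at h1
      obtain ⟨n, hn⟩ := h1
      have hpi : (Real.pi : ℂ) ≠ 0 := by exact_mod_cast Real.pi_ne_zero
      have h2 : (w : ℂ) = n * ((2 * k + 1 : ℕ) : ℂ) := by
        field_simp at hn
        linear_combination hn
      have h3 : w = n * ((2 * k + 1 : ℕ) : ℤ) := by exact_mod_cast h2
      have h4 : ((2 * k + 1 : ℕ) : ℤ) ∣ w := ⟨n, by rw [h3]; ring⟩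
      have h5 := Nat.le_of_dvd (Int.natAbs_pos.mpr h) (Int.natCast_dvd.mp h4)
      omega
    have hzm : z ^ (2 * k + 1) = 1 := by
      rw [hz, ← Complex.exp_nat_mul, Complex.exp_eq_one_iff]
      refine ⟨w, ?_⟩
      field_simp
    simp_rw [hpow]
    rw [geom_sum_eq hz1, hzm]
    simp

/-- On forms of type `(p,q)` the projection to type `(p',q')` is the identity if `p' = p` and
zero otherwise. -/
theorem typeProj_of_mem (J : V →L[ℝ] V) {p q k : ℕ} {a : V [⋀^Fin k]→L[ℝ] ℂ}
    (ha : a ∈ formsOfType J p q k) {p' q' : ℤ} (hp : 0 ≤ p') (hq : 0 ≤ q') (hk : p' + q' = k) :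
    typeProj J p' q' a = if p' = p then a else 0 := by
  induction ha using Submodule.span_induction with
  | zero =>
    unfold typeProj
    ext v
    split_ifs <;> simp
  | add a b _ _ iha ihb => rw [typeProj_add, iha, ihb]; split_ifs <;> simp
  | smul c a _ iha => rw [typeProj_smul, iha]; split_ifs <;> (ext v; simp)
  | mem a ha =>
    obtain ⟨h, ξ, h₁, h₂, hdet⟩ := ha
    have hm : ((2 * k + 1 : ℕ) : ℂ) ≠ 0 := by exact_mod_cast Nat.succ_ne_zero (2 * k)
    rw [typeProj, if_pos ⟨hp, hq, hk⟩]
    simp_rw [comp_rot_of_generator J h a ξ h₁ h₂ hdet, smul_smul, ← Complex.exp_add]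
    rw [← Finset.sum_smul, smul_smul]
    have := sum_exp_weight (k := k) (((p : ℤ) - q) - (p' - q')) (by omega)
    have hsum : ∑ j ∈ Finset.range (2 * k + 1),
        Complex.exp (-(((p' - q' : ℤ) : ℂ) * (2 * Real.pi * j / (2 * k + 1 : ℕ)) * Complex.I) +
          ((p : ℂ) - (q : ℂ)) * ((2 * Real.pi * j / (2 * k + 1 : ℕ) : ℝ) : ℂ) * Complex.I) =
        if p' = p then ((2 * k + 1 : ℕ) : ℂ) else 0 := by
      have hiff : (((p : ℤ) - q) - (p' - q') = 0) ↔ p' = p := by omega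
      simp only [hiff] at this
      rw [← this]
      refine Finset.sum_congr rfl fun j _ => ?_
      congr 1
      push_cast
      ring
    rw [hsum]
    split_ifs
    · rw [inv_mul_cancel₀ hm, one_smul]
    · ext v
      simp

end LinearAlgebra

/-! ### Complex-valued differential forms on a 6-manifold -/

/-- The model space `ℝ⁶`. -/
abbrev E6 : Type := EuclideanSpace ℝ (Fin 6)

section Forms

variable (M : Type*) [TopologicalSpace M] [ChartedSpace E6 M]

/-- Complex-valued `k`-forms on `M` (sections, not required to be smooth). -/
abbrev Form (k : ℕ) : Type _ := (x : M) → (TangentSpace 𝓘(ℝ, E6) x) [⋀^Fin k]→L[ℝ] ℂ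

/-- Complex-valued forms of mixed degree: `α k` is the component of degree `k`
(which is zero for `k > 6`, as there are no other forms). -/
abbrev GForm : Type _ := (k : ℕ) → Form M k

variable {M}

/-- The expression of a `k`-form in the chart around `c`: its pullback by the inverse chart. -/
def Form.inChart {k : ℕ} (α : Form M k) (c : M) : E6 → E6 [⋀^Fin k]→L[ℝ] ℂ := fun y =>
  (α ((extChartAt 𝓘(ℝ, E6) c).symm y)).compContinuousLinearMap
    (mfderiv 𝓘(ℝ, E6) 𝓘(ℝ, E6) (extChartAt 𝓘(ℝ, E6) c).symm y)

/-- A form is smooth if all its expressions in the charts are. -/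
def Form.IsSmooth {k : ℕ} (α : Form M k) : Prop :=
  ∀ c : M, ContDiffOn ℝ ∞ (α.inChart c) (extChartAt 𝓘(ℝ, E6) c).target

/-- Smoothness of a form of mixed degree; the smooth forms make up the de Rham algebra `Λ^*(M)`. -/
def GForm.IsSmooth (α : GForm M) : Prop := ∀ k, Form.IsSmooth (α k)

/-- The de Rham differential of a `k`-form: at `x`, the exterior derivative of the expression
in the chart around `x`, pulled back by that chart. -/
def extD {k : ℕ} (α : Form M k) : Form M (k + 1) := fun x =>
  (extDeriv (α.inChart x) (extChartAt 𝓘(ℝ, E6) x x)).compContinuousLinearMap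
    (mfderiv 𝓘(ℝ, E6) 𝓘(ℝ, E6) (extChartAt 𝓘(ℝ, E6) x) x)

/-- The component `d^{i,j} : Λ^{p,q}(M) → Λ^{p+i,q+j}(M)` of the de Rham differential
with respect to the endomorphism field `J`: on `k`-forms, the sum over `p + q = k` of `d` restricted
to `Λ^{p,q}` and followed by the projection to `Λ^{p+i,q+j}`. -/
def deRhamComponent (J : (x : M) → TangentSpace 𝓘(ℝ, E6) x →L[ℝ] TangentSpace 𝓘(ℝ, E6) x)
    (i j : ℤ) (α : GForm M) : GForm M
  | 0 => fun _ => 0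
  | k + 1 => fun x => ∑ p ∈ Finset.range (k + 1),
      typeProj (J x) ((p : ℤ) + i) ((k : ℤ) - p + j)
        (extD (fun y => typeProj (J y) p ((k : ℤ) - p) (α k y)) x)

/-- The operator `L_ω(η) = ω ∧ η` for the two-form `ω = om`. -/
def lefschetz (om : Form M 2) (α : GForm M) : GForm M
  | 0 => fun _ => 0
  | 1 => fun _ => 0
  | k + 2 => fun x => wedge (Nat.add_comm 2 k) (om x) (α k x)

/-- The commutator of two operators on forms. -/
def commutator (A B : GForm M → GForm M) (α : GForm M) : GForm M := A (B α) - B (A α)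

end Forms

/-! ### Metrics, adjoints and nearly Kähler structures -/

section Metric

variable {M : Type*} [TopologicalSpace M] [ChartedSpace E6 M]
  [RiemannianBundle (fun x : M => TangentSpace 𝓘(ℝ, E6) x)]

instance (x : M) : FiniteDimensional ℝ (TangentSpace 𝓘(ℝ, E6) x) :=
  inferInstanceAs (FiniteDimensional ℝ E6)

/-- The Hermitian product on `⨁_k Λ^k T^*_x M ⊗ ℂ` induced by the metric, for which the products
`e^{i_1} ∧ ⋯ ∧ e^{i_k}`, `i_1 < ⋯ < i_k`, of the elements of an orthonormal coframe are
orthonormal.  (The sum over all index tuples counts each of these products `k!` times.) -/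
def fiberInner (x : M) (a b : (k : ℕ) → (TangentSpace 𝓘(ℝ, E6) x) [⋀^Fin k]→L[ℝ] ℂ) : ℂ :=
  ∑ k ∈ Finset.range 7, ((k.factorial : ℂ))⁻¹ *
    ∑ f : Fin k → Fin (Module.finrank ℝ (TangentSpace 𝓘(ℝ, E6) x)),
      a k (fun i => stdOrthonormalBasis ℝ (TangentSpace 𝓘(ℝ, E6) x) (f i)) *
        (starRingEnd ℂ) (b k (fun i => stdOrthonormalBasis ℝ (TangentSpace 𝓘(ℝ, E6) x) (f i)))

/-- `B` is the (pointwise) Hermitian adjoint of `A`. -/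
def IsHermitianAdjoint (A B : GForm M → GForm M) : Prop :=
  ∀ α β : GForm M, α.IsSmooth → ∀ x : M,
    fiberInner x (fun k => A α k x) (fun k => β k x) =
      fiberInner x (fun k => α k x) (fun k => B β k x)

open Classical in
/-- The Hermitian adjoint `A^*` of a `C^∞(M)`-linear operator `A` on forms: `(A^* β)(x)` is the
vector that represents the functional `α ↦ ⟨(A α)(x), β(x)⟩` on smooth forms `α`
(and zero should there be no such vector). -/
def hermitianAdjoint (A : GForm M → GForm M) (β : GForm M) : GForm M := fun k x =>
  if h : ∃ w : (k : ℕ) → (TangentSpace 𝓘(ℝ, E6) x) [⋀^Fin k]→L[ℝ] ℂ,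
      ∀ α : GForm M, α.IsSmooth →
        fiberInner x (fun k => A α k x) (fun k => β k x) = fiberInner x (fun k => α k x) w
  then h.choose k else 0

variable (M) in
/-- An almost Hermitian structure on the Riemannian 6-manifold `M`: a smooth almost complex
structure `J` that preserves the metric `g`, with its Hermitian form `ω = g(J ·, ·)`,
denoted `om`. -/
structure AlmostHermitianStructure [IsManifold 𝓘(ℝ, E6) ∞ M] where
  J : (x : M) → TangentSpace 𝓘(ℝ, E6) x →L[ℝ] TangentSpace 𝓘(ℝ, E6) x
  smooth_J : ContMDiff 𝓘(ℝ, E6) (𝓘(ℝ, E6).prod 𝓘(ℝ, E6 →L[ℝ] E6)) ∞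
    (fun x => TotalSpace.mk' (E6 →L[ℝ] E6)
      (E := fun x : M => TangentSpace 𝓘(ℝ, E6) x →L[ℝ] TangentSpace 𝓘(ℝ, E6) x) x (J x))
  J_sq : ∀ x v, J x (J x v) = -v
  inner_J : ∀ x v w, inner ℝ (J x v) (J x w) = inner ℝ v w
  om : Form M 2
  smooth_om : om.IsSmooth
  om_apply : ∀ x v w, om x ![v, w] = ((inner ℝ (J x v) w : ℝ) : ℂ)

variable (M) in
/-- An `SU(3)`-structure on `M`: an almost Hermitian structure with a smooth `(3,0)`-form `Ω` which
at each point is `θ_1 ∧ θ_2 ∧ θ_3`, where `θ_i = u_i^* + √-1 (J u_i)^*` for an orthonormal basis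
`u_1, J u_1, u_2, J u_2, u_3, J u_3` of the tangent space
(as `Ω` is of type `(3,0)`, this means that `Ω(u_1, u_2, u_3) = 1`). -/
structure SU3Structure [IsManifold 𝓘(ℝ, E6) ∞ M] extends AlmostHermitianStructure M where
  Ω : Form M 3
  smooth_Ω : Ω.IsSmooth
  Ω_type : ∀ x, Ω x ∈ formsOfType (J x) 3 0 3
  normalized : ∀ x, ∃ u : Fin 3 → TangentSpace 𝓘(ℝ, E6) x,
    (∀ i j, inner ℝ (u i) (u j) = if i = j then (1 : ℝ) else 0) ∧
    (∀ i j, inner ℝ (u i) (J x (u j)) = (0 : ℝ)) ∧ Ω x u = 1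

variable [IsManifold 𝓘(ℝ, E6) ∞ M]

/-- The nearly Kähler equations `dω = 3 λ Re Ω` and `d Im Ω = -2 λ ω ∧ ω`,
for a nonzero real constant `λ`. -/
def SU3Structure.IsNearlyKahler (S : SU3Structure M) : Prop :=
  ∃ lam : ℝ, lam ≠ 0 ∧
    (∀ x, extD S.om x = (3 * lam : ℂ) • reForm (S.Ω x)) ∧
    (∀ x, extD (fun y => imForm (S.Ω y)) x =
      (-2 * lam : ℂ) • wedge (rfl : 2 + 2 = 4) (S.om x) (S.om x))

/-- `N = d^{2,-1}`. -/
def AlmostHermitianStructure.N (S : AlmostHermitianStructure M) : GForm M → GForm M :=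
  deRhamComponent S.J 2 (-1)

/-- `N̄ = d^{-1,2}`. -/
def AlmostHermitianStructure.Nbar (S : AlmostHermitianStructure M) : GForm M → GForm M :=
  deRhamComponent S.J (-1) 2

/-- The operator `L_ω`. -/
def AlmostHermitianStructure.L (S : AlmostHermitianStructure M) : GForm M → GForm M :=
  lefschetz S.om

/-- The operator `Λ_ω`, the Hermitian adjoint of `L_ω`. -/
def AlmostHermitianStructure.Lam (S : AlmostHermitianStructure M) : GForm M → GForm M :=
  hermitianAdjoint S.L

/-- The Hermitian adjoint `N^*`. -/
def AlmostHermitianStructure.Nadj (S : AlmostHermitianStructure M) : GForm M → GForm M :=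
  hermitianAdjoint S.N

/-- The Hermitian adjoint `N̄^*`. -/
def AlmostHermitianStructure.Nbaradj (S : AlmostHermitianStructure M) : GForm M → GForm M :=
  hermitianAdjoint S.Nbar

end Metric

end NearlyKahler
end

/-!
The operators in the four identities turn out to be of order zero, so that the identities are
statements about the exterior algebra of a single tangent space.

*The torsion.* A form `β` of type `(p,q)` satisfies `D_J β = √-1 (p - q) β`, where `D_J` is the
derivation of the exterior algebra defined by the almost complex structure `J`. Differentiating
this equation expresses the part of type `(p + 1, q - 1)` of the derivatives of `β` by `β` itself
and the derivatives of `J`. Hence `N = d^{2,-1}` is an algebraic operator (`typeProj_extDeriv`,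
`deRhamComponent_two_neg_one`). As the derivatives of `J` anticommute with `J`, this operator has
the form `∑ A i m θₘ₊₁ ∧ θₘ₊₂ ∧ s̄ᵢ` in a unitary coframe `θ`, where `s̄ᵢ` is the contraction dual
to `θ̄ᵢ` and indices are taken modulo three (`ComplexFrame.exists_torsionOp_eq`). The coefficients
can be read off from the value of `N` on `Ω̄`. This value is the component of type `(2,2)` of
`dΩ̄`; since `Re Ω` is closed, being a multiple of `dω`, the nearly Kähler equations give `dΩ̄ = 2
√-1 λ ω ∧ ω`, and hence `N = √-1 λ ∑ θₘ₊₁ ∧ θₘ₊₂ ∧ s̄ₘ`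
(`ComplexFrame.eq_torsion_of_apply_conj_vol`, `SU3Structure.IsNearlyKahlerWith.N_apply`).

*The commutators.* The identity `[L, N^*] = 2 √-1 N̄` now follows from the Clifford relations
between multiplications and contractions (`ComplexFrame.lefschetzOp_torsionAdj`), and its adjoint
is `[Λ, N] = 2 √-1 N̄^*` (`ComplexFrame.IsUnitary.lambdaOp_torsion`). The other two identities are
these for the conjugate structure `(-J, -ω, Ω̄)`, which is nearly Kähler with constant `-λ`: the
conjugation exchanges `N` and `N̄` and changes the signs of `L` and `Λ` (`SU3Structure.conj`).

*From fibres to the manifold.* Every form at a point is the value of a smooth form, so that the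
adjoint of an operator of order zero is given by the adjoints on the fibres
(`exists_isSmooth_apply_eq`, `hermitianAdjoint_apply`). The operator `N` may be applied to `Λ α`,
for a smooth form `α`, because `Λ α` is smooth (`SU3Structure.isSmooth_Lam`); this follows from an
expression of `Λ` in terms of the inverse of the coefficient matrix of `ω`
(`ComplexFrame.lambdaOp_eq`).
-/

noncomputable section

namespace NearlyKahler

/-! ### Exterior multiplication, contraction and derivations -/

section Operators

variable {V : Type*} [NormedAddCommGroup V] [NormedSpace ℝ V]

-- The laws of the complex module structure are restated for forms, so that rewriting does not have
-- to find this structure, next to the real one, anew each time.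
@[simp] theorem form_zero_smul {k : ℕ} (b : V [⋀^Fin k]→L[ℝ] ℂ) : (0 : ℂ) • b = 0 := zero_smul ℂ b

@[simp] theorem form_smul_zero {k : ℕ} (c : ℂ) : c • (0 : V [⋀^Fin k]→L[ℝ] ℂ) = 0 := by
  ext v
  simp

theorem form_add_smul {k : ℕ} (c d : ℂ) (b : V [⋀^Fin k]→L[ℝ] ℂ) :
    (c + d) • b = c • b + d • b := add_smul c d b

theorem form_sub_smul {k : ℕ} (c d : ℂ) (b : V [⋀^Fin k]→L[ℝ] ℂ) :
    (c - d) • b = c • b - d • b := sub_smul c d b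

theorem form_neg_smul {k : ℕ} (c : ℂ) (b : V [⋀^Fin k]→L[ℝ] ℂ) : (-c) • b = -(c • b) := neg_smul c b

theorem form_eq_zero_of_smul {k : ℕ} {c : ℂ} (hc : c ≠ 0) {b : V [⋀^Fin k]→L[ℝ] ℂ}
    (h : c • b = 0) : b = 0 := by
  rw [← one_smul ℂ b, ← inv_mul_cancel₀ hc, ← smul_smul, h, form_smul_zero]

/-- Complex-valued alternating forms of mixed degree on `V`.  All degrees are allowed, including
those above the dimension of `V`, in which the forms vanish. -/
abbrev MixedForm (V : Type*) [NormedAddCommGroup V] [NormedSpace ℝ V] : Type _ :=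
  (k : ℕ) → V [⋀^Fin k]→L[ℝ] ℂ

theorem mixedForm_smul_zero (c : ℂ) : c • (0 : MixedForm V) = 0 := smul_zero (A := MixedForm V) c

theorem mixedForm_zero_smul (a : MixedForm V) : (0 : ℂ) • a = 0 := zero_smul ℂ a

theorem mixedForm_sum_smul {ι : Type*} (s : Finset ι) (c : ι → ℂ) (a : MixedForm V) :
    (∑ i ∈ s, c i) • a = ∑ i ∈ s, c i • a :=
  Finset.sum_smul (R := ℂ) (M := MixedForm V)

theorem mixedForm_smul_sum {ι : Type*} (s : Finset ι) (c : ℂ) (a : ι → MixedForm V) :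
    c • ∑ i ∈ s, a i = ∑ i ∈ s, c • a i := Finset.smul_sum

/-- The product `ξ ∧ a` of a one-form and a `k`-form. -/
def extForm {k : ℕ} (ξ : V →L[ℝ] ℂ) (a : V [⋀^Fin k]→L[ℝ] ℂ) : V [⋀^Fin (k + 1)]→L[ℝ] ℂ :=
  ContinuousAlternatingMap.alternatizeUncurryFin (ξ.smulRight a)

theorem extForm_apply {k : ℕ} (ξ : V →L[ℝ] ℂ) (a : V [⋀^Fin k]→L[ℝ] ℂ) (v : Fin (k + 1) → V) :
    extForm ξ a v = ∑ i : Fin (k + 1), (-1) ^ (i : ℕ) * (ξ (v i) * a (i.removeNth v)) := by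
  simp [extForm, ContinuousAlternatingMap.alternatizeUncurryFin_apply]

theorem extForm_add_left {k : ℕ} (ξ η : V →L[ℝ] ℂ) (a : V [⋀^Fin k]→L[ℝ] ℂ) :
    extForm (ξ + η) a = extForm ξ a + extForm η a := by
  ext v
  simp [extForm_apply, add_mul, mul_add, Finset.sum_add_distrib]

theorem extForm_smul_left {k : ℕ} (c : ℂ) (ξ : V →L[ℝ] ℂ) (a : V [⋀^Fin k]→L[ℝ] ℂ) :
    extForm (c • ξ) a = c • extForm ξ a := by
  ext v
  simp only [extForm_apply, smul_apply, ContinuousAlternatingMap.smul_apply, smul_eq_mul,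
    Finset.mul_sum]
  exact Finset.sum_congr rfl fun i _ => by ring

theorem extForm_add {k : ℕ} (ξ : V →L[ℝ] ℂ) (a b : V [⋀^Fin k]→L[ℝ] ℂ) :
    extForm ξ (a + b) = extForm ξ a + extForm ξ b := by
  ext v
  simp [extForm_apply, mul_add, Finset.sum_add_distrib]

theorem extForm_smul {k : ℕ} (ξ : V →L[ℝ] ℂ) (c : ℂ) (a : V [⋀^Fin k]→L[ℝ] ℂ) :
    extForm ξ (c • a) = c • extForm ξ a := by
  ext v
  simp only [extForm_apply, ContinuousAlternatingMap.smul_apply, smul_eq_mul, Finset.mul_sum]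
  exact Finset.sum_congr rfl fun i _ => by ring

/-- Left multiplication by a one-form. -/
def extOp (ξ : V →L[ℝ] ℂ) : Module.End ℂ (MixedForm V) where
  toFun a
    | 0 => 0
    | k + 1 => extForm ξ (a k)
  map_add' a b := by
    funext k
    cases k with
    | zero => simp
    | succ k => exact extForm_add ξ (a k) (b k)
  map_smul' c a := by
    funext k
    cases k with
    | zero => exact (form_smul_zero c).symm
    | succ k => exact extForm_smul ξ c (a k)

@[simp] theorem extOp_apply_zero (ξ : V →L[ℝ] ℂ) (a : MixedForm V) : extOp ξ a 0 = 0 := rfl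

@[simp] theorem extOp_apply_succ (ξ : V →L[ℝ] ℂ) (a : MixedForm V) (k : ℕ) :
    extOp ξ a (k + 1) = extForm ξ (a k) := rfl

/-- Contraction of the first argument with a vector. -/
def intOp (v : V) : Module.End ℂ (MixedForm V) where
  toFun a k := (a (k + 1)).curryLeft v
  map_add' _ _ := rfl
  map_smul' _ _ := rfl

theorem intOp_apply (v : V) (a : MixedForm V) (k : ℕ) : intOp v a k = (a (k + 1)).curryLeft v := rfl

theorem intOp_apply_apply (v : V) (a : MixedForm V) (k : ℕ) (w : Fin k → V) :
    intOp v a k w = a (k + 1) (Matrix.vecCons v w) := rfl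

/-- A form of positive degree is determined by its contractions. -/
theorem form_ext {k : ℕ} {a b : V [⋀^Fin (k + 1)]→L[ℝ] ℂ}
    (h : ∀ v, a.curryLeft v = b.curryLeft v) : a = b := by
  ext v
  have := congrArg (fun c => c (Matrix.vecTail v)) (h (Matrix.vecHead v))
  simpa only [ContinuousAlternatingMap.curryLeft_apply_apply, Matrix.cons_head_tail] using this

@[simp] theorem extOp_add (ξ η : V →L[ℝ] ℂ) : extOp (ξ + η) = extOp ξ + extOp η := by
  refine LinearMap.ext fun a => funext fun k => ?_
  cases k with
  | zero => simp
  | succ k => exact extForm_add_left ξ η (a k)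

@[simp] theorem extOp_smul (c : ℂ) (ξ : V →L[ℝ] ℂ) : extOp (c • ξ) = c • extOp ξ := by
  refine LinearMap.ext fun a => funext fun k => ?_
  cases k with
  | zero => simp
  | succ k => exact extForm_smul_left c ξ (a k)

/-- `extOp` as a linear map. -/
def extOpₗ : (V →L[ℝ] ℂ) →ₗ[ℂ] Module.End ℂ (MixedForm V) where
  toFun := extOp
  map_add' := extOp_add
  map_smul' := extOp_smul

theorem extOp_sum {ι : Type*} (s : Finset ι) (ξ : ι → V →L[ℝ] ℂ) :
    extOp (∑ i ∈ s, ξ i) = ∑ i ∈ s, extOp (ξ i) := map_sum extOpₗ ξ s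

@[simp] theorem intOp_add (v w : V) : intOp (v + w) = intOp v + intOp w := by
  refine LinearMap.ext fun a => funext fun k => ?_
  exact map_add (a (k + 1)).curryLeft v w

@[simp] theorem intOp_smul (c : ℝ) (v : V) : intOp (c • v) = (c : ℂ) • intOp v := by
  refine LinearMap.ext fun a => funext fun k => ?_
  ext w
  simp [intOp_apply]

@[simp] theorem intOp_zero : intOp (0 : V) = 0 := by
  simpa using intOp_smul 0 (0 : V)

@[simp] theorem intOp_neg (v : V) : intOp (-v) = -intOp v := by
  rw [← neg_one_smul ℝ v, intOp_smul, Complex.ofReal_neg, Complex.ofReal_one]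
  exact neg_one_smul ℂ (intOp v)

theorem intOp_sum {ι : Type*} (s : Finset ι) (v : ι → V) :
    intOp (∑ i ∈ s, v i) = ∑ i ∈ s, intOp (v i) := by
  classical
  induction s using Finset.induction_on with
  | empty => simp
  | insert i s hi ih => simp [Finset.sum_insert hi, ih]

/-- The Clifford relation between contractions and left multiplications. -/
theorem intOp_extOp (v : V) (ξ : V →L[ℝ] ℂ) (a : MixedForm V) :
    intOp v (extOp ξ a) = ξ v • a - extOp ξ (intOp v a) := by
  funext k
  ext w
  rw [intOp_apply_apply, extOp_apply_succ, extForm_apply, Fin.sum_univ_succ]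
  cases k with
  | zero =>
    have : Fin.removeNth 0 (Matrix.vecCons v w) = w := Subsingleton.elim _ _
    simp [this]
  | succ k =>
    change _ = ξ v * a (k + 1) w - extForm ξ (intOp v a k) w
    simp only [extForm_apply, Fin.val_zero, pow_zero, one_mul, Matrix.cons_val_zero,
      Matrix.cons_val_succ, sub_eq_add_neg, ← Finset.sum_neg_distrib]
    congr 1
    refine Finset.sum_congr rfl fun i _ => ?_
    have : i.succ.removeNth (Matrix.vecCons v w) = Matrix.vecCons v (i.removeNth w) := by
      funext j
      refine Fin.cases ?_ (fun j => ?_) j <;> simp [Fin.removeNth]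
    rw [this, intOp_apply_apply, Fin.val_succ, pow_succ]
    ring

theorem intOp_intOp (v w : V) (a : MixedForm V) :
    intOp v (intOp w a) = -intOp w (intOp v a) := by
  have h : ∀ u, intOp u (intOp u a) = 0 := fun u => funext fun k =>
    ContinuousAlternatingMap.curryLeft_same (a (k + 1 + 1)) u
  have := h (v + w)
  simp only [intOp_add, LinearMap.add_apply, map_add, h, zero_add, add_zero] at this
  exact eq_neg_of_add_eq_zero_left (by rw [← this]; abel)

/-- By induction on the degree: by the Clifford relation all contractions of `ξ ∧ ξ ∧ a` are of the
same form. -/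
theorem extOp_extOp_self (ξ : V →L[ℝ] ℂ) (a : MixedForm V) : extOp ξ (extOp ξ a) = 0 := by
  have key : ∀ k : ℕ, ∀ a : MixedForm V, extOp ξ (extOp ξ a) k = 0 := by
    intro k
    induction k with
    | zero => intro a; rfl
    | succ k ih =>
      intro a
      refine form_ext fun w => ?_
      change intOp w (extOp ξ (extOp ξ a)) k = 0
      rw [intOp_extOp, intOp_extOp, map_sub, map_smul, sub_sub_cancel]
      exact ih _
  exact funext fun k => key k a

theorem extOp_extOp (ξ η : V →L[ℝ] ℂ) (a : MixedForm V) :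
    extOp ξ (extOp η a) = -extOp η (extOp ξ a) := by
  have := extOp_extOp_self (ξ + η) a
  simp only [extOp_add, LinearMap.add_apply, map_add, extOp_extOp_self, zero_add, add_zero] at this
  exact eq_neg_of_add_eq_zero_left (by rw [← this]; abel)

/-- The derivation `a ↦ ∑ i, a (v_1, …, A v_i, …, v_k)` of the exterior algebra, in degree `k`. -/
def derForm (A : V →L[ℝ] V) : {k : ℕ} → (V [⋀^Fin k]→L[ℝ] ℂ) → V [⋀^Fin k]→L[ℝ] ℂ
  | 0, _ => 0
  | _ + 1, a => ContinuousAlternatingMap.alternatizeUncurryFin (a.curryLeft ∘L A)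

/-- The derivation of the exterior algebra that extends `ξ ↦ ξ ∘ A`. -/
def derOp (A : V →L[ℝ] V) : Module.End ℂ (MixedForm V) where
  toFun a k := derForm A (a k)
  map_add' a b := by
    funext k
    cases k with
    | zero => simp [derForm]
    | succ k =>
      simp only [derForm, Pi.add_apply, ← ContinuousAlternatingMap.alternatizeUncurryFin_add]
      rfl
  map_smul' c a := by
    funext k
    cases k with
    | zero => exact (form_smul_zero c).symm
    | succ k =>
      simp only [derForm, Pi.smul_apply, RingHom.id_apply,
        ← ContinuousAlternatingMap.alternatizeUncurryFin_smul]
      rfl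

theorem derOp_apply (A : V →L[ℝ] V) (a : MixedForm V) (k : ℕ) : derOp A a k = derForm A (a k) := rfl

/-- The complex-valued coordinate functions of a basis. -/
def coordC {ι : Type*} [FiniteDimensional ℝ V] (e : Module.Basis ι ℝ V) (i : ι) : V →L[ℝ] ℂ :=
  Complex.ofRealCLM ∘L LinearMap.toContinuousLinearMap (e.coord i)

@[simp] theorem coordC_apply {ι : Type*} [FiniteDimensional ℝ V] (e : Module.Basis ι ℝ V) (i : ι)
    (v : V) : coordC e i v = (e.repr v i : ℂ) := rfl

variable {ι : Type*} [Fintype ι] [FiniteDimensional ℝ V]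

theorem alternatizeUncurryFin_eq_sum (e : Module.Basis ι ℝ V) {k : ℕ}
    (f : V →L[ℝ] V [⋀^Fin k]→L[ℝ] ℂ) :
    ContinuousAlternatingMap.alternatizeUncurryFin f = ∑ l, extForm (coordC e l) (f (e l)) := by
  ext v
  simp only [ContinuousAlternatingMap.alternatizeUncurryFin_apply,
    ContinuousAlternatingMap.sum_apply, extForm_apply]
  rw [Finset.sum_comm]
  refine Finset.sum_congr rfl fun i _ => ?_
  conv_lhs => rw [← e.sum_repr (v i), _root_.map_sum, ContinuousAlternatingMap.sum_apply]
  simp [Finset.mul_sum]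

theorem oneForm_eq_sum (e : Module.Basis ι ℝ V) (ξ : V →L[ℝ] ℂ) :
    ξ = ∑ l, ξ (e l) • coordC e l := by
  ext v
  conv_lhs => rw [← e.sum_repr v, map_sum]
  simp [mul_comm]

/-- In a basis `e` the derivation defined by `A` is `∑ eˡ ∧ ι_{A eₗ}`; its properties follow from
the Clifford relations. -/
theorem derOp_eq_sum (e : Module.Basis ι ℝ V) (A : V →L[ℝ] V) (a : MixedForm V) :
    derOp A a = ∑ l, extOp (coordC e l) (intOp (A (e l)) a) := by
  funext k
  rw [Finset.sum_apply]
  cases k with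
  | zero => simp [derOp_apply, derForm]
  | succ k =>
    rw [derOp_apply, derForm, alternatizeUncurryFin_eq_sum e]
    rfl

theorem derOp_extOp (A : V →L[ℝ] V) (ξ : V →L[ℝ] ℂ) (a : MixedForm V) :
    derOp A (extOp ξ a) = extOp (ξ ∘L A) a + extOp ξ (derOp A a) := by
  let e := Module.finBasis ℝ V
  simp only [derOp_eq_sum e, intOp_extOp, map_sub, map_smul, Finset.sum_sub_distrib, map_sum]
  rw [oneForm_eq_sum e (ξ ∘L A), extOp_sum, LinearMap.sum_apply, sub_eq_add_neg,
    ← Finset.sum_neg_distrib]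
  refine congrArg₂ _ (by simp) (Finset.sum_congr rfl fun l _ => ?_)
  rw [extOp_extOp, neg_neg]

theorem intOp_derOp (A : V →L[ℝ] V) (v : V) (a : MixedForm V) :
    intOp v (derOp A a) = intOp (A v) a + derOp A (intOp v a) := by
  let e := Module.finBasis ℝ V
  have hv : intOp (A v) a = ∑ l, coordC e l v • intOp (A (e l)) a := by
    conv_lhs => rw [← e.sum_repr v, map_sum, intOp_sum, LinearMap.sum_apply]
    simp only [map_smul, intOp_smul, LinearMap.smul_apply, coordC_apply]
  simp only [derOp_eq_sum e, map_sum, intOp_extOp, Finset.sum_sub_distrib, hv]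
  rw [sub_eq_add_neg, ← Finset.sum_neg_distrib]
  refine congrArg₂ _ rfl (Finset.sum_congr rfl fun l _ => ?_)
  rw [intOp_intOp, map_neg, neg_neg]

/-- The derivations represent the Lie algebra of endomorphisms, acting on forms from the right. -/
theorem derOp_derOp (A B : V →L[ℝ] V) (a : MixedForm V) :
    derOp A (derOp B a) = derOp B (derOp A a) + derOp (B ∘L A - A ∘L B) a := by
  have key : ∀ k : ℕ, ∀ a : MixedForm V,
      derOp A (derOp B a) k = (derOp B (derOp A a) + derOp (B ∘L A - A ∘L B) a) k := by
    intro k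
    induction k with
    | zero => intro a; simp [derOp_apply, derForm]
    | succ k ih =>
      intro a
      refine form_ext fun w => ?_
      change intOp w (derOp A (derOp B a)) k =
        intOp w (derOp B (derOp A a) + derOp (B ∘L A - A ∘L B) a) k
      have hw : (B ∘L A - A ∘L B) w = B (A w) + -A (B w) := by
        simp [sub_eq_add_neg]
      simp only [map_add, intOp_derOp, Pi.add_apply, ih, hw, intOp_add, intOp_neg,
        LinearMap.add_apply, LinearMap.neg_apply, Pi.neg_apply]
      abel
  exact funext fun k => key k a

end Operators

/-! ### Types of forms as weights of the circle action -/

section Weights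

variable {V : Type*} [NormedAddCommGroup V] [NormedSpace ℝ V]

theorem derForm_add (A : V →L[ℝ] V) {k : ℕ} (a b : V [⋀^Fin k]→L[ℝ] ℂ) :
    derForm A (a + b) = derForm A a + derForm A b := by
  have := congrFun (map_add (derOp A) (Pi.single k a : MixedForm V) (Pi.single k b)) k
  simpa [derOp_apply] using this

theorem derForm_smul (A : V →L[ℝ] V) (c : ℂ) {k : ℕ} (a : V [⋀^Fin k]→L[ℝ] ℂ) :
    derForm A (c • a) = c • derForm A a := by
  have := congrFun (map_smul (derOp A) c (Pi.single k a : MixedForm V)) k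
  simpa [derOp_apply] using this

theorem derForm_zero (A : V →L[ℝ] V) {k : ℕ} : derForm A (0 : V [⋀^Fin k]→L[ℝ] ℂ) = 0 := by
  simpa only [form_zero_smul] using derForm_smul A 0 (0 : V [⋀^Fin k]→L[ℝ] ℂ)

theorem derForm_extForm [FiniteDimensional ℝ V] (A : V →L[ℝ] V) (ξ : V →L[ℝ] ℂ) {k : ℕ}
    (a : V [⋀^Fin k]→L[ℝ] ℂ) :
    derForm A (extForm ξ a) = extForm (ξ ∘L A) a + extForm ξ (derForm A a) := by
  have := congrFun (derOp_extOp A ξ (Pi.single k a)) (k + 1)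
  simpa [derOp_apply] using this

theorem derForm_derForm [FiniteDimensional ℝ V] (A B : V →L[ℝ] V) {k : ℕ}
    (a : V [⋀^Fin k]→L[ℝ] ℂ) :
    derForm A (derForm B a) = derForm B (derForm A a) + derForm (B ∘L A - A ∘L B) a := by
  have := congrFun (derOp_derOp A B (Pi.single k a)) k
  simpa [derOp_apply] using this

theorem derForm_smul_left (c : ℝ) (A : V →L[ℝ] V) {k : ℕ} (a : V [⋀^Fin k]→L[ℝ] ℂ) :
    derForm (c • A) a = (c : ℂ) • derForm A a := by
  cases k with
  | zero => simp [derForm]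
  | succ k =>
    simp only [derForm, ContinuousLinearMap.comp_smul,
      ContinuousAlternatingMap.alternatizeUncurryFin_smul]
    ext v
    simp

theorem extForm_comp {k : ℕ} (ξ : V →L[ℝ] ℂ) (a : V [⋀^Fin k]→L[ℝ] ℂ) (A : V →L[ℝ] V) :
    (extForm ξ a).compContinuousLinearMap A =
      extForm (ξ ∘L A) (a.compContinuousLinearMap A) := by
  ext v
  simp only [ContinuousAlternatingMap.compContinuousLinearMap_apply, extForm_apply]
  rfl

/-- The component of type `(1,0)` of a one-form; the component of type `(0,1)` is
`oneZero (-J) ξ`. -/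
def oneZero (J : V →L[ℝ] V) (ξ : V →L[ℝ] ℂ) : V →L[ℝ] ℂ :=
  (2⁻¹ : ℂ) • (ξ - Complex.I • (ξ ∘L J))

theorem oneZero_apply (J : V →L[ℝ] V) (ξ : V →L[ℝ] ℂ) (v : V) :
    oneZero J ξ v = 2⁻¹ * (ξ v - Complex.I * ξ (J v)) := rfl

theorem oneZero_comp {J : V →L[ℝ] V} (hJ : ∀ v, J (J v) = -v) (ξ : V →L[ℝ] ℂ) (v : V) :
    oneZero J ξ (J v) = Complex.I * oneZero J ξ v := by
  simp only [oneZero_apply, hJ, map_neg]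
  linear_combination (2⁻¹ * ξ (J v)) * Complex.I_sq

theorem oneZero_add_oneZero_neg (J : V →L[ℝ] V) (ξ : V →L[ℝ] ℂ) :
    oneZero J ξ + oneZero (-J) ξ = ξ := by
  ext v
  simp only [add_apply, oneZero_apply, neg_apply, map_neg]
  ring

/-- The `k`-forms of weight `w` for the circle action `exp (t J)`; these are the forms of type
`(p,q)` with `p + q = k` and `p - q = w`.  The first condition is the infinitesimal version of the
second one; it is linear in `J` and is used where `J` varies, and the second one computes
`typeProj`. -/
def weightForms (J : V →L[ℝ] V) (k : ℕ) (w : ℤ) : Submodule ℂ (V [⋀^Fin k]→L[ℝ] ℂ) where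
  carrier := {b | derForm J b = (Complex.I * w) • b ∧
    ∀ t : ℝ, b.compContinuousLinearMap (rot J t) = Complex.exp (w * t * Complex.I) • b}
  add_mem' {a b} ha hb := by
    refine ⟨by rw [derForm_add, ha.1, hb.1, smul_add], fun t => ?_⟩
    rw [smul_add, ← ha.2, ← hb.2]
    rfl
  zero_mem' := by
    refine ⟨by rw [derForm_zero, smul_zero], fun t => ?_⟩
    rw [smul_zero]
    rfl
  smul_mem' c a ha := by
    refine ⟨by rw [derForm_smul, ha.1, smul_comm], fun t => ?_⟩
    rw [smul_comm, ← ha.2]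
    rfl

theorem derForm_extForm_of_weight [FiniteDimensional ℝ V] {J : V →L[ℝ] V} {ξ : V →L[ℝ] ℂ}
    {ε : ℤ} (hξ : ∀ v, ξ (J v) = (Complex.I * ε) * ξ v) {k : ℕ} {w : ℤ}
    {b : V [⋀^Fin k]→L[ℝ] ℂ} (hb : derForm J b = (Complex.I * w) • b) :
    derForm J (extForm ξ b) = (Complex.I * (w + ε : ℤ)) • extForm ξ b := by
  have h : ξ ∘L J = (Complex.I * ε) • ξ := ContinuousLinearMap.ext hξ
  rw [derForm_extForm, hb, h, extForm_smul, extForm_smul_left, ← form_add_smul]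
  congr 1
  push_cast
  ring

theorem extForm_mem_weightForms [FiniteDimensional ℝ V] {J : V →L[ℝ] V} {ξ : V →L[ℝ] ℂ}
    {ε : ℤ} (hε : ε = 1 ∨ ε = -1) (hξ : ∀ v, ξ (J v) = (Complex.I * ε) * ξ v) {k : ℕ} {w : ℤ}
    {b : V [⋀^Fin k]→L[ℝ] ℂ} (hb : b ∈ weightForms J k w) :
    extForm ξ b ∈ weightForms J (k + 1) (w + ε) := by
  refine ⟨derForm_extForm_of_weight hξ hb.1, fun t => ?_⟩
  have h : ξ ∘L rot J t = Complex.exp (ε * t * Complex.I) • ξ := by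
    ext v
    have e : Complex.exp (ε * t * Complex.I) = Real.cos t + Complex.I * ε * Real.sin t := by
      rw [Complex.exp_mul_I]
      rcases hε with rfl | rfl <;> simp <;> ring
    rw [e]
    simp only [rot, ContinuousLinearMap.comp_apply, add_apply, smul_apply, map_add, map_smul,
      ContinuousLinearMap.id_apply, hξ, Complex.real_smul, smul_eq_mul]
    ring
  rw [extForm_comp, hb.2, h, extForm_smul, extForm_smul_left, smul_smul, ← Complex.exp_add]
  congr 2
  push_cast
  ring

theorem zeroForm_mem_weightForms (J : V →L[ℝ] V) (b : V [⋀^Fin 0]→L[ℝ] ℂ) :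
    b ∈ weightForms J 0 0 := by
  refine ⟨by simp [derForm], fun t => ?_⟩
  ext v
  simp [Subsingleton.elim (⇑(rot J t) ∘ v) v]

/-- The forms of pure type span all forms: by induction, as the `(1,0)`- and the `(0,1)`-part of a
one-form map forms of pure type to forms of pure type. -/
theorem span_weightForms [FiniteDimensional ℝ V] {J : V →L[ℝ] V} (hJ : ∀ v, J (J v) = -v) (k : ℕ) :
    Submodule.span ℂ {b : V [⋀^Fin k]→L[ℝ] ℂ | ∃ p ≤ k, b ∈ weightForms J k (2 * p - k)} = ⊤ := by
  induction k with
  | zero =>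
    refine Submodule.eq_top_iff'.2 fun b => Submodule.subset_span ⟨0, le_rfl, ?_⟩
    simpa using zeroForm_mem_weightForms J b
  | succ k ih =>
    have hext : ∀ (ξ : V →L[ℝ] ℂ) (b : V [⋀^Fin k]→L[ℝ] ℂ), extForm ξ b ∈
        Submodule.span ℂ {b : V [⋀^Fin (k + 1)]→L[ℝ] ℂ |
          ∃ p ≤ k + 1, b ∈ weightForms J (k + 1) (2 * p - (k + 1 : ℕ))} := by
      intro ξ b
      have hb : b ∈ (⊤ : Submodule ℂ (V [⋀^Fin k]→L[ℝ] ℂ)) := trivial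
      rw [← ih] at hb
      induction hb using Submodule.span_induction with
      | zero =>
        have := extForm_smul ξ 0 (0 : V [⋀^Fin k]→L[ℝ] ℂ)
        rw [form_zero_smul, form_zero_smul] at this
        rw [this]
        exact Submodule.zero_mem _
      | add a b _ _ iha ihb => rw [extForm_add]; exact Submodule.add_mem _ iha ihb
      | smul c a _ iha => rw [extForm_smul]; exact Submodule.smul_mem _ c iha
      | mem b hb =>
        obtain ⟨p, hp, hb⟩ := hb
        rw [← oneZero_add_oneZero_neg J ξ, extForm_add_left]
        refine Submodule.add_mem _ (Submodule.subset_span ⟨p + 1, by omega, ?_⟩)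
          (Submodule.subset_span ⟨p, by omega, ?_⟩)
        · have := extForm_mem_weightForms (ξ := oneZero J ξ) (ε := 1) (Or.inl rfl)
            (fun v => by rw [oneZero_comp hJ]; simp) hb
          convert this using 2
          push_cast
          ring
        · have hJ' : ∀ v, (-J) ((-J) v) = -v := fun v => by simp [hJ]
          have := extForm_mem_weightForms (J := J) (ξ := oneZero (-J) ξ) (ε := -1) (Or.inr rfl)
            (fun v => by
              have := oneZero_comp hJ' ξ v
              rw [neg_apply, map_neg] at this
              rw [← neg_eq_iff_eq_neg.2 this.symm]
              push_cast
              ring) hb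
          convert this using 2
          push_cast
          ring
    refine Submodule.eq_top_iff'.2 fun b => ?_
    have hk : ((k + 1 : ℕ) : ℂ) ≠ 0 := by exact_mod_cast k.succ_ne_zero
    -- every form of positive degree is a combination of products with one-forms
    have : b = ((k + 1 : ℕ) : ℂ)⁻¹ •
        ContinuousAlternatingMap.alternatizeUncurryFin b.curryLeft := by
      rw [ContinuousAlternatingMap.alternatizeUncurryFin_curryLeft, ← Nat.cast_smul_eq_nsmul ℂ,
        smul_smul, inv_mul_cancel₀ hk, one_smul]
    rw [this, alternatizeUncurryFin_eq_sum (Module.finBasis ℝ V)]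
    exact Submodule.smul_mem _ _ (Submodule.sum_mem _ fun l _ => hext _ _)

theorem typeProj_zero (J : V →L[ℝ] V) (p q : ℤ) {k : ℕ} :
    typeProj J p q (0 : V [⋀^Fin k]→L[ℝ] ℂ) = 0 := by
  simpa only [form_zero_smul] using typeProj_smul J p q 0 (0 : V [⋀^Fin k]→L[ℝ] ℂ)

theorem typeProj_sum (J : V →L[ℝ] V) (p q : ℤ) {k : ℕ} {ι : Type*} (s : Finset ι)
    (a : ι → V [⋀^Fin k]→L[ℝ] ℂ) :
    typeProj J p q (∑ i ∈ s, a i) = ∑ i ∈ s, typeProj J p q (a i) := by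
  classical
  induction s using Finset.induction_on with
  | empty => simp [typeProj_zero]
  | insert i s hi ih => simp [Finset.sum_insert hi, ih, typeProj_add]

theorem typeProj_of_neg (J : V →L[ℝ] V) {p q : ℤ} {k : ℕ} (h : ¬ (0 ≤ p ∧ 0 ≤ q ∧ p + q = k))
    (a : V [⋀^Fin k]→L[ℝ] ℂ) : typeProj J p q a = 0 := if_neg h

theorem typeProj_of_mem_weightForms (J : V →L[ℝ] V) {k : ℕ} {w : ℤ} (hw : w.natAbs ≤ k)
    {b : V [⋀^Fin k]→L[ℝ] ℂ} (hb : b ∈ weightForms J k w) {p q : ℤ} (hp : 0 ≤ p) (hq : 0 ≤ q)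
    (hk : p + q = k) : typeProj J p q b = if p - q = w then b else 0 := by
  have hm : ((2 * k + 1 : ℕ) : ℂ) ≠ 0 := by exact_mod_cast Nat.succ_ne_zero (2 * k)
  -- the average of a character over the roots of unity of order `2 k + 1`
  rw [typeProj, if_pos ⟨hp, hq, hk⟩]
  simp_rw [hb.2, smul_smul, ← Complex.exp_add]
  rw [← Finset.sum_smul, smul_smul]
  have := sum_exp_weight (k := k) (w - (p - q)) (by omega)
  have hsum : ∑ j ∈ Finset.range (2 * k + 1),
      Complex.exp (-(((p - q : ℤ) : ℂ) * (2 * Real.pi * j / (2 * k + 1 : ℕ)) * Complex.I) +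
        (w : ℂ) * ((2 * Real.pi * j / (2 * k + 1 : ℕ) : ℝ) : ℂ) * Complex.I) =
      if p - q = w then ((2 * k + 1 : ℕ) : ℂ) else 0 := by
    have hiff : (w - (p - q) = 0) ↔ p - q = w := by omega
    simp only [hiff] at this
    rw [← this]
    refine Finset.sum_congr rfl fun j _ => ?_
    congr 1
    push_cast
    ring
  rw [hsum]
  split_ifs
  · rw [inv_mul_cancel₀ hm, one_smul]
  · rw [mul_zero, form_zero_smul]

variable [FiniteDimensional ℝ V] {J : V →L[ℝ] V}

/-- Linear statements about forms need only be checked on forms of pure type. -/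
theorem form_induction (hJ : ∀ v, J (J v) = -v) {k : ℕ} {P : (V [⋀^Fin k]→L[ℝ] ℂ) → Prop}
    (hmem : ∀ p : ℕ, p ≤ k → ∀ b ∈ weightForms J k (2 * p - k), P b) (hzero : P 0)
    (hadd : ∀ a b, P a → P b → P (a + b)) (hsmul : ∀ (c : ℂ) a, P a → P (c • a))
    (b : V [⋀^Fin k]→L[ℝ] ℂ) : P b := by
  have hb : b ∈ (⊤ : Submodule ℂ (V [⋀^Fin k]→L[ℝ] ℂ)) := trivial
  rw [← span_weightForms hJ] at hb
  induction hb using Submodule.span_induction with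
  | zero => exact hzero
  | add a b _ _ iha ihb => exact hadd _ _ iha ihb
  | smul c a _ iha => exact hsmul c _ iha
  | mem b hb =>
    obtain ⟨p, hp, hb⟩ := hb
    exact hmem p hp b hb

theorem typeProj_mem_weightForms (hJ : ∀ v, J (J v) = -v) (p q : ℤ) {k : ℕ}
    (b : V [⋀^Fin k]→L[ℝ] ℂ) :
    typeProj J p q b ∈ weightForms J k (p - q) := by
  by_cases h : 0 ≤ p ∧ 0 ≤ q ∧ p + q = k
  · obtain ⟨hp, hq, hk⟩ := h
    induction b using form_induction hJ with
    | hmem r hr b hb =>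
      rw [typeProj_of_mem_weightForms J (by omega) hb hp hq hk]
      split_ifs with h
      · rwa [h]
      · exact Submodule.zero_mem _
    | hzero => rw [typeProj_zero]; exact Submodule.zero_mem _
    | hadd a b ha hb => rw [typeProj_add]; exact Submodule.add_mem _ ha hb
    | hsmul c a ha => rw [typeProj_smul]; exact Submodule.smul_mem _ c ha
  · rw [typeProj_of_neg J h]; exact Submodule.zero_mem _

/-- A form is the sum of its components of pure type. -/
theorem sum_typeProj (hJ : ∀ v, J (J v) = -v) {k : ℕ} (b : V [⋀^Fin k]→L[ℝ] ℂ) :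
    ∑ p ∈ Finset.range (k + 1), typeProj J p ((k : ℤ) - p) b = b := by
  induction b using form_induction hJ with
  | hmem r hr b hb =>
    rw [Finset.sum_eq_single_of_mem r (Finset.mem_range.2 (by omega))]
    · rw [typeProj_of_mem_weightForms J (by omega) hb (by omega) (by omega) (by omega),
        if_pos (by ring)]
    · intro p hp hpr
      rw [Finset.mem_range] at hp
      rw [typeProj_of_mem_weightForms J (by omega) hb (by omega) (by omega) (by omega),
        if_neg (by omega)]
  | hzero => simp [typeProj_zero]
  | hadd a b ha hb => simp only [typeProj_add, Finset.sum_add_distrib, ha, hb]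
  | hsmul c a ha => simp only [typeProj_smul, ← Finset.smul_sum, ha]

/-- The derivation defined by `J` is `√-1 (p - q)` on the `(p,q)`-component, and does not mix the
components. -/
theorem typeProj_derForm (hJ : ∀ v, J (J v) = -v) (p q : ℤ) {k : ℕ} (b : V [⋀^Fin k]→L[ℝ] ℂ) :
    typeProj J p q (derForm J b) = (Complex.I * (p - q : ℤ)) • typeProj J p q b := by
  by_cases h : 0 ≤ p ∧ 0 ≤ q ∧ p + q = k
  · obtain ⟨hp, hq, hk⟩ := h
    induction b using form_induction hJ with
    | hmem r hr b hb =>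
      rw [hb.1, typeProj_smul, typeProj_of_mem_weightForms J (by omega) hb hp hq hk]
      split_ifs with h
      · rw [h]
      · simp
    | hzero => simp [typeProj_zero, derForm_zero]
    | hadd a b ha hb => rw [derForm_add, typeProj_add, typeProj_add, ha, hb, smul_add]
    | hsmul c a ha => rw [derForm_smul, typeProj_smul, typeProj_smul, ha, smul_comm]
  · simp [typeProj_of_neg J h]

theorem typeProj_eq_zero_of_weight (hJ : ∀ v, J (J v) = -v) {p q w : ℤ} (h : p - q ≠ w)
    {k : ℕ} {b : V [⋀^Fin k]→L[ℝ] ℂ} (hb : derForm J b = (Complex.I * w) • b) :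
    typeProj J p q b = 0 := by
  have h1 := typeProj_derForm hJ p q b
  rw [hb, typeProj_smul, ← sub_eq_zero, ← form_sub_smul] at h1
  refine form_eq_zero_of_smul (fun h2 => h ?_) h1
  rw [← mul_sub, mul_eq_zero, sub_eq_zero] at h2
  exact (Int.cast_injective (h2.resolve_left Complex.I_ne_zero)).symm

/-- An eigenvector of the infinitesimal circle action is of pure type. -/
theorem typeProj_eq_self_of_weight (hJ : ∀ v, J (J v) = -v) {p q : ℤ} {k : ℕ}
    (hk : p + q = k) {b : V [⋀^Fin k]→L[ℝ] ℂ} (hb : derForm J b = (Complex.I * (p - q : ℤ)) • b) :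
    typeProj J p q b = b := by
  conv_rhs => rw [← sum_typeProj hJ b]
  have hne : ∀ r : ℕ, (r : ℤ) ≠ p → typeProj J r ((k : ℤ) - r) b = 0 := fun r hr =>
    typeProj_eq_zero_of_weight hJ (w := p - q) (by omega) hb
  by_cases h : 0 ≤ p ∧ 0 ≤ q
  · obtain ⟨hp, hq⟩ := h
    lift p to ℕ using hp
    rw [Finset.sum_eq_single_of_mem p (Finset.mem_range.2 (by omega))]
    · congr 1
      omega
    · intro r _ hr
      exact hne r (by exact_mod_cast hr)
  · rw [typeProj_of_neg J (by tauto), Finset.sum_eq_zero]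
    intro r hr
    rw [Finset.mem_range] at hr
    exact hne r (by omega)

/-- Passing to the conjugate complex structure exchanges the types `(p,q)` and `(q,p)`. -/
theorem typeProj_neg (hJ : ∀ v, J (J v) = -v) (p q : ℤ) {k : ℕ} (b : V [⋀^Fin k]→L[ℝ] ℂ) :
    typeProj (-J) p q b = typeProj J q p b := by
  have hJ' : ∀ v, (-J) ((-J) v) = -v := fun v => by simp [hJ]
  by_cases h : 0 ≤ q ∧ 0 ≤ p ∧ q + p = k
  · have hder : ∀ c : V [⋀^Fin k]→L[ℝ] ℂ, derForm (-J) c = -derForm J c := fun c => by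
      rw [← neg_one_smul ℝ J, derForm_smul_left, Complex.ofReal_neg, Complex.ofReal_one,
        form_neg_smul, one_smul]
    induction b using form_induction hJ with
    | hmem r hr b hb =>
      rw [typeProj_of_mem_weightForms J (by omega) hb h.1 h.2.1 h.2.2]
      split_ifs with h1
      · refine typeProj_eq_self_of_weight hJ' (by omega) ?_
        rw [hder, hb.1, ← h1, ← form_neg_smul]
        congr 1
        push_cast
        ring
      · refine typeProj_eq_zero_of_weight hJ' (w := -(2 * r - k)) (by omega) ?_
        rw [hder, hb.1, ← form_neg_smul]
        congr 1
        push_cast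
        ring
    | hzero => simp [typeProj_zero]
    | hadd a b ha hb => rw [typeProj_add, typeProj_add, ha, hb]
    | hsmul c a ha => rw [typeProj_smul, typeProj_smul, ha]
  · rw [typeProj_of_neg J h, typeProj_of_neg]
    omega

end Weights

/-! ### The component `d^{2,-1}` is algebraic -/

section LocalFormula

variable {V : Type*} [NormedAddCommGroup V] [NormedSpace ℝ V]

/-- The product rule for `A (L (β y) ∘ J y)`, where `A` and `L` are constant. It is stated for
abstract spaces, and applied to spaces of forms. -/
theorem hasFDerivAt_comp_clm_comp {F G H : Type*} [NormedAddCommGroup F] [NormedSpace ℝ F]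
    [NormedAddCommGroup G] [NormedSpace ℝ G] [NormedAddCommGroup H] [NormedSpace ℝ H]
    (L : F →L[ℝ] V →L[ℝ] H) (A : (V →L[ℝ] H) →L[ℝ] G) {J : V → V →L[ℝ] V} {β : V → F} {y : V}
    {β' : V →L[ℝ] F} {J' : V →L[ℝ] V →L[ℝ] V} (hβ : HasFDerivAt β β' y) (hJ : HasFDerivAt J J' y) :
    ∃ D : V →L[ℝ] G, HasFDerivAt (fun y => A (L (β y) ∘L J y)) D y ∧
      ∀ v, D v = A (L (β y) ∘L J' v) + A (L (β' v) ∘L J y) :=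
  ⟨_, A.hasFDerivAt.comp y ((L.hasFDerivAt.comp y hβ).clm_comp hJ), fun v => by simp⟩

set_option synthInstance.maxHeartbeats 400000 in
/-- The derivation `derForm J β` is bilinear in `J` and `β`. -/
theorem hasFDerivAt_derForm {k : ℕ} {J : V → V →L[ℝ] V} {β : V → V [⋀^Fin k]→L[ℝ] ℂ} {y₀ : V}
    (hJ : DifferentiableAt ℝ J y₀) (hβ : DifferentiableAt ℝ β y₀) :
    DifferentiableAt ℝ (fun y => derForm (J y) (β y)) y₀ ∧
      ∀ v, fderiv ℝ (fun y => derForm (J y) (β y)) y₀ v =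
        derForm (fderiv ℝ J y₀ v) (β y₀) + derForm (J y₀) (fderiv ℝ β y₀ v) := by
  cases k with
  | zero => simp [derForm]
  | succ k =>
    let L : (V [⋀^Fin (k + 1)]→L[ℝ] ℂ) →L[ℝ] V →L[ℝ] V [⋀^Fin k]→L[ℝ] ℂ :=
      ContinuousAlternatingMap.curryLeftLI.toContinuousLinearMap
    let A : (V →L[ℝ] V [⋀^Fin k]→L[ℝ] ℂ) →L[ℝ] V [⋀^Fin (k + 1)]→L[ℝ] ℂ :=
      ContinuousAlternatingMap.alternatizeUncurryFinCLM ℝ V ℂ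
    obtain ⟨D, h, hD⟩ := hasFDerivAt_comp_clm_comp (F := V [⋀^Fin (k + 1)]→L[ℝ] ℂ)
      (H := V [⋀^Fin k]→L[ℝ] ℂ) (G := V [⋀^Fin (k + 1)]→L[ℝ] ℂ) L A hβ.hasFDerivAt hJ.hasFDerivAt
    refine ⟨h.differentiableAt, fun v => (congrArg (fun L => L v) h.fderiv).trans ?_⟩
    rw [hD]
    rfl

/-- The derivatives of an almost complex structure anticommute with it: differentiate `J ∘ J = -1`.
-/
theorem fderiv_complexStructure {J : V → V →L[ℝ] V} {y₀ : V} (hJd : DifferentiableAt ℝ J y₀)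
    (hJ : ∀ᶠ y in 𝓝 y₀, ∀ v, J y (J y v) = -v) (u v : V) :
    fderiv ℝ J y₀ u (J y₀ v) = -J y₀ (fderiv ℝ J y₀ u v) := by
  have h := hJd.hasFDerivAt.clm_comp hJd.hasFDerivAt
  have h' : HasFDerivAt (fun y => J y ∘L J y) (0 : V →L[ℝ] V →L[ℝ] V) y₀ := by
    refine (hasFDerivAt_const (-ContinuousLinearMap.id ℝ V) y₀).congr_of_eventuallyEq ?_
    filter_upwards [hJ] with y hy
    ext v
    simp [hy]
  have h2 := congrArg (fun L => L u v) (h.unique h')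
  simp only [add_apply, ContinuousLinearMap.comp_apply, ContinuousLinearMap.compL_apply,
    ContinuousLinearMap.flip_apply, zero_apply] at h2
  exact eq_neg_of_add_eq_zero_right h2

variable [FiniteDimensional ℝ V]

/-- The derivation defined by an endomorphism `K` that anticommutes with `J` is the sum of a part
that raises the weight by two and one that lowers it by two.  Up to a factor of two, these are the
expressions below for `ε = 1` and `ε = -1`. -/
theorem derForm_raise {J K : V →L[ℝ] V} (hJ : ∀ v, J (J v) = -v) (hK : ∀ v, K (J v) = -J (K v))
    {k : ℕ} {w : ℤ} {b : V [⋀^Fin k]→L[ℝ] ℂ} (hb : derForm J b = (Complex.I * w) • b) {ε : ℤ}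
    (hε : ε = 1 ∨ ε = -1) :
    derForm J (derForm K b - (Complex.I * ε) • derForm (K ∘L J) b) =
      (Complex.I * (w + 2 * ε : ℤ)) • (derForm K b - (Complex.I * ε) • derForm (K ∘L J) b) := by
  -- the commutators of `J` with `K` and `K J`
  have h1 : K ∘L J - J ∘L K = (2 : ℝ) • (K ∘L J) := by
    ext v
    change K (J v) - J (K v) = (2 : ℝ) • K (J v)
    rw [hK, two_smul]
    abel
  have h2 : (K ∘L J) ∘L J - J ∘L (K ∘L J) = (-2 : ℝ) • K := by
    ext v
    change K (J (J v)) - J (K (J v)) = (-2 : ℝ) • K v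
    rw [hK v, hJ, map_neg, map_neg, hJ, neg_smul, two_smul]
    abel
  have hε2 : (ε : ℂ) * ε = 1 := by rcases hε with rfl | rfl <;> simp
  rw [sub_eq_add_neg, ← form_neg_smul, derForm_add, derForm_smul, derForm_derForm, hb,
    derForm_derForm J (K ∘L J), hb, h1, h2, derForm_smul_left, derForm_smul_left, derForm_smul,
    derForm_smul]
  generalize derForm K b = x
  generalize derForm (K ∘L J) b = y
  ext v
  simp only [ContinuousAlternatingMap.add_apply, ContinuousAlternatingMap.smul_apply, smul_eq_mul]
  push_cast
  have hI := Complex.I_mul_I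
  linear_combination (2 * y v * ε * ε) * hI - 2 * y v * hε2

variable {ι : Type*} [Fintype ι]

/-- The operator `(√-1/4) ∑ⱼ (eʲ)^{1,0} ∧ (D_{Kⱼ} - √-1 D_{Kⱼ J})`, where `D_A` is the derivation
defined by `A` and `Kⱼ` is the derivative of `J` in the direction of the basis vector `eⱼ`. -/
def torsionOp (e : Module.Basis ι ℝ V) (J : V →L[ℝ] V) (K : ι → V →L[ℝ] V) :
    Module.End ℂ (MixedForm V) :=
  (Complex.I / 4) • ∑ j, extOp (oneZero J (coordC e j)) ∘ₗ
    (derOp (K j) - Complex.I • derOp (K j ∘L J))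

theorem torsionOp_apply_succ (e : Module.Basis ι ℝ V) (J : V →L[ℝ] V) (K : ι → V →L[ℝ] V)
    (a : MixedForm V) (k : ℕ) :
    torsionOp e J K a (k + 1) = (Complex.I / 4) • ∑ j, extForm (oneZero J (coordC e j))
      (derForm (K j) (a k) - Complex.I • derForm (K j ∘L J) (a k)) := by
  simp only [torsionOp, LinearMap.smul_apply, LinearMap.sum_apply, Pi.smul_apply, Finset.sum_apply]
  rfl

/-- The component of type `(p + 2, q - 1)` of the exterior derivative of a form `β` of type `(p,q)`
is algebraic in `β`.  Differentiating `D_J β = √-1 (p - q) β` shows that the components of type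
`(p + 1, q - 1)` of the partial derivatives of `β` are algebraic in `β`. -/
theorem typeProj_extDeriv (e : Module.Basis ι ℝ V) {k : ℕ} {w : ℤ} {J : V → V →L[ℝ] V}
    {β : V → V [⋀^Fin k]→L[ℝ] ℂ} {y₀ : V} (hJd : DifferentiableAt ℝ J y₀)
    (hβd : DifferentiableAt ℝ β y₀) (hJ : ∀ᶠ y in 𝓝 y₀, ∀ v, J y (J y v) = -v)
    (hβ : ∀ᶠ y in 𝓝 y₀, derForm (J y) (β y) = (Complex.I * w) • β y) {p q : ℤ}
    (hk : p + q = (k + 1 : ℕ)) (hw : p - q = w + 3) :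
    typeProj (J y₀) p q (extDeriv β y₀) =
      torsionOp e (J y₀) (fun j => fderiv ℝ J y₀ (e j)) (Pi.single k (β y₀)) (k + 1) := by
  have hJ₀ := hJ.self_of_nhds
  have hβ₀ := hβ.self_of_nhds
  have hJ₁ : ∀ v, (-J y₀) ((-J y₀) v) = -v := fun v => by simp [hJ₀]
  -- the derivative of the equation `D_J β = √-1 w β`
  have hD : ∀ u, derForm (fderiv ℝ J y₀ u) (β y₀) + derForm (J y₀) (fderiv ℝ β y₀ u) =
      (Complex.I * w) • fderiv ℝ β y₀ u := by
    intro u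
    rw [← (hasFDerivAt_derForm hJd hβd).2 u, Filter.EventuallyEq.fderiv_eq hβ]
    exact congrArg (fun L => L u) (hβd.hasFDerivAt.const_smul (Complex.I * (w : ℂ))).fderiv
  rw [extDeriv, alternatizeUncurryFin_eq_sum e, typeProj_sum, torsionOp_apply_succ,
    Finset.smul_sum]
  refine Finset.sum_congr rfl fun j _ => ?_
  rw [Pi.single_eq_same]
  set K := fderiv ℝ J y₀ (e j) with hKdef
  have hK : ∀ v, K (J y₀ v) = -J y₀ (K v) := fderiv_complexStructure hJd hJ _
  set b := β y₀
  set d := fderiv ℝ β y₀ (e j) with hd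
  have hD := hD (e j)
  rw [← hKdef, ← hd] at hD
  set ξ := coordC e j
  -- the parts of `D_K b` of weight `w + 2` and `w - 2`
  set c₁ := derForm K b - Complex.I • derForm (K ∘L J y₀) b with hc₁
  set c₂ := derForm K b + Complex.I • derForm (K ∘L J y₀) b with hc₂
  have h₁ : derForm (J y₀) c₁ = (Complex.I * (w + 2 : ℤ)) • c₁ := by
    simpa using derForm_raise hJ₀ hK hβ₀ (Or.inl rfl)
  have h₂ : derForm (J y₀) c₂ = (Complex.I * (w - 2 : ℤ)) • c₂ := by
    have h := derForm_raise hJ₀ hK hβ₀ (ε := -1) (Or.inr rfl)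
    have hc : derForm K b - (Complex.I * (-1 : ℤ)) • derForm (K ∘L J y₀) b = c₂ := by
      rw [hc₂]
      push_cast
      module
    rwa [hc, mul_neg_one, ← sub_eq_add_neg] at h
  -- the part of `d` of the same type as `b`
  set d₀ := d + (-(Complex.I / 4)) • c₁ + (Complex.I / 4) • c₂ with hd₀
  have hK12 : derForm K b = (2⁻¹ : ℂ) • c₁ + (2⁻¹ : ℂ) • c₂ := by
    rw [hc₁, hc₂]
    module
  have h₀ : derForm (J y₀) d₀ = (Complex.I * w) • d₀ := by
    have hd' : derForm (J y₀) d = (Complex.I * w) • d - derForm K b := eq_sub_of_add_eq' hD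
    rw [hd₀, derForm_add, derForm_add, derForm_smul, derForm_smul, h₁, h₂, hd', hK12]
    ext v
    simp only [ContinuousAlternatingMap.add_apply, ContinuousAlternatingMap.sub_apply,
      ContinuousAlternatingMap.smul_apply, smul_eq_mul]
    push_cast
    linear_combination (-(c₁ v + c₂ v) / 2) * Complex.I_mul_I
  have hdd : d = d₀ + (Complex.I / 4) • c₁ + (-(Complex.I / 4)) • c₂ := by
    rw [hd₀]
    module
  have hξ : ∀ v, oneZero (J y₀) ξ (J y₀ v) = (Complex.I * (1 : ℤ)) * oneZero (J y₀) ξ v := by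
    intro v
    rw [oneZero_comp hJ₀]
    simp
  have hξ' : ∀ v, oneZero (-J y₀) ξ (J y₀ v) =
      (Complex.I * (-1 : ℤ)) * oneZero (-J y₀) ξ v := by
    intro v
    have := oneZero_comp hJ₁ ξ v
    rw [neg_apply, map_neg] at this
    rw [← neg_eq_iff_eq_neg.2 this.symm]
    push_cast
    ring
  -- the components of the differential of weight different from `w + 3` do not contribute
  have kill : ∀ {η : V →L[ℝ] ℂ} {ε u : ℤ} {c : V [⋀^Fin k]→L[ℝ] ℂ},
      (∀ v, η (J y₀ v) = (Complex.I * ε) * η v) → derForm (J y₀) c = (Complex.I * u) • c →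
      w + 3 ≠ u + ε → typeProj (J y₀) p q (extForm η c) = 0 := fun hη hc h =>
    typeProj_eq_zero_of_weight hJ₀ (by omega) (derForm_extForm_of_weight hη hc)
  have keep : typeProj (J y₀) p q (extForm (oneZero (J y₀) ξ) c₁) =
      extForm (oneZero (J y₀) ξ) c₁ := by
    refine typeProj_eq_self_of_weight hJ₀ hk ?_
    rw [derForm_extForm_of_weight hξ h₁, hw]
    congr 3
    ring
  conv_lhs => rw [hdd, ← oneZero_add_oneZero_neg (J y₀) ξ]
  simp only [extForm_add, extForm_add_left, extForm_smul, typeProj_add, typeProj_smul, keep]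
  rw [kill hξ h₀ (by omega), kill hξ' h₀ (by omega), kill hξ h₂ (by omega),
    kill hξ' h₂ (by omega), kill hξ' h₁ (by omega)]
  simp

end LocalFormula

/-! ### Complex frames -/

section Frames

variable {V : Type*} [NormedAddCommGroup V] [NormedSpace ℝ V]

/-- A complex basis `u` of the three-dimensional complex vector space `(V, J)` with its dual
basis `θ` of forms of type `(1,0)`.  The last field says that the vectors `u i`, `J (u i)` span `V`
over the reals. -/
structure ComplexFrame (J : V →L[ℝ] V) where
  u : Fin 3 → V
  θ : Fin 3 → V →L[ℝ] ℂ
  θ_J : ∀ i v, θ i (J v) = Complex.I * θ i v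
  θ_u : ∀ i j, θ i (u j) = if i = j then 1 else 0
  expand : ∀ v, ∑ i, ((θ i v).re • u i + (θ i v).im • J (u i)) = v

/-- The complex conjugate of a complex-valued one-form. -/
def conjForm (ξ : V →L[ℝ] ℂ) : V →L[ℝ] ℂ := (Complex.conjCLE : ℂ →L[ℝ] ℂ) ∘L ξ

@[simp] theorem conjForm_apply (ξ : V →L[ℝ] ℂ) (v : V) :
    conjForm ξ v = (starRingEnd ℂ) (ξ v) := rfl

@[simp] theorem conjForm_conjForm (ξ : V →L[ℝ] ℂ) : conjForm (conjForm ξ) = ξ := by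
  ext v
  simp

namespace ComplexFrame

variable {J : V →L[ℝ] V} (F : ComplexFrame J)

/-- The same vectors, as a complex basis for the conjugate complex structure. -/
def conj : ComplexFrame (-J) where
  u := F.u
  θ i := conjForm (F.θ i)
  θ_J i v := by simp [F.θ_J]
  θ_u i j := by simp [F.θ_u, apply_ite]
  expand v := by simpa using F.expand v

@[simp] theorem conj_θ (i : Fin 3) : F.conj.θ i = conjForm (F.θ i) := rfl

/-- Left multiplication by `θ i`. -/
def t (i : Fin 3) : Module.End ℂ (MixedForm V) := extOp (F.θ i)

/-- Contraction with the complex vector `(u i - √-1 J (u i)) / 2`, which is dual to `θ i`. -/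
def s (i : Fin 3) : Module.End ℂ (MixedForm V) :=
  (2⁻¹ : ℂ) • (intOp (F.u i) - Complex.I • intOp (J (F.u i)))

theorem conj_s (i : Fin 3) :
    F.conj.s i = (2⁻¹ : ℂ) • (intOp (F.u i) + Complex.I • intOp (J (F.u i))) := by
  refine LinearMap.ext fun a => ?_
  change (2⁻¹ : ℂ) • (intOp (F.u i) a - Complex.I • intOp (-J (F.u i)) a) =
    (2⁻¹ : ℂ) • (intOp (F.u i) a + Complex.I • intOp (J (F.u i)) a)
  rw [intOp_neg, LinearMap.neg_apply]
  module

theorem conj_conj_s (i : Fin 3) : F.conj.conj.s i = F.s i := by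
  rw [conj_s]
  refine LinearMap.ext fun a => ?_
  change (2⁻¹ : ℂ) • (intOp (F.u i) a + Complex.I • intOp (-J (F.u i)) a) =
    (2⁻¹ : ℂ) • (intOp (F.u i) a - Complex.I • intOp (J (F.u i)) a)
  rw [intOp_neg, LinearMap.neg_apply]
  module

theorem conj_conj_t (i : Fin 3) : F.conj.conj.t i = F.t i := by
  rw [t, conj_θ, conj_θ, conjForm_conjForm, t]

theorem s_apply (i : Fin 3) (a : MixedForm V) :
    F.s i a = (2⁻¹ : ℂ) • (intOp (F.u i) a - Complex.I • intOp (J (F.u i)) a) := rfl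

theorem s_extOp (i : Fin 3) (ξ : V →L[ℝ] ℂ) (a : MixedForm V) :
    F.s i (extOp ξ a) =
      ((2⁻¹ : ℂ) * (ξ (F.u i) - Complex.I * ξ (J (F.u i)))) • a - extOp ξ (F.s i a) := by
  simp only [s_apply, intOp_extOp, map_smul, map_sub]
  module

/-- The contractions `s i` and the multiplications `t j` satisfy the Clifford relations; this and
the next statements give the commutation relations of the operators of the frame and its conjugate.
-/
theorem s_t (i j : Fin 3) (a : MixedForm V) :
    F.s i (F.t j a) = (if i = j then (1 : ℂ) else 0) • a - F.t j (F.s i a) := by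
  rw [t, s_extOp, F.θ_J, F.θ_u]
  congr 2
  simp only [eq_comm (a := j)]
  split_ifs
  · linear_combination (-2⁻¹ : ℂ) * Complex.I_mul_I
  · simp

theorem s_conj_t (i j : Fin 3) (a : MixedForm V) :
    F.s i (F.conj.t j a) = -F.conj.t j (F.s i a) := by
  rw [t, s_extOp, conj_θ, conjForm_apply, conjForm_apply, F.θ_J, map_mul, Complex.conj_I]
  have : (2⁻¹ : ℂ) * ((starRingEnd ℂ) (F.θ j (F.u i)) -
      Complex.I * (-Complex.I * (starRingEnd ℂ) (F.θ j (F.u i)))) = 0 := by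
    linear_combination (2⁻¹ * (starRingEnd ℂ) (F.θ j (F.u i))) * Complex.I_mul_I
  rw [this]
  module

theorem conj_s_t (i j : Fin 3) (a : MixedForm V) :
    F.conj.s i (F.t j a) = -F.t j (F.conj.s i a) := by
  rw [← conj_conj_t, s_conj_t]

theorem t_t (i j : Fin 3) (a : MixedForm V) : F.t i (F.t j a) = -F.t j (F.t i a) :=
  extOp_extOp _ _ _

theorem t_t_self (i : Fin 3) (a : MixedForm V) : F.t i (F.t i a) = 0 := extOp_extOp_self _ _

theorem conj_t_t (i j : Fin 3) (a : MixedForm V) : F.conj.t i (F.t j a) = -F.t j (F.conj.t i a) :=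
  extOp_extOp _ _ _

/-- Every contraction is a combination of the contractions `s i` and their conjugates. -/
theorem intOp_eq (v : V) (a : MixedForm V) :
    intOp v a = ∑ i, (F.θ i v • F.s i a + (starRingEnd ℂ) (F.θ i v) • F.conj.s i a) := by
  conv_lhs => rw [← F.expand v, intOp_sum, LinearMap.sum_apply]
  refine Finset.sum_congr rfl fun i _ => ?_
  simp only [intOp_add, intOp_smul, LinearMap.add_apply, LinearMap.smul_apply, conj_s, s_apply]
  have h := (Complex.re_add_im (F.θ i v)).symm
  generalize (F.θ i v).re = x at h ⊢
  generalize (F.θ i v).im = y at h ⊢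
  rw [h, map_add, map_mul, Complex.conj_I, Complex.conj_ofReal, Complex.conj_ofReal]
  have e : (y : ℂ) = -(Complex.I * Complex.I) * y := by rw [Complex.I_mul_I]; ring
  conv_lhs => rw [e]
  module

theorem derOp_eq [FiniteDimensional ℝ V] (A : V →L[ℝ] V) (a : MixedForm V) :
    derOp A a =
      ∑ i, (extOp (F.θ i ∘L A) (F.s i a) + extOp (conjForm (F.θ i) ∘L A) (F.conj.s i a)) := by
  let e := Module.finBasis ℝ V
  rw [derOp_eq_sum e]
  simp_rw [F.intOp_eq, map_sum, map_add, map_smul]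
  rw [Finset.sum_comm]
  refine Finset.sum_congr rfl fun i _ => ?_
  rw [Finset.sum_add_distrib, oneForm_eq_sum e (F.θ i ∘L A),
    oneForm_eq_sum e (conjForm (F.θ i) ∘L A)]
  simp [extOp_sum]

/-- A one-form of type `(1,0)` is a combination of the `θ i`. -/
theorem eq_sum_of_oneZero {ξ : V →L[ℝ] ℂ} (hξ : ∀ v, ξ (J v) = Complex.I * ξ v) :
    ξ = ∑ m, ξ (F.u m) • F.θ m := by
  ext v
  conv_lhs => rw [← F.expand v, map_sum]
  simp only [sum_apply, smul_apply, smul_eq_mul]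
  refine Finset.sum_congr rfl fun i _ => ?_
  rw [map_add, map_smul, map_smul, hξ, Complex.real_smul, Complex.real_smul]
  conv_rhs => rw [← Complex.re_add_im (F.θ i v)]
  ring

/-- The torsion operator is `∑ᵢ τᵢ ∧ s̄ᵢ` for forms `τᵢ` of type `(2,0)`, where `s̄ᵢ` is the
contraction dual to `θ̄ᵢ`; the numbers `A i m` are the coefficients of `τᵢ` with respect to `θₘ₊₁ ∧
θₘ₊₂`. -/
theorem exists_torsionOp_eq [FiniteDimensional ℝ V] {ι : Type*} [Fintype ι]
    (e : Module.Basis ι ℝ V) (hJ : ∀ v, J (J v) = -v) {K : ι → V →L[ℝ] V}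
    (hK : ∀ j v, K j (J v) = -J (K j v)) :
    ∃ A : Fin 3 → Fin 3 → ℂ, ∀ a, torsionOp e J K a =
      ∑ i, ∑ m, A i m • F.t (m + 1) (F.t (m + 2) (F.conj.s i a)) := by
  -- as `K j` anticommutes with `J`, the form `θ̄ᵢ ∘ K j` is of type `(1,0)` and survives, whereas
  -- `θᵢ ∘ K j` is of type `(0,1)` and drops out
  have hder : ∀ j a, derOp (K j) a - Complex.I • derOp (K j ∘L J) a =
      ∑ i, (2 : ℂ) • extOp (conjForm (F.θ i) ∘L K j) (F.conj.s i a) := by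
    intro j a
    have h1 : ∀ i, F.θ i ∘L K j ∘L J = (-Complex.I) • (F.θ i ∘L K j) := by
      intro i
      ext v
      simp [hK, F.θ_J]
    have h2 : ∀ i, conjForm (F.θ i) ∘L K j ∘L J = Complex.I • (conjForm (F.θ i) ∘L K j) := by
      intro i
      ext v
      simp [hK, F.θ_J]
    rw [F.derOp_eq, F.derOp_eq, Finset.smul_sum, ← Finset.sum_sub_distrib]
    refine Finset.sum_congr rfl fun i _ => ?_
    rw [h1, h2, extOp_smul, extOp_smul, LinearMap.smul_apply, LinearMap.smul_apply, smul_add,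
      smul_smul, smul_smul, mul_neg, Complex.I_mul_I]
    module
  let c : ι → Fin 3 → ℂ := fun j m => oneZero J (coordC e j) (F.u m)
  let d : ι → Fin 3 → Fin 3 → ℂ := fun j i n => conjForm (F.θ i) (K j (F.u n))
  have hc : ∀ j x, extOp (oneZero J (coordC e j)) x = ∑ m, c j m • F.t m x := by
    intro j x
    rw [F.eq_sum_of_oneZero (oneZero_comp hJ (coordC e j)), extOp_sum, LinearMap.sum_apply]
    simp_rw [extOp_smul]
    rfl
  have hd : ∀ j i x, extOp (conjForm (F.θ i) ∘L K j) x = ∑ n, d j i n • F.t n x := by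
    intro j i x
    rw [F.eq_sum_of_oneZero (ξ := conjForm (F.θ i) ∘L K j) (fun v => by simp [hK, F.θ_J]),
      extOp_sum, LinearMap.sum_apply]
    simp_rw [extOp_smul]
    rfl
  let B : Fin 3 → Fin 3 → Fin 3 → ℂ := fun i m n => ∑ j, (Complex.I / 2) * (c j m * d j i n)
  have key : ∀ a, torsionOp e J K a =
      ∑ i, ∑ m, ∑ n, B i m n • F.t m (F.t n (F.conj.s i a)) := by
    intro a
    simp only [torsionOp, LinearMap.smul_apply, LinearMap.sum_apply, LinearMap.comp_apply,
      LinearMap.sub_apply, hder, B, mixedForm_sum_smul]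
    rw [Finset.smul_sum]
    simp_rw [Finset.sum_comm (t := (Finset.univ : Finset ι))]
    refine Finset.sum_congr rfl fun j _ => ?_
    simp only [hc, hd, map_sum, map_smul, mixedForm_smul_sum, smul_smul]
    rw [Finset.sum_comm]
    refine Finset.sum_congr rfl fun i _ => Finset.sum_congr rfl fun m _ =>
      Finset.sum_congr rfl fun n _ => ?_
    congr 1
    ring
  -- antisymmetrize the coefficients of `θₘ ∧ θₙ`
  refine ⟨fun i m => B i (m + 1) (m + 2) - B i (m + 2) (m + 1), fun a => ?_⟩
  rw [key]
  refine Finset.sum_congr rfl fun i _ => ?_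
  simp only [Fin.sum_univ_three, t_t_self, mixedForm_smul_zero, zero_add, add_zero, Fin.isValue,
    Fin.reduceAdd]
  rw [F.t_t 1 0, F.t_t 2 1, F.t_t 2 0]
  module

end ComplexFrame

end Frames

/-! ### The commutator of the Lefschetz operator and the adjoint torsion -/

section FrameAlgebra

variable {V : Type*} [NormedAddCommGroup V] [NormedSpace ℝ V]

/-- The constant function `1`, as a form of degree `0`. -/
def oneForm : MixedForm V := Pi.single 0 (ContinuousAlternatingMap.constOfIsEmpty ℝ V (Fin 0) 1)

theorem oneForm_apply_zero (v : Fin 0 → V) : (oneForm : MixedForm V) 0 v = 1 := by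
  simp [oneForm]

theorem smul_oneForm_apply_zero (c : ℂ) (v : Fin 0 → V) : (c • oneForm : MixedForm V) 0 v = c := by
  simp [oneForm]

@[simp] theorem intOp_oneForm (v : V) : intOp v oneForm = 0 := by
  funext k
  ext w
  simp [intOp_apply, oneForm]

@[simp] theorem derOp_oneForm (A : V →L[ℝ] V) : derOp A (oneForm : MixedForm V) = 0 := by
  funext k
  cases k with
  | zero => rfl
  | succ k => simp [derOp_apply, oneForm, derForm_zero]

namespace ComplexFrame

variable {J : V →L[ℝ] V} (F : ComplexFrame J)

theorem s_s (i j : Fin 3) (a : MixedForm V) : F.s i (F.s j a) = -F.s j (F.s i a) := by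
  simp only [s_apply, map_sub, map_smul]
  rw [intOp_intOp (F.u i) (F.u j), intOp_intOp (F.u i) (J (F.u j)), intOp_intOp (J (F.u i)) (F.u j),
    intOp_intOp (J (F.u i)) (J (F.u j))]
  module

theorem s_oneForm (i : Fin 3) : F.s i oneForm = 0 := by
  rw [s_apply, intOp_oneForm, intOp_oneForm]
  module

/-- The contraction in degree `k` depends only on the component of degree `k + 1`. -/
theorem s_congr (i : Fin 3) {a b : MixedForm V} {k : ℕ} (h : a (k + 1) = b (k + 1)) :
    F.s i a k = F.s i b k := by
  simp only [s_apply, Pi.smul_apply, Pi.sub_apply, intOp_apply, h]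

/-- The operator `(√-1 / 2) ∑ᵢ θᵢ ∧ θ̄ᵢ ∧ ·`. -/
def lefschetzOp : Module.End ℂ (MixedForm V) := (Complex.I / 2) • ∑ i, F.t i ∘ₗ F.conj.t i

theorem lefschetzOp_apply (a : MixedForm V) :
    F.lefschetzOp a = (Complex.I / 2) • ∑ i, F.t i (F.conj.t i a) := by
  simp [lefschetzOp]

/-- The conjugate frame has the opposite Hermitian form. -/
theorem conj_lefschetzOp (a : MixedForm V) : F.conj.lefschetzOp a = -F.lefschetzOp a := by
  simp only [lefschetzOp_apply, conj_conj_t, F.conj_t_t, Finset.sum_neg_distrib]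
  module

/-- The commutator of a contraction and the Lefschetz operator is a multiplication by `θ̄ⱼ`. -/
theorem s_lefschetzOp (j : Fin 3) (a : MixedForm V) :
    F.s j (F.lefschetzOp a) = F.lefschetzOp (F.s j a) + (Complex.I / 2) • F.conj.t j a := by
  simp only [lefschetzOp_apply, map_smul, map_sum, s_t, s_conj_t, map_neg, sub_neg_eq_add,
    Finset.sum_add_distrib]
  fin_cases j <;> simp [Fin.sum_univ_three] <;> module

theorem conj_t_lefschetzOp (j : Fin 3) (a : MixedForm V) :
    F.conj.t j (F.lefschetzOp a) = F.lefschetzOp (F.conj.t j a) := by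
  simp only [lefschetzOp_apply, map_smul, map_sum]
  congr 1
  refine Finset.sum_congr rfl fun i _ => ?_
  rw [conj_t_t, F.conj.t_t, map_neg, neg_neg]

/-- The component `d^{2,-1}` of the differential, for a nearly Kähler structure:
`√-1 λ ∑ₘ θₘ₊₁ ∧ θₘ₊₂ ∧ ι_{ūₘ}`, indices modulo three. -/
def torsion (lam : ℂ) : Module.End ℂ (MixedForm V) :=
  (Complex.I * lam) • ∑ m, F.t (m + 1) ∘ₗ F.t (m + 2) ∘ₗ F.conj.s m

theorem torsion_apply (lam : ℂ) (a : MixedForm V) : F.torsion lam a =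
    (Complex.I * lam) • ∑ m, F.t (m + 1) (F.t (m + 2) (F.conj.s m a)) := by
  simp [torsion]

/-- The Hermitian adjoint of `torsion` for a unitary frame; the factor two is due to the forms `θ i`
having length `√2`. -/
def torsionAdj (lam : ℂ) : Module.End ℂ (MixedForm V) :=
  (2 * Complex.I * lam) • ∑ m, F.conj.t m ∘ₗ F.s (m + 1) ∘ₗ F.s (m + 2)

theorem torsionAdj_apply (lam : ℂ) (a : MixedForm V) : F.torsionAdj lam a =
    (2 * Complex.I * lam) • ∑ m, F.conj.t m (F.s (m + 1) (F.s (m + 2) a)) := by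
  simp [torsionAdj]

/-- The commutator `[L, N^*] = 2 √-1 N̄` in a frame. Moving `L` past the two contractions in `N^*`
produces two terms for each index `m`, which pair up to twice the conjugate torsion. -/
theorem lefschetzOp_torsionAdj (lam : ℂ) (a : MixedForm V) :
    F.lefschetzOp (F.torsionAdj lam a) - F.torsionAdj lam (F.lefschetzOp a) =
      (2 * Complex.I) • F.conj.torsion (-lam) a := by
  have key : ∀ m, F.conj.t m (F.s (m + 1) (F.s (m + 2) (F.lefschetzOp a))) =
      F.lefschetzOp (F.conj.t m (F.s (m + 1) (F.s (m + 2) a))) + (Complex.I / 2) •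
        (F.conj.t m (F.conj.t (m + 1) (F.s (m + 2) a)) +
          F.conj.t (m + 2) (F.conj.t m (F.s (m + 1) a))) := by
    intro m
    rw [s_lefschetzOp, map_add, map_smul, s_lefschetzOp, s_conj_t, map_add, map_add, map_smul,
      map_smul, map_neg, conj_t_lefschetzOp, F.conj.t_t (m + 2) m]
    module
  simp only [torsionAdj_apply, torsion_apply, key, map_smul, map_add,
    Finset.sum_add_distrib, conj_conj_s, Fin.sum_univ_three]
  simp only [Fin.isValue, zero_add, Fin.reduceAdd]
  -- the constants on the two sides of the identity
  have e : (2 * Complex.I * lam) * (Complex.I / 2) = -lam := by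
    linear_combination lam * Complex.I_mul_I
  have e' : (2 * Complex.I) * (Complex.I * -lam) = 2 * lam := by
    linear_combination (-2 * lam) * Complex.I_mul_I
  rw [smul_smul, e']
  simp only [smul_add, smul_smul, e]
  module

/-- The contractions extract the coefficients of the products `θₘ₊₁ ∧ θₘ₊₂ ∧ x`, for `x` without
factors `θⱼ`. -/
theorem s_s_t_t {x : MixedForm V} (hx : ∀ j, F.s j x = 0) (p m : Fin 3) :
    F.s (p + 2) (F.s (p + 1) (F.t (m + 1) (F.t (m + 2) x))) =
      (if p = m then (1 : ℂ) else 0) • x := by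
  fin_cases p <;> fin_cases m <;> simp [s_t, hx, mixedForm_zero_smul]

/-- The complex volume form `θ₀ ∧ θ₁ ∧ θ₂`. -/
def vol : MixedForm V := F.t 0 (F.t 1 (F.t 2 oneForm))

theorem s_vol (i : Fin 3) : F.s i F.vol = F.t (i + 1) (F.t (i + 2) oneForm) := by
  have h20 := F.t_t 2 0 oneForm
  fin_cases i <;> simp [vol, s_t, s_oneForm, mixedForm_zero_smul, h20]

/-- The contractions extract the coefficients of a form of type `(2,2)` with respect to the products
`θₘ₊₁ ∧ θₘ₊₂ ∧ θ̄ᵢ₊₁ ∧ θ̄ᵢ₊₂`. -/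
theorem coeff_extract (p q m i : Fin 3) :
    F.s (p + 2) (F.s (p + 1) (F.conj.s (q + 2) (F.conj.s (q + 1)
      (F.t (m + 1) (F.t (m + 2) (F.conj.t (i + 1) (F.conj.t (i + 2) oneForm))))))) =
      ((if p = m then (1 : ℂ) else 0) * (if q = i then (1 : ℂ) else 0)) • oneForm := by
  simp only [conj_s_t, map_neg, neg_neg]
  rw [F.conj.s_s_t_t F.conj.s_oneForm, F.s_s_t_t, smul_smul]
  intro j
  rw [map_smul, s_oneForm, mixedForm_smul_zero]

theorem lefschetzOp_lefschetzOp_oneForm :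
    F.lefschetzOp (F.lefschetzOp oneForm) = (2⁻¹ : ℂ) •
      ∑ m, F.t (m + 1) (F.t (m + 2) (F.conj.t (m + 1) (F.conj.t (m + 2) oneForm))) := by
  have key : ∀ i j, F.t i (F.conj.t i (F.t j (F.conj.t j oneForm))) =
      -F.t i (F.t j (F.conj.t i (F.conj.t j oneForm))) := by
    intro i j
    rw [conj_t_t, map_neg]
  have swap : ∀ i j, F.t i (F.t j (F.conj.t i (F.conj.t j oneForm))) =
      F.t j (F.t i (F.conj.t j (F.conj.t i oneForm))) := by
    intro i j
    rw [t_t, F.conj.t_t i j, map_neg, map_neg, neg_neg]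
  simp only [lefschetzOp_apply, map_smul, map_add, key, Fin.sum_univ_three, t_t_self]
  rw [swap 1 0, swap 2 1, swap 2 0]
  have hI : Complex.I / 2 * (Complex.I / 2) = -(1 / 4) := by
    linear_combination (1 / 4 : ℂ) * Complex.I_mul_I
  simp only [smul_add, smul_smul, hI, Fin.isValue, zero_add, Fin.reduceAdd]
  rw [swap 2 0]
  module

/-- The torsion is determined by its value on `θ̄₀ ∧ θ̄₁ ∧ θ̄₂`: the coefficients `A i m` can be
read off from it.  If this value is `2 √-1 λ ω ∧ ω`, with `ω` the Hermitian form, then the torsion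
is `torsion λ`. -/
theorem eq_torsion_of_apply_conj_vol {T : MixedForm V → MixedForm V} {A : Fin 3 → Fin 3 → ℂ}
    {lam : ℂ}
    (hT : ∀ a, T a = ∑ i, ∑ m, A i m • F.t (m + 1) (F.t (m + 2) (F.conj.s i a)))
    (h : T F.conj.vol 4 = (2 * Complex.I * lam) • F.lefschetzOp (F.lefschetzOp oneForm) 4)
    (a : MixedForm V) : T a = F.torsion lam a := by
  have h' : T F.conj.vol 4 = F.torsion lam F.conj.vol 4 := by
    have e : (2 * Complex.I * lam) • F.lefschetzOp (F.lefschetzOp oneForm) =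
        F.torsion lam F.conj.vol := by
      rw [lefschetzOp_lefschetzOp_oneForm, torsion_apply, smul_smul]
      simp only [s_vol]
      congr 1
      ring
    exact h.trans (congrFun e 4)
  have key : ∀ q p, A q p = if q = p then Complex.I * lam else 0 := by
    intro q p
    have h2 : F.s (p + 2) (F.s (p + 1) (F.conj.s (q + 2) (F.conj.s (q + 1)
        (T F.conj.vol)))) 0 = F.s (p + 2) (F.s (p + 1) (F.conj.s (q + 2) (F.conj.s (q + 1)
        (F.torsion lam F.conj.vol)))) 0 :=
      F.s_congr _ (F.s_congr _ (F.conj.s_congr _ (F.conj.s_congr _ h')))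
    rw [hT, torsion_apply] at h2
    simp only [s_vol, map_sum, map_smul, coeff_extract, smul_smul, ← mixedForm_sum_smul] at h2
    have h3 := congrArg (fun b => b ![]) h2
    rw [smul_oneForm_apply_zero, smul_oneForm_apply_zero] at h3
    simpa [eq_comm] using h3
  rw [hT, torsion_apply, mixedForm_smul_sum]
  refine Finset.sum_congr rfl fun i _ => ?_
  rw [Finset.sum_eq_single i]
  · rw [key, if_pos rfl]
  · intro m _ hm
    rw [key, if_neg hm.symm, mixedForm_zero_smul]
  · simp

/-- A three-form of type `(3,0)` is determined by its value on the frame. -/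
theorem eq_vol {c : V [⋀^Fin 3]→L[ℝ] ℂ}
    (hc : ∀ v : V, c.curryLeft (J v) = Complex.I • c.curryLeft v) (hu : c F.u = 1) :
    c = F.vol 3 := by
  -- a form that is complex linear in the first argument is determined by its contractions with `u`
  have hexp : ∀ {k : ℕ} {d : V [⋀^Fin (k + 1)]→L[ℝ] ℂ},
      (∀ v : V, d.curryLeft (J v) = Complex.I • d.curryLeft v) → ∀ v,
      d.curryLeft v = ∑ i, F.θ i v • d.curryLeft (F.u i) := by
    intro k d hd v
    conv_lhs => rw [← F.expand v, map_sum]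
    refine Finset.sum_congr rfl fun i _ => ?_
    rw [map_add, map_smul, map_smul, hd]
    ext w
    simp only [ContinuousAlternatingMap.add_apply, ContinuousAlternatingMap.smul_apply, smul_eq_mul,
      Complex.real_smul]
    linear_combination (d.curryLeft (F.u i) w) * Complex.re_add_im (F.θ i v)
  -- contractions inherit the complex linearity
  have hcurry : ∀ {k : ℕ} {d : V [⋀^Fin (k + 2)]→L[ℝ] ℂ},
      (∀ v : V, d.curryLeft (J v) = Complex.I • d.curryLeft v) → ∀ v w : V,
      (d.curryLeft v).curryLeft (J w) = Complex.I • (d.curryLeft v).curryLeft w := by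
    intro k d hd v w
    have h1 := congrFun (intOp_intOp (J w) v (Pi.single (k + 2) d)) k
    have h2 := congrFun (intOp_intOp w v (Pi.single (k + 2) d)) k
    simp only [intOp_apply, Pi.single_eq_same, Pi.neg_apply] at h1 h2
    rw [h1, h2, hd]
    ext w
    simp
  -- a complex trilinear form that vanishes on the basis is zero
  have hdet : ∀ {d : V [⋀^Fin 3]→L[ℝ] ℂ},
      (∀ v : V, d.curryLeft (J v) = Complex.I • d.curryLeft v) → d F.u = 0 → d = 0 := by
    intro d hd hu
    have hσ : ∀ i j k : Fin 3, d ![F.u i, F.u j, F.u k] = 0 := by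
      intro i j k
      have h0 : ![F.u i, F.u j, F.u k] = F.u ∘ ![i, j, k] := by
        funext l
        fin_cases l <;> rfl
      rw [h0]
      by_cases hinj : Function.Injective ![i, j, k]
      · have h2 := d.toAlternatingMap.map_perm F.u
          (Equiv.ofBijective _ (Finite.injective_iff_bijective.1 hinj))
        exact h2.trans (by simp [show d.toAlternatingMap F.u = 0 from hu])
      · exact d.toAlternatingMap.map_eq_zero_of_not_injective _
          fun h => hinj (Function.Injective.of_comp h)
    have h₁ : ∀ i j, (d.curryLeft (F.u i)).curryLeft (F.u j) = 0 := by
      refine fun i j => form_ext fun v => ?_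
      rw [hexp (hcurry (hcurry hd _) _) v]
      ext w
      rw [Subsingleton.elim w ![]]
      refine (ContinuousAlternatingMap.sum_apply _ _).trans (Finset.sum_eq_zero fun k _ => ?_)
      exact (congrArg (F.θ k v * ·) (hσ i j k)).trans (mul_zero _)
    have h₂ : ∀ i, d.curryLeft (F.u i) = 0 := by
      refine fun i => form_ext fun v => ?_
      rw [hexp (hcurry hd _) v]
      simp only [h₁, form_smul_zero, Finset.sum_const_zero]
      rfl
    refine form_ext fun v => ?_
    rw [hexp hd v]
    simp only [h₂, form_smul_zero, Finset.sum_const_zero]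
    rfl
  rw [← sub_eq_zero]
  refine hdet (fun v => ?_) ?_
  · change c.curryLeft (J v) - intOp (J v) F.vol 2 =
      Complex.I • (c.curryLeft v - intOp v F.vol 2)
    rw [hc, smul_sub]
    congr 1
    rw [← Pi.smul_apply]
    refine congrFun ?_ 2
    simp only [vol, t, intOp_extOp, intOp_oneForm, F.θ_J]
    simp
    module
  · have h : F.vol 3 F.u = 1 := by
      have h1 : F.vol 3 F.u = intOp (F.u 2) (intOp (F.u 1) (intOp (F.u 0) F.vol)) 0 ![] := by
        simp only [intOp_apply_apply]
        congr 1
        funext l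
        fin_cases l <;> rfl
      rw [h1]
      simp [vol, t, intOp_extOp, F.θ_u, oneForm_apply_zero, mixedForm_zero_smul]
    change c F.u - F.vol 3 F.u = 0
    rw [hu, h, sub_self]

end ComplexFrame

end FrameAlgebra

/-! ### Exterior products with a two-form -/

section Wedge

variable {V : Type*} [NormedAddCommGroup V] [NormedSpace ℝ V]

/-- Expansion of the antisymmetrization along the first argument. -/
theorem alternatization_apply_succ {n : ℕ}
    (m : ContinuousMultilinearMap ℝ (fun _ : Fin (n + 1) => V) ℂ) (v : Fin (n + 1) → V) :
    ContinuousMultilinearMap.alternatization m v = ∑ i : Fin (n + 1), (-1) ^ (i : ℕ) *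
      ContinuousMultilinearMap.alternatization (m.curryLeft (v i)) (i.removeNth v) := by
  classical
  -- a permutation is given by the image `i` of `0` and a permutation of the other elements
  let φ : Fin (n + 1) × Equiv.Perm (Fin n) → Equiv.Perm (Fin (n + 1)) := fun x =>
    x.1.cycleRange.symm * Equiv.Perm.decomposeFin.symm (0, x.2)
  have hφ : Function.Bijective φ := by
    rw [Fintype.bijective_iff_injective_and_card]
    refine ⟨fun x y h => ?_, ?_⟩
    · have h0 := congrArg (fun σ : Equiv.Perm (Fin (n + 1)) => σ 0) h
      have h1 : x.1 = y.1 := by simpa [φ] using h0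
      refine Prod.ext h1 ?_
      simp only [φ, h1, mul_right_inj, EmbeddingLike.apply_eq_iff_eq, Prod.mk.injEq, true_and] at h
      exact h
    · simp [Fintype.card_perm, Nat.factorial_succ]
  rw [ContinuousMultilinearMap.alternatization_apply_apply, ← (Equiv.ofBijective φ hφ).sum_comp,
    Fintype.sum_prod_type]
  refine Finset.sum_congr rfl fun i _ => ?_
  rw [ContinuousMultilinearMap.alternatization_apply_apply, Finset.mul_sum]
  refine Finset.sum_congr rfl fun e _ => ?_
  have hv : v ∘ φ (i, e) = Fin.cons (v i) (i.removeNth v ∘ e) := by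
    funext j
    refine Fin.cases ?_ (fun j => ?_) j <;> simp [φ, Fin.removeNth]
  have hs : Equiv.Perm.sign (φ (i, e)) = (-1) ^ (i : ℕ) * Equiv.Perm.sign e := by
    simp [φ, Fin.sign_cycleRange]
  rw [Equiv.ofBijective_apply, hv, hs, ContinuousMultilinearMap.curryLeft_apply]
  simp [Units.smul_def, mul_assoc]

theorem zero_wedge {n : ℕ} (a : V [⋀^Fin 0]→L[ℝ] ℂ) (b : V [⋀^Fin n]→L[ℝ] ℂ) (h : 0 + n = n) :
    wedge h a b = a ![] • b := by
  ext v
  have h1 : ∀ σ : Equiv.Perm (Fin n), mulForms h a b (v ∘ σ) =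
      Equiv.Perm.sign σ • (a ![] * b v) := by
    intro σ
    rw [mulForms_apply]
    have : (fun j => (v ∘ σ) (Fin.cast h (Fin.natAdd 0 j))) = v ∘ σ := by
      funext j
      simp
    have h2 : b (v ∘ σ) = Equiv.Perm.sign σ • b v := b.toAlternatingMap.map_perm v σ
    rw [this, h2, Subsingleton.elim (fun i : Fin 0 => _) ![], mul_smul_comm]
  simp only [wedge, ContinuousAlternatingMap.smul_apply,
    ContinuousMultilinearMap.alternatization_apply_apply, h1, smul_smul, smul_eq_mul]
  have hn : (n.factorial : ℂ) ≠ 0 := Nat.cast_ne_zero.2 n.factorial_ne_zero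
  simp [Fintype.card_perm, hn]

theorem curryLeft_mulForms {p q n : ℕ} (a : V [⋀^Fin (p + 1)]→L[ℝ] ℂ) (b : V [⋀^Fin q]→L[ℝ] ℂ)
    (h : p + 1 + q = n + 1) (h' : p + q = n) (v : V) :
    (mulForms h a b).curryLeft v = mulForms h' (a.curryLeft v) b := by
  ext w
  rw [ContinuousMultilinearMap.curryLeft_apply, mulForms_apply, mulForms_apply,
    ContinuousAlternatingMap.curryLeft_apply_apply]
  congr 2
  · funext i
    refine Fin.cases ?_ (fun i => ?_) i <;> rfl
  · funext j
    have : Fin.cast h (Fin.natAdd (p + 1) j) = (Fin.cast h' (Fin.natAdd p j)).succ := by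
      ext
      simp
      omega
    rw [this]
    rfl

theorem wedge_apply {p q n : ℕ} (h : p + q = n) (a : V [⋀^Fin p]→L[ℝ] ℂ) (b : V [⋀^Fin q]→L[ℝ] ℂ)
    (v : Fin n → V) : wedge h a b v = ((p.factorial : ℂ) * (q.factorial : ℂ))⁻¹ *
      ∑ σ : Equiv.Perm (Fin n), ((Equiv.Perm.sign σ : ℤ) : ℂ) *
        (a (fun i => v (σ (Fin.cast h (Fin.castAdd q i)))) *
          b (fun j => v (σ (Fin.cast h (Fin.natAdd p j))))) := by
  simp only [wedge, ContinuousAlternatingMap.smul_apply, smul_eq_mul,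
    ContinuousMultilinearMap.alternatization_apply_apply, mulForms_apply, Units.smul_def,
    zsmul_eq_mul]
  rfl

/-- The exterior product as an antisymmetrization of the products of the contractions of the first
factor; this is the way to reduce exterior products to products with one-forms. -/
theorem succ_smul_wedge {p q n : ℕ} {ι : Type*} [Fintype ι] [FiniteDimensional ℝ V]
    (e : Module.Basis ι ℝ V) (a : V [⋀^Fin (p + 1)]→L[ℝ] ℂ) (b : V [⋀^Fin q]→L[ℝ] ℂ)
    (h : p + 1 + q = n + 1) (h' : p + q = n) :
    ((p + 1 : ℕ) : ℂ) • wedge h a b =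
      ∑ l, extForm (coordC e l) (wedge h' (a.curryLeft (e l)) b) := by
  let f : V →ₗ[ℝ] V [⋀^Fin n]→L[ℝ] ℂ :=
    { toFun := fun v => wedge h' (a.curryLeft v) b
      map_add' := fun v w => by
        ext x
        simp only [ContinuousAlternatingMap.add_apply, wedge_apply, map_add, add_mul, mul_add,
          Finset.sum_add_distrib]
      map_smul' := fun c v => by
        ext x
        simp only [ContinuousAlternatingMap.smul_apply, wedge_apply, map_smul, RingHom.id_apply,
          Complex.real_smul, Finset.mul_sum]
        exact Finset.sum_congr rfl fun σ _ => by ring }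
  refine Eq.trans ?_ (alternatizeUncurryFin_eq_sum e (LinearMap.toContinuousLinearMap f))
  ext v
  rw [ContinuousAlternatingMap.alternatizeUncurryFin_apply]
  simp only [LinearMap.coe_toContinuousLinearMap', f, LinearMap.coe_mk, AddHom.coe_mk, wedge,
    ContinuousAlternatingMap.smul_apply, smul_eq_mul, alternatization_apply_succ,
    curryLeft_mulForms a b h h', Finset.mul_sum, Nat.factorial_succ, zsmul_eq_mul]
  refine Finset.sum_congr rfl fun i _ => ?_
  have hp : ((p + 1 : ℕ) : ℂ) ≠ 0 := Nat.cast_ne_zero.2 p.succ_ne_zero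
  push_cast at hp ⊢
  field_simp

/-- The exterior product with a two-form. -/
theorem two_wedge {ι : Type*} [Fintype ι] [FiniteDimensional ℝ V] (e : Module.Basis ι ℝ V)
    (c : V [⋀^Fin 2]→L[ℝ] ℂ) {k : ℕ} (b : V [⋀^Fin k]→L[ℝ] ℂ) :
    wedge (Nat.add_comm 2 k) c b = (2⁻¹ : ℂ) • ∑ l, ∑ m, c ![e l, e m] •
      extForm (coordC e l) (extForm (coordC e m) b) := by
  have h2 := succ_smul_wedge e c b (n := k + 1) (Nat.add_comm 2 k) (Nat.add_comm 1 k)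
  have h1 : ∀ l, wedge (Nat.add_comm 1 k) (c.curryLeft (e l)) b =
      ∑ m, c ![e l, e m] • extForm (coordC e m) b := by
    intro l
    have h1 := succ_smul_wedge e (c.curryLeft (e l)) b (n := k) (Nat.add_comm 1 k) (Nat.zero_add k)
    rw [Nat.cast_one, one_smul] at h1
    rw [h1]
    refine Finset.sum_congr rfl fun m _ => ?_
    rw [zero_wedge, extForm_smul]
    rfl
  have h3 : wedge (Nat.add_comm 2 k) c b =
      (2⁻¹ : ℂ) • (((1 + 1 : ℕ) : ℂ) • wedge (Nat.add_comm 2 k) c b) := by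
    rw [smul_smul]
    norm_num
  rw [h3, h2]
  congr 1
  refine Finset.sum_congr rfl fun l _ => ?_
  rw [h1]
  ext v
  simp only [extForm_apply, ContinuousAlternatingMap.sum_apply,
    ContinuousAlternatingMap.smul_apply, smul_eq_mul, Finset.mul_sum]
  rw [Finset.sum_comm]
  exact Finset.sum_congr rfl fun m _ => Finset.sum_congr rfl fun i _ => Finset.sum_congr rfl
    fun j _ => by ring

/-- The values of the Hermitian form of the frame. -/
theorem ComplexFrame.lefschetzOp_oneForm_apply {J : V →L[ℝ] V} (F : ComplexFrame J) (v w : V) :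
    F.lefschetzOp oneForm 2 ![v, w] = (Complex.I / 2) * ∑ i,
      (F.θ i v * (starRingEnd ℂ) (F.θ i w) - (starRingEnd ℂ) (F.θ i v) * F.θ i w) := by
  change intOp w (intOp v (F.lefschetzOp oneForm)) 0 ![] = _
  have h : ∀ i, intOp w (intOp v (F.t i (F.conj.t i oneForm))) =
      (F.θ i v * (starRingEnd ℂ) (F.θ i w) - (starRingEnd ℂ) (F.θ i v) * F.θ i w) • oneForm := by
    intro i
    simp only [t, conj_θ, intOp_extOp, map_sub, map_smul, intOp_oneForm, conjForm_apply, map_zero,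
      sub_zero]
    module
  rw [lefschetzOp_apply]
  simp only [map_smul, map_sum, h, ← mixedForm_sum_smul, smul_smul, smul_oneForm_apply_zero]

/-- The operator `lefschetzOp` is the exterior product with the Hermitian form. -/
theorem ComplexFrame.lefschetzOp_apply_add_two [FiniteDimensional ℝ V] {J : V →L[ℝ] V}
    (F : ComplexFrame J) {c : V [⋀^Fin 2]→L[ℝ] ℂ} (hc : c = F.lefschetzOp oneForm 2)
    (a : MixedForm V) (k : ℕ) :
    F.lefschetzOp a (k + 2) = wedge (Nat.add_comm 2 k) c (a k) := by
  let e := Module.finBasis ℝ V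
  ext x
  have hX : ∀ ξ η : V →L[ℝ] ℂ, extOp ξ (extOp η a) (k + 2) x = ∑ l, ∑ m, ξ (e l) * η (e m) *
      extForm (coordC e l) (extForm (coordC e m) (a k)) x := by
    intro ξ η
    conv_lhs => rw [oneForm_eq_sum e ξ, oneForm_eq_sum e η]
    simp only [extOp_sum, extOp_smul, LinearMap.sum_apply, LinearMap.smul_apply, map_sum, map_smul,
      Finset.sum_apply, Pi.smul_apply, ContinuousAlternatingMap.sum_apply,
      ContinuousAlternatingMap.smul_apply, smul_eq_mul, extOp_apply_succ, Finset.mul_sum]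
    rw [Finset.sum_comm]
    exact Finset.sum_congr rfl fun l _ => Finset.sum_congr rfl fun m _ => by ring
  have hF : ∀ i, F.t i (F.conj.t i a) (k + 2) x = (2⁻¹ : ℂ) * ∑ l, ∑ m,
      (F.θ i (e l) * (starRingEnd ℂ) (F.θ i (e m)) - (starRingEnd ℂ) (F.θ i (e l)) * F.θ i (e m)) *
      extForm (coordC e l) (extForm (coordC e m) (a k)) x := by
    intro i
    have h1 := hX (F.θ i) (conjForm (F.θ i))
    have h2 := hX (conjForm (F.θ i)) (F.θ i)
    rw [extOp_extOp, Pi.neg_apply, ContinuousAlternatingMap.neg_apply] at h2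
    simp only [sub_mul, Finset.sum_sub_distrib]
    simp only [conjForm_apply] at h1 h2
    rw [← h1, ← h2, t, t, conj_θ]
    ring
  rw [two_wedge e, hc, lefschetzOp_apply]
  simp only [lefschetzOp_oneForm_apply, Finset.sum_apply, Pi.smul_apply,
    ContinuousAlternatingMap.sum_apply, ContinuousAlternatingMap.smul_apply, smul_eq_mul, hF,
    Finset.mul_sum, Finset.sum_mul]
  rw [Finset.sum_comm]
  refine Finset.sum_congr rfl fun l _ => ?_
  rw [Finset.sum_comm]
  exact Finset.sum_congr rfl fun m _ => Finset.sum_congr rfl fun i _ => by ring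

/-- The Hermitian form is of type `(1,1)`, that is, of weight zero. -/
theorem ComplexFrame.derOp_lefschetzOp [FiniteDimensional ℝ V] {J : V →L[ℝ] V}
    (F : ComplexFrame J) (a : MixedForm V) :
    derOp J (F.lefschetzOp a) = F.lefschetzOp (derOp J a) := by
  have h1 : ∀ i, F.θ i ∘L J = Complex.I • F.θ i := fun i => by
    ext v
    simp [F.θ_J]
  have h2 : ∀ i, conjForm (F.θ i) ∘L J = (-Complex.I) • conjForm (F.θ i) := fun i => by
    ext v
    simp [F.θ_J]
  simp only [lefschetzOp_apply, map_smul, map_sum]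
  congr 1
  refine Finset.sum_congr rfl fun i _ => ?_
  simp only [t, conj_θ, derOp_extOp, h1, h2, extOp_smul, LinearMap.smul_apply, map_add, map_smul]
  module

end Wedge

/-! ### Hermitian adjoints and the dual commutator -/

section Adjoints

variable {V : Type*} [NormedAddCommGroup V] [NormedSpace ℝ V] {ι : Type*} [Fintype ι]

/-- The Hermitian product on the forms of degree at most `6` for which the basis `e` is
orthonormal, normalized so that the products of different elements of the dual basis have length
one. -/
def formInner (e : Module.Basis ι ℝ V) (a b : MixedForm V) : ℂ :=
  ∑ k ∈ Finset.range 7, ((k.factorial : ℂ))⁻¹ *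
    ∑ f : Fin k → ι, a k (fun i => e (f i)) * (starRingEnd ℂ) (b k (fun i => e (f i)))

variable (e : Module.Basis ι ℝ V)

theorem formInner_add_left (a a' b : MixedForm V) :
    formInner e (a + a') b = formInner e a b + formInner e a' b := by
  simp [formInner, add_mul, mul_add, Finset.sum_add_distrib]

theorem formInner_smul_left (c : ℂ) (a b : MixedForm V) :
    formInner e (c • a) b = c * formInner e a b := by
  simp only [formInner, Pi.smul_apply, ContinuousAlternatingMap.smul_apply, smul_eq_mul,
    Finset.mul_sum]
  exact Finset.sum_congr rfl fun k _ => Finset.sum_congr rfl fun f _ => by ring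

theorem conj_formInner (a b : MixedForm V) :
    (starRingEnd ℂ) (formInner e a b) = formInner e b a := by
  simp [formInner, mul_comm]

theorem formInner_add_right (a b b' : MixedForm V) :
    formInner e a (b + b') = formInner e a b + formInner e a b' := by
  simp only [← conj_formInner e _ a, formInner_add_left, map_add]

theorem formInner_smul_right (c : ℂ) (a b : MixedForm V) :
    formInner e a (c • b) = (starRingEnd ℂ) c * formInner e a b := by
  simp only [← conj_formInner e _ a, formInner_smul_left, map_mul]

/-- The forms of degree greater than the dimension vanish. -/
theorem form_eq_zero_of_card_lt (e : Module.Basis ι ℝ V) {k : ℕ} (h : Fintype.card ι < k)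
    (a : V [⋀^Fin k]→L[ℝ] ℂ) : a = 0 := by
  refine ContinuousAlternatingMap.toAlternatingMap_injective ?_
  refine Module.Basis.ext_alternating e fun v hv => ?_
  have := Fintype.card_le_of_injective v hv
  simp at this
  omega

/-- The Hermitian product is nondegenerate. The bound on the dimension is needed as the product does
not see the forms of degree greater than `6`. -/
theorem eq_of_formInner_eq (hι : Fintype.card ι ≤ 6) {b c : MixedForm V}
    (h : ∀ a, formInner e a b = formInner e a c) : b = c := by
  have h0 : formInner e (b - c) (b - c) = 0 := by
    have := h (b - c)
    have h1 : b = (b - c) + c := by abel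
    conv_lhs at this => rw [h1, formInner_add_right]
    simpa using this
  have h1 : ((∑ k ∈ Finset.range 7, ((k.factorial : ℝ))⁻¹ *
      ∑ f : Fin k → ι, Complex.normSq ((b - c) k (fun i => e (f i))) : ℝ) : ℂ) = 0 := by
    rw [← h0, formInner]
    push_cast
    simp only [Complex.mul_conj]
  rw [Complex.ofReal_eq_zero, Finset.sum_eq_zero_iff_of_nonneg fun k _ => mul_nonneg
    (by positivity) (Finset.sum_nonneg fun _ _ => Complex.normSq_nonneg _)] at h1
  funext k
  by_cases hk : k < 7
  · have h2 := h1 k (Finset.mem_range.2 hk)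
    rw [mul_eq_zero, or_iff_right (by positivity), Finset.sum_eq_zero_iff_of_nonneg
      fun _ _ => Complex.normSq_nonneg _] at h2
    refine ContinuousAlternatingMap.toAlternatingMap_injective ?_
    refine Module.Basis.ext_alternating e fun v hv => ?_
    have := h2 v (Finset.mem_univ _)
    rw [Complex.normSq_eq_zero] at this
    exact sub_eq_zero.1 this
  · rw [form_eq_zero_of_card_lt e (by omega) (b k), form_eq_zero_of_card_lt e (by omega) (c k)]

/-- `B` is the Hermitian adjoint of `A`. -/
def IsAdj (A B : Module.End ℂ (MixedForm V)) : Prop :=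
  ∀ a b, formInner e (A a) b = formInner e a (B b)

variable {e} {A B A' B' : Module.End ℂ (MixedForm V)}

theorem IsAdj.symm (h : IsAdj e A B) : IsAdj e B A := fun a b => by
  rw [← conj_formInner, ← h, conj_formInner]

theorem IsAdj.comp (h : IsAdj e A B) (h' : IsAdj e A' B') : IsAdj e (A ∘ₗ A') (B' ∘ₗ B) :=
  fun _ _ => (h _ _).trans (h' _ _)

theorem IsAdj.smul (c : ℂ) (h : IsAdj e A B) : IsAdj e (c • A) ((starRingEnd ℂ) c • B) :=
  fun a b => by
    rw [LinearMap.smul_apply, LinearMap.smul_apply, formInner_smul_left, formInner_smul_right,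
      h a b, Complex.conj_conj]

theorem IsAdj.add (h : IsAdj e A B) (h' : IsAdj e A' B') : IsAdj e (A + A') (B + B') :=
  fun a b => by
    rw [LinearMap.add_apply, LinearMap.add_apply, formInner_add_left, formInner_add_right, h, h']

theorem IsAdj.congr (h : IsAdj e A B) (hA : ∀ a, A a = A' a) (hB : ∀ a, B a = B' a) :
    IsAdj e A' B' := by
  rwa [← LinearMap.ext hA, ← LinearMap.ext hB]

theorem IsAdj.zero : IsAdj e (0 : Module.End ℂ (MixedForm V)) 0 := fun _ _ => by
  simp [formInner]

theorem IsAdj.sum {κ : Type*} (s : Finset κ) {A B : κ → Module.End ℂ (MixedForm V)}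
    (h : ∀ i, IsAdj e (A i) (B i)) : IsAdj e (∑ i ∈ s, A i) (∑ i ∈ s, B i) := by
  classical
  induction s using Finset.induction_on with
  | empty => simpa using IsAdj.zero
  | insert i s hi ih => rw [Finset.sum_insert hi, Finset.sum_insert hi]; exact (h i).add ih

/-- The adjoint of the multiplication by a one-form `ξ` is the contraction with the vector that is
dual to `ξ̄`. -/
theorem isAdj_extOp (hι : Fintype.card ι ≤ 6) (ξ : V →L[ℝ] ℂ) :
    IsAdj e (extOp ξ) (∑ j, (starRingEnd ℂ) (ξ (e j)) • intOp (e j)) := by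
  intro a b
  have key : ∀ k : ℕ, (((k + 1).factorial : ℂ))⁻¹ * ∑ f : Fin (k + 1) → ι,
      extForm ξ (a k) (fun i => e (f i)) * (starRingEnd ℂ) (b (k + 1) (fun i => e (f i))) =
      ((k.factorial : ℂ))⁻¹ * ∑ g : Fin k → ι, a k (fun i => e (g i)) * (starRingEnd ℂ)
        ((∑ j, (starRingEnd ℂ) (ξ (e j)) • intOp (e j)) b k (fun i => e (g i))) := by
    intro k
    -- all `k + 1` terms of the exterior product make the same contribution
    have hi : ∀ i : Fin (k + 1), ∑ f : Fin (k + 1) → ι, (-1) ^ (i : ℕ) * (ξ (e (f i)) *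
        a k (i.removeNth fun l => e (f l))) * (starRingEnd ℂ) (b (k + 1) (fun i => e (f i))) =
        ∑ g : Fin k → ι, ∑ j, a k (fun i => e (g i)) *
          (ξ (e j) * (starRingEnd ℂ) (intOp (e j) b k (fun i => e (g i)))) := by
      intro i
      rw [← (Fin.insertNthEquiv (fun _ => ι) i).sum_comp, Fintype.sum_prod_type, Finset.sum_comm]
      refine Finset.sum_congr rfl fun g _ => Finset.sum_congr rfl fun j _ => ?_
      have h1 : (fun l => e (Fin.insertNth (α := fun _ => ι) i j g l)) =
          Fin.insertNth (α := fun _ => V) i (e j) fun l => e (g l) := by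
        funext l
        refine Fin.succAboveCases i ?_ (fun l => ?_) l <;> simp
      have h2 : b (k + 1) (Fin.insertNth (α := fun _ => V) i (e j) fun l => e (g l)) =
          (-1) ^ (i : ℕ) * intOp (e j) b k (fun l => e (g l)) := by
        rw [ContinuousAlternatingMap.map_insertNth, intOp_apply_apply, zsmul_eq_mul]
        push_cast
        rfl
      simp only [Fin.insertNthEquiv_apply, h1, h2, Fin.insertNth_apply_same,
        Fin.removeNth_insertNth, map_mul, map_pow, map_neg, map_one]
      linear_combination (ξ (e j) * a k (fun l => e (g l)) *
        (starRingEnd ℂ) (intOp (e j) b k (fun l => e (g l)))) *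
        (pow_mul_pow_eq_one (i : ℕ) (show (-1 : ℂ) * -1 = 1 by norm_num))
    simp only [extForm_apply, Finset.sum_mul]
    rw [Finset.sum_comm]
    simp only [hi, Finset.sum_const, Finset.card_univ, Fintype.card_fin, Nat.factorial_succ]
    simp only [LinearMap.sum_apply, LinearMap.smul_apply, Finset.sum_apply, Pi.smul_apply,
      ContinuousAlternatingMap.sum_apply, ContinuousAlternatingMap.smul_apply, smul_eq_mul, map_sum,
      map_mul, Complex.conj_conj, Finset.mul_sum, nsmul_eq_mul]
    refine Finset.sum_congr rfl fun g _ => Finset.sum_congr rfl fun j _ => ?_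
    push_cast
    have : (k : ℂ) + 1 ≠ 0 := by exact_mod_cast k.succ_ne_zero
    field_simp
  -- the degrees are shifted by one; in the top degree all contractions of `b` vanish
  refine (Finset.sum_range_succ' _ 6).trans (Eq.trans ?_ (Finset.sum_range_succ _ 6).symm)
  congr 1
  · exact Finset.sum_congr rfl fun k _ => key k
  · have h7 : ∀ j, intOp (e j) b 6 = 0 := fun j => by
      rw [intOp_apply, form_eq_zero_of_card_lt e (by omega) (b (6 + 1))]
      rfl
    simp [h7]

theorem isAdj_unique (hι : Fintype.card ι ≤ 6) (h : IsAdj e A B) (h' : IsAdj e A B') : B = B' :=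
  LinearMap.ext fun b => eq_of_formInner_eq e hι fun a => by rw [← h, ← h']

namespace ComplexFrame

variable {J : V →L[ℝ] V} (F : ComplexFrame J)

/-- The frame is unitary for the metric for which the basis `e` is orthonormal: the real and
imaginary parts of `θ i` are dual to `u i` and `J (u i)` for this metric. -/
def IsUnitary (e : Module.Basis ι ℝ V) : Prop :=
  ∀ i, ∑ j, (F.θ i (e j)).re • e j = F.u i ∧ ∑ j, (F.θ i (e j)).im • e j = J (F.u i)

variable {F}

theorem IsUnitary.conj (h : F.IsUnitary e) : F.conj.IsUnitary e := fun i => by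
  simp only [conj_θ, conjForm_apply, Complex.conj_re, Complex.conj_im, neg_smul,
    Finset.sum_neg_distrib]
  exact ⟨(h i).1, congrArg Neg.neg (h i).2⟩

theorem IsUnitary.isAdj_t (hι : Fintype.card ι ≤ 6) (h : F.IsUnitary e) (i : Fin 3) :
    IsAdj e (F.t i) ((2 : ℂ) • F.s i) := by
  refine (isAdj_extOp (e := e) hι (F.θ i)).congr (fun a => rfl) fun a => Eq.symm ?_
  rw [LinearMap.smul_apply, s_apply, ← (h i).2, ← (h i).1, smul_smul]
  simp only [intOp_sum, intOp_smul, LinearMap.sum_apply, LinearMap.smul_apply, mixedForm_smul_sum]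
  rw [← Finset.sum_sub_distrib, mixedForm_smul_sum]
  refine Finset.sum_congr rfl fun j _ => ?_
  have : (starRingEnd ℂ) (F.θ i (e j)) = ((F.θ i (e j)).re : ℂ) - (F.θ i (e j)).im * Complex.I := by
    exact Complex.ext (by simp) (by simp)
  rw [this]
  module

theorem IsUnitary.isAdj_s (hι : Fintype.card ι ≤ 6) (h : F.IsUnitary e) (i : Fin 3) :
    IsAdj e (F.s i) ((2⁻¹ : ℂ) • F.t i) := by
  refine ((h.isAdj_t hι i).symm.smul (2⁻¹ : ℂ)).congr (fun a => ?_) fun a => ?_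
  · simp only [LinearMap.smul_apply]
    module
  · simp only [LinearMap.smul_apply, map_inv₀, map_ofNat]

theorem IsUnitary.isAdj_torsion (hι : Fintype.card ι ≤ 6) (h : F.IsUnitary e) (lam : ℝ) :
    IsAdj e (F.torsion lam) (F.torsionAdj lam) := by
  refine ((IsAdj.sum Finset.univ fun m => (h.isAdj_t hι (m + 1)).comp
    ((h.isAdj_t hι (m + 2)).comp (h.conj.isAdj_s hι m))).smul (Complex.I * lam)).congr
    (fun a => rfl) fun a => ?_
  simp only [torsionAdj_apply, LinearMap.smul_apply, LinearMap.sum_apply, LinearMap.comp_apply,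
    map_smul, map_mul, Complex.conj_I, Complex.conj_ofReal, smul_smul, mixedForm_smul_sum]
  refine Finset.sum_congr rfl fun m _ => ?_
  rw [F.s_s (m + 1) (m + 2), map_neg]
  module

/-- The adjoint of `lefschetzOp` for a unitary frame. -/
def lambdaOp (F : ComplexFrame J) : Module.End ℂ (MixedForm V) :=
  (2 * Complex.I) • ∑ i, F.s i ∘ₗ F.conj.s i

theorem lambdaOp_apply (F : ComplexFrame J) (a : MixedForm V) :
    F.lambdaOp a = (2 * Complex.I) • ∑ i, F.s i (F.conj.s i a) := by
  simp [lambdaOp]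

theorem s_conj_s (i j : Fin 3) (a : MixedForm V) :
    F.s i (F.conj.s j a) = -F.conj.s j (F.s i a) := by
  simp only [s_apply, conj_s, LinearMap.smul_apply, LinearMap.add_apply, map_sub, map_add, map_smul]
  rw [intOp_intOp (F.u i) (F.u j), intOp_intOp (F.u i) (J (F.u j)), intOp_intOp (J (F.u i)) (F.u j),
    intOp_intOp (J (F.u i)) (J (F.u j))]
  module

theorem IsUnitary.isAdj_lefschetzOp (hι : Fintype.card ι ≤ 6) (h : F.IsUnitary e) :
    IsAdj e F.lefschetzOp F.lambdaOp := by
  refine ((IsAdj.sum Finset.univ fun m => (h.isAdj_t hι m).comp (h.conj.isAdj_t hι m)).smul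
    (Complex.I / 2)).congr (fun a => rfl) fun a => ?_
  simp only [lambdaOp_apply, LinearMap.smul_apply, LinearMap.sum_apply, LinearMap.comp_apply,
    map_smul, map_div₀, Complex.conj_I, smul_smul, mixedForm_smul_sum, s_conj_s]
  refine Finset.sum_congr rfl fun m _ => ?_
  simp only [map_ofNat]
  module

theorem conj_lambdaOp (a : MixedForm V) : F.conj.lambdaOp a = -F.lambdaOp a := by
  simp only [lambdaOp_apply, conj_conj_s, s_conj_s, Finset.sum_neg_distrib]
  module

/-- The commutator `[Λ, N] = 2 √-1 N̄^*` in a unitary frame, the adjoint of the relation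
`lefschetzOp_torsionAdj`. -/
theorem IsUnitary.lambdaOp_torsion (hι : Fintype.card ι ≤ 6) (h : F.IsUnitary e) (lam : ℝ)
    (a : MixedForm V) :
    F.lambdaOp (F.torsion lam a) - F.torsion lam (F.lambdaOp a) =
      (2 * Complex.I) • F.conj.torsionAdj (-lam) a := by
  have hN := (h.isAdj_torsion hι lam).symm
  have hL := h.isAdj_lefschetzOp hι
  have h1 := (hL.comp hN).add ((hN.comp hL).smul (-1))
  have h2 := (h.conj.isAdj_torsion hι (-lam)).smul (2 * Complex.I)
  have h3 := h1.congr (A' := (2 * Complex.I) • F.conj.torsion (-lam)) (fun a => by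
    rw [LinearMap.smul_apply, ← F.lefschetzOp_torsionAdj lam a]
    simp only [LinearMap.add_apply, LinearMap.smul_apply, LinearMap.comp_apply]
    module) fun _ => rfl
  rw [Complex.ofReal_neg] at h2
  have h4 := LinearMap.congr_fun (isAdj_unique hι h3 h2) a
  simp only [LinearMap.add_apply, LinearMap.smul_apply, LinearMap.comp_apply, map_neg, map_one,
    map_mul, Complex.conj_I, map_ofNat] at h4
  have h5 : ∀ x y z : MixedForm V, x + (-1 : ℂ) • y = (2 * -Complex.I) • z →
      y - x = (2 * Complex.I) • z := fun x y z h => by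
    have : y - x = (-1 : ℂ) • (x + (-1 : ℂ) • y) := by module
    rw [this, h]
    module
  exact h5 _ _ _ h4

theorem lefschetzOp_oneForm_u (i : Fin 3) (w : V) :
    F.lefschetzOp oneForm 2 ![F.u i, w] = ((F.θ i w).im : ℂ) := by
  simp only [lefschetzOp_oneForm_apply, F.θ_u, apply_ite (starRingEnd ℂ), map_one, map_zero,
    ite_mul, one_mul, zero_mul, Finset.sum_sub_distrib, Finset.sum_ite_eq', Finset.mem_univ,
    if_true]
  generalize F.θ i w = z
  apply Complex.ext <;> simp
  ring

theorem lefschetzOp_oneForm_J_u (i : Fin 3) (w : V) :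
    F.lefschetzOp oneForm 2 ![J (F.u i), w] = -((F.θ i w).re : ℂ) := by
  simp only [lefschetzOp_oneForm_apply, F.θ_u, F.θ_J, apply_ite (starRingEnd ℂ), map_zero,
    mul_ite, ite_mul, mul_one, mul_zero, zero_mul, Finset.sum_sub_distrib, Finset.sum_ite_eq',
    Finset.mem_univ, if_true, Complex.conj_I]
  generalize F.θ i w = z
  apply Complex.ext <;> simp
  ring

theorem lefschetzOp_oneForm_comm (v w : V) :
    F.lefschetzOp oneForm 2 ![v, w] = -F.lefschetzOp oneForm 2 ![w, v] := by
  rw [lefschetzOp_oneForm_apply, lefschetzOp_oneForm_apply, ← mul_neg, ← Finset.sum_neg_distrib]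
  congr 1
  exact Finset.sum_congr rfl fun i _ => by ring

theorem lefschetzOp_oneForm_nondegenerate {v : V}
    (h : ∀ w, F.lefschetzOp oneForm 2 ![v, w] = 0) : v = 0 := by
  rw [← F.expand v]
  refine Finset.sum_eq_zero fun i _ => ?_
  have h1 := h (F.u i)
  have h2 := h (J (F.u i))
  rw [lefschetzOp_oneForm_comm, neg_eq_zero] at h1 h2
  rw [lefschetzOp_oneForm_u, Complex.ofReal_eq_zero] at h1
  rw [lefschetzOp_oneForm_J_u, neg_eq_zero, Complex.ofReal_eq_zero] at h2
  rw [h1, h2, zero_smul, zero_smul, add_zero]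

/-- A formula for the adjoint of `lefschetzOp` in terms of the Hermitian form alone, where `v j` is
the vector that represents the `j`-th coordinate function.  It does not refer to the frame, and so
shows that the adjoint depends smoothly on the Hermitian form. -/
theorem lambdaOp_eq (f : Module.Basis ι ℝ V) {v : ι → V}
    (hv : ∀ j w, F.lefschetzOp oneForm 2 ![v j, w] = f.repr w j) (a : MixedForm V) :
    F.lambdaOp a = (-2⁻¹ : ℂ) • ∑ j, intOp (v j) (intOp (f j) a) := by
  -- the vector that represents the linear form `r` is `∑ r (f j) v j`
  have hsum : ∀ (r : V →ₗ[ℝ] ℝ) (w : V),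
      F.lefschetzOp oneForm 2 ![∑ j, r (f j) • v j, w] = (r w : ℂ) := by
    intro r w
    have h1 : (F.lefschetzOp oneForm 2).curryLeft (∑ j, r (f j) • v j) ![w] =
        ∑ j, (r (f j) : ℂ) * (F.lefschetzOp oneForm 2).curryLeft (v j) ![w] := by
      rw [map_sum, ContinuousAlternatingMap.sum_apply]
      simp
    refine h1.trans ?_
    have h2 : ∀ j, (F.lefschetzOp oneForm 2).curryLeft (v j) ![w] = f.repr w j := fun j => hv j w
    simp only [h2]
    conv_rhs => rw [← f.sum_repr w, map_sum]
    simp [mul_comm]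
  have huniq : ∀ (r : V →ₗ[ℝ] ℝ) (x : V), (∀ w, F.lefschetzOp oneForm 2 ![x, w] = (r w : ℂ)) →
      ∑ j, r (f j) • v j = x := by
    intro r x hx
    rw [← sub_eq_zero]
    refine F.lefschetzOp_oneForm_nondegenerate fun w => ?_
    have h1 : (F.lefschetzOp oneForm 2).curryLeft (∑ j, r (f j) • v j - x) ![w] =
        F.lefschetzOp oneForm 2 ![∑ j, r (f j) • v j, w] - F.lefschetzOp oneForm 2 ![x, w] := by
      rw [map_sub]
      rfl
    refine h1.trans ?_
    rw [hsum, hx, sub_self]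
  have him : ∀ i, ∑ j, (F.θ i (f j)).im • v j = F.u i := fun i =>
    huniq (Complex.imLm ∘ₗ (F.θ i).toLinearMap) _ (F.lefschetzOp_oneForm_u i)
  have hre : ∀ i, ∑ j, (F.θ i (f j)).re • v j = -J (F.u i) := by
    intro i
    rw [eq_neg_iff_add_eq_zero, ← neg_eq_zero, neg_add_rev, neg_add_eq_zero]
    have := huniq (-Complex.reLm ∘ₗ (F.θ i).toLinearMap) (J (F.u i)) fun w => by
      rw [lefschetzOp_oneForm_J_u]
      simp
    rw [← this]
    simp
  have hs : ∀ j, intOp (f j) a = ∑ i, (((F.θ i (f j)).re : ℂ) • (F.s i a + F.conj.s i a) +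
      ((F.θ i (f j)).im : ℂ) • (Complex.I • F.s i a - Complex.I • F.conj.s i a)) := by
    intro j
    rw [F.intOp_eq]
    refine Finset.sum_congr rfl fun i _ => ?_
    have h := (Complex.re_add_im (F.θ i (f j))).symm
    generalize (F.θ i (f j)).re = x at h ⊢
    generalize (F.θ i (f j)).im = y at h ⊢
    rw [h, map_add, map_mul, Complex.conj_I, Complex.conj_ofReal, Complex.conj_ofReal]
    module
  have hint : ∀ (r : Fin 3 → ι → ℝ) (b : Fin 3 → MixedForm V),
      ∑ j, intOp (v j) (∑ i, (r i j : ℂ) • b i) = ∑ i, intOp (∑ j, r i j • v j) (b i) := by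
    intro r b
    simp only [map_sum, map_smul, intOp_sum, intOp_smul, LinearMap.sum_apply, LinearMap.smul_apply]
    rw [Finset.sum_comm]
  simp only [hs, Finset.sum_add_distrib, map_add, hint (fun i j => (F.θ i (f j)).re),
    hint (fun i j => (F.θ i (f j)).im), hre, him]
  rw [← Finset.sum_add_distrib, ← Finset.sum_add_distrib, lambdaOp_apply, mixedForm_smul_sum,
    mixedForm_smul_sum]
  refine Finset.sum_congr rfl fun i _ => ?_
  have hu : ∀ x, intOp (F.u i) x = F.s i x + F.conj.s i x := fun x => by
    rw [conj_s, s_apply]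
    simp only [LinearMap.smul_apply, LinearMap.add_apply]
    module
  have hJu : ∀ x, intOp (J (F.u i)) x = Complex.I • (F.s i x - F.conj.s i x) := fun x => by
    rw [conj_s, s_apply]
    simp only [LinearMap.smul_apply, LinearMap.add_apply]
    have : intOp (J (F.u i)) x = (-(Complex.I * Complex.I)) • intOp (J (F.u i)) x := by
      rw [Complex.I_mul_I, neg_neg, one_smul]
    conv_lhs => rw [this]
    module
  simp only [intOp_neg, LinearMap.neg_apply, hu, hJu, map_sub, map_smul, F.s_conj_s i i a]
  module

end ComplexFrame

end Adjoints

/-! ### Differential forms in charts -/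

section Charts

variable {M : Type*} [TopologicalSpace M] [ChartedSpace E6 M]

/-- The derivative at `p` of the chart around `c`. -/
def chartDeriv (c p : M) : E6 →L[ℝ] E6 :=
  mfderiv 𝓘(ℝ, E6) 𝓘(ℝ, E6) (extChartAt 𝓘(ℝ, E6) c) p

/-- The derivative at `y` of the inverse of the chart around `c`. -/
def chartSymmDeriv (c : M) (y : E6) : E6 →L[ℝ] E6 :=
  mfderiv 𝓘(ℝ, E6) 𝓘(ℝ, E6) (extChartAt 𝓘(ℝ, E6) c).symm y

/-- The definition of `Form.inChart`, with the tangent spaces identified with the model space. -/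
theorem inChart_eq {k : ℕ} (α : M → E6 [⋀^Fin k]→L[ℝ] ℂ) (c : M) (y : E6) :
    Form.inChart (M := M) α c y = (α ((extChartAt 𝓘(ℝ, E6) c).symm y)).compContinuousLinearMap
      (chartSymmDeriv c y) := rfl

theorem chartSymmDeriv_eq (c : M) (y : E6) : chartSymmDeriv c y =
    mfderivWithin 𝓘(ℝ, E6) 𝓘(ℝ, E6) (extChartAt 𝓘(ℝ, E6) c).symm (Set.range 𝓘(ℝ, E6)) y := by
  rw [chartSymmDeriv, ModelWithCorners.range_eq_univ, mfderivWithin_univ]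

theorem Form.IsSmooth.contDiffAt {k : ℕ} {α : Form M k} (hα : α.IsSmooth) {c : M} {y : E6}
    (hy : y ∈ (extChartAt 𝓘(ℝ, E6) c).target) : ContDiffAt ℝ ∞ (α.inChart c) y :=
  (hα c).contDiffAt ((isOpen_extChartAt_target c).mem_nhds hy)

theorem Form.IsSmooth.differentiableAt {k : ℕ} {α : Form M k} (hα : α.IsSmooth) {c : M} {y : E6}
    (hy : y ∈ (extChartAt 𝓘(ℝ, E6) c).target) : DifferentiableAt ℝ (α.inChart c) y :=
  (hα.contDiffAt hy).differentiableAt (by norm_num)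

variable [IsManifold 𝓘(ℝ, E6) ∞ M]

theorem chartDeriv_self (c : M) : chartDeriv c c = ContinuousLinearMap.id ℝ E6 :=
  mfderiv_extChartAt_self

theorem chartSymmDeriv_self (c : M) :
    chartSymmDeriv c (extChartAt 𝓘(ℝ, E6) c c) = ContinuousLinearMap.id ℝ E6 := by
  rw [chartSymmDeriv_eq]
  exact mfderivWithin_range_extChartAt_symm

theorem chartDeriv_comp_chartSymmDeriv {c : M} {y : E6} (hy : y ∈ (extChartAt 𝓘(ℝ, E6) c).target) :
    chartDeriv c ((extChartAt 𝓘(ℝ, E6) c).symm y) ∘L chartSymmDeriv c y =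
      ContinuousLinearMap.id ℝ E6 := by
  rw [chartSymmDeriv_eq]
  exact mfderiv_extChartAt_comp_mfderivWithin_extChartAt_symm hy

theorem chartSymmDeriv_comp_chartDeriv {c : M} {y : E6} (hy : y ∈ (extChartAt 𝓘(ℝ, E6) c).target) :
    chartSymmDeriv c y ∘L chartDeriv c ((extChartAt 𝓘(ℝ, E6) c).symm y) =
      ContinuousLinearMap.id ℝ E6 := by
  rw [chartSymmDeriv_eq]
  exact mfderivWithin_extChartAt_symm_comp_mfderiv_extChartAt hy

theorem inChart_self {k : ℕ} (α : Form M k) (c : M) :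
    α.inChart c (extChartAt 𝓘(ℝ, E6) c c) = α c := by
  refine (inChart_eq α c _).trans ?_
  rw [chartSymmDeriv_self, extChartAt_to_inv]
  rfl

theorem extD_apply {k : ℕ} (α : Form M k) (c : M) :
    extD α c = extDeriv (α.inChart c) (extChartAt 𝓘(ℝ, E6) c c) := by
  have h : extD α c = (extDeriv (α.inChart c) (extChartAt 𝓘(ℝ, E6) c c)).compContinuousLinearMap
    (chartDeriv c c) := rfl
  rw [h, chartDeriv_self]
  rfl

theorem contDiffAt_chart_change {c p : M} {y : E6} (hy : y ∈ (extChartAt 𝓘(ℝ, E6) c).target)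
    (hp : (extChartAt 𝓘(ℝ, E6) c).symm y ∈ (extChartAt 𝓘(ℝ, E6) p).source) :
    ContDiffAt ℝ ∞ (fun z => extChartAt 𝓘(ℝ, E6) p ((extChartAt 𝓘(ℝ, E6) c).symm z)) y := by
  have h := contDiffWithinAt_ext_coord_change (I := 𝓘(ℝ, E6)) (n := ∞) p c (y := y)
    ⟨hy, hp⟩
  rwa [ModelWithCorners.range_eq_univ, contDiffWithinAt_univ] at h

theorem fderiv_chart_change {c p : M} {y : E6} (hy : y ∈ (extChartAt 𝓘(ℝ, E6) c).target)
    (hp : (extChartAt 𝓘(ℝ, E6) c).symm y ∈ (extChartAt 𝓘(ℝ, E6) p).source) :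
    fderiv ℝ (fun z => extChartAt 𝓘(ℝ, E6) p ((extChartAt 𝓘(ℝ, E6) c).symm z)) y =
      chartDeriv p ((extChartAt 𝓘(ℝ, E6) c).symm y) ∘L chartSymmDeriv c y := by
  rw [← mfderiv_eq_fderiv]
  have h := mdifferentiableWithinAt_extChartAt_symm (I := 𝓘(ℝ, E6)) hy
  rw [ModelWithCorners.range_eq_univ, mdifferentiableWithinAt_univ] at h
  exact mfderiv_comp (I' := 𝓘(ℝ, E6)) y
    (mdifferentiableAt_extChartAt (by rwa [← extChartAt_source 𝓘(ℝ, E6)])) h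

/-- The expression in the chart around `c` is, near `y`, the pullback of the expression in the chart
around another point by the change of coordinates. -/
theorem inChart_eventuallyEq {k : ℕ} (α : Form M k) {c p : M} {y : E6}
    (hy : y ∈ (extChartAt 𝓘(ℝ, E6) c).target)
    (hp : (extChartAt 𝓘(ℝ, E6) c).symm y ∈ (extChartAt 𝓘(ℝ, E6) p).source) :
    α.inChart c =ᶠ[𝓝 y] fun z =>
      (α.inChart p (extChartAt 𝓘(ℝ, E6) p
        ((extChartAt 𝓘(ℝ, E6) c).symm z))).compContinuousLinearMap
        (fderiv ℝ (fun z => extChartAt 𝓘(ℝ, E6) p ((extChartAt 𝓘(ℝ, E6) c).symm z)) z) := by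
  have h1 := (isOpen_extChartAt_target (I := 𝓘(ℝ, E6)) c).mem_nhds hy
  have h2 := (continuousAt_extChartAt_symm'' (I := 𝓘(ℝ, E6)) hy).preimage_mem_nhds
    ((isOpen_extChartAt_source (I := 𝓘(ℝ, E6)) p).mem_nhds hp)
  filter_upwards [h1, h2] with z hz hzp
  have h3 := chartSymmDeriv_comp_chartDeriv (M := M) ((extChartAt 𝓘(ℝ, E6) p).map_source hzp)
  have h4 := (extChartAt 𝓘(ℝ, E6) p).left_inv hzp
  rw [h4] at h3
  rw [fderiv_chart_change hz hzp]
  refine (inChart_eq α c z).trans (Eq.symm ?_)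
  refine (congrArg (fun β => ContinuousAlternatingMap.compContinuousLinearMap β _)
    (inChart_eq α p _)).trans ?_
  rw [h4]
  refine ContinuousAlternatingMap.ext fun v => congrArg (fun w : Fin k → E6 =>
    (α ((extChartAt 𝓘(ℝ, E6) c).symm z) : E6 [⋀^Fin k]→L[ℝ] ℂ) w) (funext fun i => ?_)
  exact congrArg (fun L : E6 →L[ℝ] E6 => L (chartSymmDeriv c z (v i))) h3

/-- The exterior derivative does not depend on the chart. -/
theorem inChart_extD {k : ℕ} {α : Form M k} (hα : α.IsSmooth) {c : M} {y : E6}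
    (hy : y ∈ (extChartAt 𝓘(ℝ, E6) c).target) :
    (extD α).inChart c y = extDeriv (α.inChart c) y := by
  have hp := mem_extChartAt_source (I := 𝓘(ℝ, E6)) ((extChartAt 𝓘(ℝ, E6) c).symm y)
  refine ((inChart_eq (extD α) c y).trans ?_).trans
    (inChart_eventuallyEq α hy hp).extDeriv.self_of_nhds.symm
  have h := extDeriv_pullback (x := y) (f := fun z => extChartAt 𝓘(ℝ, E6)
      ((extChartAt 𝓘(ℝ, E6) c).symm y) ((extChartAt 𝓘(ℝ, E6) c).symm z))
    (hα.differentiableAt (mem_extChartAt_target ((extChartAt 𝓘(ℝ, E6) c).symm y)))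
    (contDiffAt_chart_change hy hp)
    (by simpa using ENat.LEInfty.out)
  rw [fderiv_chart_change hy hp, chartDeriv_self] at h
  rw [extD_apply]
  exact h.symm

theorem extD_extD {k : ℕ} {α : Form M k} (hα : α.IsSmooth) (x : M) : extD (extD α) x = 0 := by
  have hx := mem_extChartAt_target (I := 𝓘(ℝ, E6)) x
  rw [extD_apply]
  have h : (extD α).inChart x =ᶠ[𝓝 (extChartAt 𝓘(ℝ, E6) x x)] extDeriv (α.inChart x) := by
    filter_upwards [(isOpen_extChartAt_target x).mem_nhds hx] with y hy
    exact inChart_extD hα hy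
  rw [h.extDeriv.self_of_nhds]
  exact extDeriv_extDeriv_apply (hα.contDiffAt hx) (by simpa using ENat.LEInfty.out)

/-- An endomorphism field in the chart around `c`. -/
def endInChart (J : M → E6 →L[ℝ] E6) (c : M) (y : E6) : E6 →L[ℝ] E6 :=
  chartDeriv c ((extChartAt 𝓘(ℝ, E6) c).symm y) ∘L J ((extChartAt 𝓘(ℝ, E6) c).symm y) ∘L
    chartSymmDeriv c y

theorem endInChart_self (J : M → E6 →L[ℝ] E6) (c : M) :
    endInChart J c (extChartAt 𝓘(ℝ, E6) c c) = J c := by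
  rw [endInChart, chartSymmDeriv_self, extChartAt_to_inv, chartDeriv_self]
  rfl

/-- A smooth endomorphism field is smooth in the charts: the trivialization of the tangent bundle
around `c` is the derivative of the chart. -/
theorem contDiffAt_endInChart
    {J : (x : M) → TangentSpace 𝓘(ℝ, E6) x →L[ℝ] TangentSpace 𝓘(ℝ, E6) x}
    (hJ : ContMDiff 𝓘(ℝ, E6) (𝓘(ℝ, E6).prod 𝓘(ℝ, E6 →L[ℝ] E6)) ∞
      (fun x => TotalSpace.mk' (E6 →L[ℝ] E6)
        (E := fun x : M => TangentSpace 𝓘(ℝ, E6) x →L[ℝ] TangentSpace 𝓘(ℝ, E6) x) x (J x)))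
    (c : M) : ContDiffAt ℝ ∞ (endInChart J c) (extChartAt 𝓘(ℝ, E6) c c) := by
  have h := ((contMDiffAt_hom_bundle _).1 (hJ c)).2
  rw [contMDiffAt_iff_source, ModelWithCorners.range_eq_univ, contMDiffWithinAt_univ,
    contMDiffAt_iff_contDiffAt] at h
  refine h.congr_of_eventuallyEq ?_
  filter_upwards [(isOpen_extChartAt_target (I := 𝓘(ℝ, E6)) c).mem_nhds
    (mem_extChartAt_target c)] with y hy
  have hy' : (extChartAt 𝓘(ℝ, E6) c).symm y ∈ (chartAt E6 c).source := by
    rw [← extChartAt_source 𝓘(ℝ, E6)]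
    exact (extChartAt 𝓘(ℝ, E6) c).map_target hy
  have h1 := TangentBundle.continuousLinearMapAt_trivializationAt (I := 𝓘(ℝ, E6)) hy'
  have h2 := TangentBundle.symmL_trivializationAt (I := 𝓘(ℝ, E6)) hy'
  rw [(extChartAt 𝓘(ℝ, E6) c).right_inv hy] at h2
  have h3 : endInChart J c y = chartDeriv c ((extChartAt 𝓘(ℝ, E6) c).symm y) ∘L
      (J ((extChartAt 𝓘(ℝ, E6) c).symm y) : E6 →L[ℝ] E6) ∘L mfderivWithin 𝓘(ℝ, E6) 𝓘(ℝ, E6)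
        (extChartAt 𝓘(ℝ, E6) c).symm (Set.range 𝓘(ℝ, E6)) y :=
    congrArg (fun L : E6 →L[ℝ] E6 => chartDeriv c ((extChartAt 𝓘(ℝ, E6) c).symm y) ∘L
      (J ((extChartAt 𝓘(ℝ, E6) c).symm y) : E6 →L[ℝ] E6) ∘L L) (chartSymmDeriv_eq c y)
  rw [h3]
  change _ = ((trivializationAt E6 (TangentSpace 𝓘(ℝ, E6)) c).continuousLinearMapAt ℝ
    ((extChartAt 𝓘(ℝ, E6) c).symm y)).comp ((J ((extChartAt 𝓘(ℝ, E6) c).symm y)).comp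
      ((trivializationAt E6 (TangentSpace 𝓘(ℝ, E6)) c).symmL ℝ ((extChartAt 𝓘(ℝ, E6) c).symm y)))
  rw [h1, h2]
  rfl

/-- The projections to the types are natural for complex linear maps. -/
theorem typeProj_comp {V W : Type*} [NormedAddCommGroup V] [NormedSpace ℝ V]
    [NormedAddCommGroup W] [NormedSpace ℝ W] {J : V →L[ℝ] V} {J' : W →L[ℝ] W} {φ : W →L[ℝ] V}
    (h : ∀ w, φ (J' w) = J (φ w)) (p q : ℤ) {k : ℕ} (a : V [⋀^Fin k]→L[ℝ] ℂ) :
    (typeProj J p q a).compContinuousLinearMap φ =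
      typeProj J' p q (a.compContinuousLinearMap φ) := by
  unfold typeProj
  split_ifs
  · ext v
    simp only [ContinuousAlternatingMap.compContinuousLinearMap_apply,
      ContinuousAlternatingMap.smul_apply, ContinuousAlternatingMap.sum_apply]
    congr 1
    refine Finset.sum_congr rfl fun j _ => ?_
    congr 2
    funext i
    simp [rot, h]
  · rfl

theorem inChart_typeProj {k : ℕ} (J : M → E6 →L[ℝ] E6) (α : M → E6 [⋀^Fin k]→L[ℝ] ℂ) (p q : ℤ)
    {c : M} {y : E6} (hy : y ∈ (extChartAt 𝓘(ℝ, E6) c).target) :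
    Form.inChart (M := M) (fun x => typeProj (J x) p q (α x)) c y =
      typeProj (endInChart J c y) p q (Form.inChart (M := M) α c y) := by
  refine (inChart_eq _ c y).trans
    ((typeProj_comp (J' := endInChart J c y) (fun w => ?_) p q _).trans
      (congrArg _ (inChart_eq _ c y).symm))
  exact congrArg (fun L : E6 →L[ℝ] E6 => L (J _ (chartSymmDeriv c y w)))
    (chartSymmDeriv_comp_chartDeriv hy)

end Charts

/-! ### Adapted frames of the tangent spaces -/

section UnitaryFrames

/-- The dual basis of a complex basis `u` which together with `J u` is orthonormal.  The last clause
expresses the Hermitian form `⟨J ·, ·⟩` as `(√-1 / 2) ∑ᵢ θᵢ ∧ θ̄ᵢ`. -/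
theorem exists_dual_frame {V : Type*} [NormedAddCommGroup V] [InnerProductSpace ℝ V]
    [FiniteDimensional ℝ V] (hV : Module.finrank ℝ V = 6) {J : V →L[ℝ] V}
    (hJ : ∀ v, J (J v) = -v) (hJi : ∀ v w, inner ℝ (J v) (J w) = inner ℝ v w) {u : Fin 3 → V}
    (hu : ∀ i j, inner ℝ (u i) (u j) = if i = j then (1 : ℝ) else 0)
    (huJ : ∀ i j, inner ℝ (u i) (J (u j)) = (0 : ℝ)) :
    ∃ θ : Fin 3 → V →L[ℝ] ℂ, (∀ i v, θ i (J v) = Complex.I * θ i v) ∧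
      (∀ i j, θ i (u j) = if i = j then 1 else 0) ∧
      (∀ v, ∑ i, ((θ i v).re • u i + (θ i v).im • J (u i)) = v) ∧
      (∀ i, ∑ j, (θ i (stdOrthonormalBasis ℝ V j)).re • stdOrthonormalBasis ℝ V j = u i ∧
        ∑ j, (θ i (stdOrthonormalBasis ℝ V j)).im • stdOrthonormalBasis ℝ V j = J (u i)) ∧
      ∀ v w, ((inner ℝ (J v) w : ℝ) : ℂ) = (Complex.I / 2) * ∑ i,
        (θ i v * (starRingEnd ℂ) (θ i w) - (starRingEnd ℂ) (θ i v) * θ i w) := by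
  have hskew : ∀ v w, inner ℝ (J v) w = -inner ℝ v (J w) := by
    intro v w
    rw [← hJi v (J w), hJ, inner_neg_right, neg_neg]
  let θ : Fin 3 → V →L[ℝ] ℂ := fun i => Complex.ofRealCLM ∘L innerSL ℝ (u i) +
    Complex.I • (Complex.ofRealCLM ∘L innerSL ℝ (J (u i)))
  have hθ : ∀ i v, θ i v = (inner ℝ (u i) v : ℝ) + Complex.I * (inner ℝ (J (u i)) v : ℝ) :=
    fun i v => rfl
  have hre : ∀ i v, (θ i v).re = inner ℝ (u i) v := fun i v => by simp [hθ]
  have him : ∀ i v, (θ i v).im = inner ℝ (J (u i)) v := fun i v => by simp [hθ]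
  let b₀ : Fin 3 ⊕ Fin 3 → V := Sum.elim u fun i => J (u i)
  have hb₀ : Orthonormal ℝ b₀ := by
    rw [orthonormal_iff_ite]
    rintro (i | i) (j | j)
    · simpa [b₀] using hu i j
    · simpa [b₀] using huJ i j
    · simpa [b₀, hskew] using huJ i j
    · simpa [b₀, hJi] using hu i j
  let b : OrthonormalBasis (Fin 3 ⊕ Fin 3) ℝ V := OrthonormalBasis.mk hb₀ (by
    rw [hb₀.linearIndependent.span_eq_top_of_card_eq_finrank (by simp [hV])])
  have hbl : ∀ i, b (Sum.inl i) = u i := fun i => by simp [b, b₀]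
  have hbr : ∀ i, b (Sum.inr i) = J (u i) := fun i => by simp [b, b₀]
  refine ⟨θ, fun i v => ?_, fun i j => ?_, fun v => ?_, fun i => ⟨?_, ?_⟩, fun v w => ?_⟩
  · have h1 : inner ℝ (u i) (J v) = -inner ℝ (J (u i)) v := by rw [hskew, neg_neg]
    rw [hθ, hθ, hJi, h1]
    push_cast
    linear_combination (-(inner ℝ (J (u i)) v : ℝ) : ℂ) * Complex.I_mul_I
  · rw [hθ, hu, hskew, huJ]
    split_ifs <;> simp
  · have := b.sum_repr' v
    rw [Fintype.sum_sum_type] at this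
    simp only [hre, him, Finset.sum_add_distrib]
    simpa only [hbl, hbr] using this
  · simp only [hre, real_inner_comm _ (u i)]
    exact (stdOrthonormalBasis ℝ V).sum_repr' _
  · simp only [him, real_inner_comm _ (J (u i))]
    exact (stdOrthonormalBasis ℝ V).sum_repr' _
  · rw [← b.sum_inner_mul_inner, Fintype.sum_sum_type, ← Finset.sum_add_distrib, Finset.mul_sum,
      Complex.ofReal_sum]
    refine Finset.sum_congr rfl fun i _ => ?_
    have h1 : inner ℝ (J v) (u i) = -inner ℝ (J (u i)) v := by
      rw [hskew, real_inner_comm]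
    rw [hbl, hbr, hJi, h1, real_inner_comm (u i) v, ← hre, ← hre, ← him, ← him]
    generalize θ i v = z
    generalize θ i w = z'
    apply Complex.ext <;> simp
    ring

variable {M : Type*} [TopologicalSpace M] [ChartedSpace E6 M]

theorem finrank_tangentSpace (x : M) : Module.finrank ℝ (TangentSpace 𝓘(ℝ, E6) x) = 6 :=
  finrank_euclideanSpace_fin

theorem card_fin_finrank_tangentSpace (x : M) :
    Fintype.card (Fin (Module.finrank ℝ (TangentSpace 𝓘(ℝ, E6) x))) ≤ 6 := by
  rw [Fintype.card_fin, finrank_tangentSpace]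

variable [RiemannianBundle (fun x : M => TangentSpace 𝓘(ℝ, E6) x)]

/-- The orthonormal basis of the tangent space in the definition of `fiberInner`. -/
def tangentBasis (x : M) :
    Module.Basis (Fin (Module.finrank ℝ (TangentSpace 𝓘(ℝ, E6) x))) ℝ E6 :=
  (stdOrthonormalBasis ℝ (TangentSpace 𝓘(ℝ, E6) x)).toBasis

theorem tangentBasis_apply (x : M) (j : Fin (Module.finrank ℝ (TangentSpace 𝓘(ℝ, E6) x))) :
    tangentBasis x j = stdOrthonormalBasis ℝ (TangentSpace 𝓘(ℝ, E6) x) j :=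
  congrFun (stdOrthonormalBasis ℝ (TangentSpace 𝓘(ℝ, E6) x)).coe_toBasis j

/-- The Hermitian product on the forms at `x` is the one defined by an orthonormal basis. -/
theorem fiberInner_eq (x : M) (a b : MixedForm E6) :
    fiberInner x a b = formInner (tangentBasis x) a b := by
  simp only [formInner, tangentBasis]
  rfl

variable [IsManifold 𝓘(ℝ, E6) ∞ M]

/-- A unitary frame of the tangent space at `x`, adapted to the complex volume form. -/
structure SU3Structure.Frame (S : SU3Structure M) (x : M) extends
    ComplexFrame (V := E6) (S.J x) where
  unitary : toComplexFrame.IsUnitary (tangentBasis x)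
  om_eq : (S.om x : E6 [⋀^Fin 2]→L[ℝ] ℂ) = toComplexFrame.lefschetzOp oneForm 2
  Ω_u : S.Ω x u = 1

theorem SU3Structure.nonempty_frame (S : SU3Structure M) (x : M) : Nonempty (S.Frame x) := by
  obtain ⟨u, hu, huJ, hΩ⟩ := S.normalized x
  obtain ⟨θ, h1, h2, h3, h4, h5⟩ := exists_dual_frame (finrank_tangentSpace x) (S.J_sq x)
    (S.inner_J x) hu huJ
  let F : ComplexFrame (V := E6) (S.J x) := ⟨u, θ, h1, h2, h3⟩
  refine ⟨⟨F, fun i => ?_, ?_, hΩ⟩⟩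
  · simp only [tangentBasis_apply]
    exact h4 i
  · refine ContinuousAlternatingMap.ext fun v => ?_
    have hv : v = ![v 0, v 1] := by
      funext i
      fin_cases i <;> rfl
    have key : ∀ a b : E6, (S.om x : E6 [⋀^Fin 2]→L[ℝ] ℂ) ![a, b] =
        F.lefschetzOp oneForm 2 ![a, b] := fun a b =>
      ((S.om_apply x a b).trans (h5 a b)).trans (F.lefschetzOp_oneForm_apply a b).symm
    rw [hv]
    exact key _ _

/-- The forms of type `(k + 1, 0)` are complex linear. -/
theorem curryLeft_of_formsOfType {V : Type*} [NormedAddCommGroup V] [NormedSpace ℝ V]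
    {J : V →L[ℝ] V} {k : ℕ} {c : V [⋀^Fin (k + 1)]→L[ℝ] ℂ}
    (hc : c ∈ formsOfType J (k + 1) 0 (k + 1)) (v : V) :
    c.curryLeft (J v) = Complex.I • c.curryLeft v := by
  ext w
  change c (Matrix.vecCons (J v) w) = Complex.I * c (Matrix.vecCons v w)
  induction hc using Submodule.span_induction with
  | zero => simp
  | add a b _ _ ha hb =>
    rw [ContinuousAlternatingMap.add_apply, ContinuousAlternatingMap.add_apply, ha, hb, mul_add]
  | smul c a _ ha =>
    rw [ContinuousAlternatingMap.smul_apply, ContinuousAlternatingMap.smul_apply, ha, smul_eq_mul,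
      smul_eq_mul]
    ring
  | mem a ha =>
    obtain ⟨-, ξ, hξ, -, hdet⟩ := ha
    have := Matrix.det_mul_row (Matrix.vecCons Complex.I fun _ : Fin k => 1)
      (Matrix.of fun i j => ξ i (Matrix.vecCons v w j))
    rw [Fin.prod_univ_succ] at this
    simp only [Matrix.cons_val_zero, Matrix.cons_val_succ, Finset.prod_const_one, mul_one] at this
    rw [hdet, hdet, ← this]
    congr 1
    ext i j
    refine Fin.cases ?_ (fun j => ?_) j
    · simp [hξ i i.2]
    · simp

/-- The conjugate of a complex-valued form. -/
def conjAlt {V : Type*} [NormedAddCommGroup V] [NormedSpace ℝ V] {k : ℕ} (a : V [⋀^Fin k]→L[ℝ] ℂ) :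
    V [⋀^Fin k]→L[ℝ] ℂ :=
  (Complex.conjCLE : ℂ →L[ℝ] ℂ).compContinuousAlternatingMap a

theorem curryLeft_conjAlt {V : Type*} [NormedAddCommGroup V] [NormedSpace ℝ V] {J : V →L[ℝ] V}
    {k : ℕ} {c : V [⋀^Fin (k + 1)]→L[ℝ] ℂ}
    (hc : ∀ v, c.curryLeft (J v) = Complex.I • c.curryLeft v) (v : V) :
    (conjAlt c).curryLeft ((-J) v) = Complex.I • (conjAlt c).curryLeft v := by
  ext w
  change (starRingEnd ℂ) (c.curryLeft (-J v) w) = Complex.I * (starRingEnd ℂ) (c.curryLeft v w)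
  rw [map_neg, hc]
  simp

/-- The conjugate of the complex volume form. -/
def SU3Structure.conjΩ (S : SU3Structure M) : Form M 3 := fun x =>
  conjAlt (V := E6) (S.Ω x)

variable {S : SU3Structure M} {x : M}

theorem SU3Structure.Frame.conjΩ_eq (F : S.Frame x) :
    (S.conjΩ x : E6 [⋀^Fin 3]→L[ℝ] ℂ) = F.conj.vol 3 := by
  refine F.conj.eq_vol (curryLeft_conjAlt (curryLeft_of_formsOfType (S.Ω_type x))) ?_
  have h := F.Ω_u
  change (starRingEnd ℂ) (S.Ω x F.u) = 1
  rw [h, map_one]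

end UnitaryFrames

/-! ### The component `d^{2,-1}` on a manifold -/

section Torsion

variable {V : Type*} [NormedAddCommGroup V] [NormedSpace ℝ V]

theorem extDeriv_complex_smul {k : ℕ} (c : ℂ) {β : V → V [⋀^Fin k]→L[ℝ] ℂ} {y : V}
    (hβ : DifferentiableAt ℝ β y) : extDeriv (fun y => c • β y) y = c • extDeriv β y := by
  have h : fderiv ℝ (fun y => c • β y) y = c • fderiv ℝ β y :=
    (hβ.hasFDerivAt.const_smul c).fderiv
  have h' : ∀ (u : V) (w : Fin k → V), (c • fderiv ℝ β y) u w = c * fderiv ℝ β y u w :=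
    fun _ _ => rfl
  ext v
  rw [extDeriv, h]
  simp only [ContinuousAlternatingMap.alternatizeUncurryFin_apply, extDeriv,
    ContinuousAlternatingMap.smul_apply, smul_eq_mul, Finset.mul_sum, zsmul_eq_mul, h']
  refine Finset.sum_congr rfl fun i _ => ?_
  ring

theorem differentiableAt_typeProj {J : V → V →L[ℝ] V} {k : ℕ} {β : V → V [⋀^Fin k]→L[ℝ] ℂ} {y : V}
    (hJ : DifferentiableAt ℝ J y) (hβ : DifferentiableAt ℝ β y) (p q : ℤ) :
    DifferentiableAt ℝ (fun y => typeProj (J y) p q (β y)) y := by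
  unfold typeProj
  split_ifs
  · have h : ∀ (t : ℝ) (c : ℂ), DifferentiableAt ℝ
        (fun y => c • (β y).compContinuousLinearMap (rot (J y) t)) y := fun t c =>
      (hβ.continuousAlternatingMapCompContinuousLinearMap
        ((differentiableAt_const _).add (hJ.const_smul (Real.sin t)))).const_smul c
    exact (DifferentiableAt.fun_sum fun j _ => h _ _).const_smul (((2 * k + 1 : ℕ) : ℂ)⁻¹)
  · exact differentiableAt_const _

theorem torsionOp_apply_zero [FiniteDimensional ℝ V] {ι : Type*} [Fintype ι]
    (e : Module.Basis ι ℝ V) (J : V →L[ℝ] V) (K : ι → V →L[ℝ] V) (a : MixedForm V) :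
    torsionOp e J K a 0 = 0 := by
  simp only [torsionOp, LinearMap.smul_apply, LinearMap.sum_apply, Pi.smul_apply, Finset.sum_apply]
  exact (congrArg _ (Finset.sum_eq_zero fun _ _ => rfl)).trans (form_smul_zero _)

/-- The torsion operator in degree `k + 1` depends only on the component of degree `k`. -/
theorem torsionOp_single [FiniteDimensional ℝ V] {ι : Type*} [Fintype ι] (e : Module.Basis ι ℝ V)
    (J : V →L[ℝ] V) (K : ι → V →L[ℝ] V) (a : MixedForm V) (k : ℕ) :
    torsionOp e J K (Pi.single k (a k)) (k + 1) = torsionOp e J K a (k + 1) := by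
  rw [torsionOp_apply_succ, torsionOp_apply_succ, Pi.single_eq_same]

theorem typeProj_typeProj [FiniteDimensional ℝ V] {J : V →L[ℝ] V} (hJ : ∀ v, J (J v) = -v)
    (p q : ℤ) {k : ℕ} (b : V [⋀^Fin k]→L[ℝ] ℂ) :
    typeProj J p q (typeProj J p q b) = typeProj J p q b := by
  by_cases hk : p + q = k
  · exact typeProj_eq_self_of_weight hJ hk (typeProj_mem_weightForms hJ p q b).1
  · have h : ∀ a : V [⋀^Fin k]→L[ℝ] ℂ, typeProj J p q a = 0 := fun a => by
      rw [typeProj, if_neg fun h => hk h.2.2]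
    rw [h, h]

variable {M : Type*} [TopologicalSpace M] [ChartedSpace E6 M] [IsManifold 𝓘(ℝ, E6) ∞ M]

theorem endInChart_endInChart {J : M → E6 →L[ℝ] E6} (hJ : ∀ x v, J x (J x v) = -v) {c : M} {y : E6}
    (hy : y ∈ (extChartAt 𝓘(ℝ, E6) c).target) (v : E6) :
    endInChart J c y (endInChart J c y v) = -v := by
  have h1 := fun w => congrArg (fun L : E6 →L[ℝ] E6 => L w) (chartSymmDeriv_comp_chartDeriv hy)
  have h2 := fun w => congrArg (fun L : E6 →L[ℝ] E6 => L w) (chartDeriv_comp_chartSymmDeriv hy)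
  simp only [ContinuousLinearMap.comp_apply, ContinuousLinearMap.id_apply] at h1 h2
  simp only [endInChart, ContinuousLinearMap.comp_apply, h1, hJ, map_neg, h2]

theorem fderiv_endInChart {J : M → E6 →L[ℝ] E6} (hJ : ∀ x v, J x (J x v) = -v) {x : M}
    (hJd : DifferentiableAt ℝ (endInChart J x) (extChartAt 𝓘(ℝ, E6) x x)) (u v : E6) :
    fderiv ℝ (endInChart J x) (extChartAt 𝓘(ℝ, E6) x x) u (J x v) =
      -J x (fderiv ℝ (endInChart J x) (extChartAt 𝓘(ℝ, E6) x x) u v) := by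
  have hx := (isOpen_extChartAt_target (I := 𝓘(ℝ, E6)) x).mem_nhds (mem_extChartAt_target x)
  have h := fderiv_complexStructure hJd
    (Filter.Eventually.mono hx fun y hy => endInChart_endInChart hJ hy) u v
  rwa [endInChart_self] at h

/-- The component of type `(p + 2, q - 1)` of the differential of a form of type `(p, q)` is
algebraic; this is `typeProj_extDeriv` in the chart around `x`. -/
theorem typeProj_extD {ι : Type*} [Fintype ι] (e : Module.Basis ι ℝ E6)
    {J : M → E6 →L[ℝ] E6} (hJ : ∀ x v, J x (J x v) = -v) {x : M}
    (hJd : DifferentiableAt ℝ (endInChart J x) (extChartAt 𝓘(ℝ, E6) x x)) {k : ℕ}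
    {β : M → E6 [⋀^Fin k]→L[ℝ] ℂ}
    (hβd : DifferentiableAt ℝ (Form.inChart (M := M) β x) (extChartAt 𝓘(ℝ, E6) x x)) {p q : ℤ}
    (hpq : p + q = k) (hβ : ∀ y, typeProj (J y) p q (β y) = β y) :
    typeProj (J x) (p + 2) (q + -1) (extD (M := M) β x) = torsionOp e (J x)
      (fun j => fderiv ℝ (endInChart J x) (extChartAt 𝓘(ℝ, E6) x x) (e j))
      (Pi.single k (β x)) (k + 1) := by
  have hx := (isOpen_extChartAt_target (I := 𝓘(ℝ, E6)) x).mem_nhds (mem_extChartAt_target x)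
  have h := typeProj_extDeriv e hJd hβd
    (Filter.Eventually.mono hx fun y hy => endInChart_endInChart hJ hy) (w := p - q)
    (p := p + 2) (q := q + -1) (Filter.Eventually.mono hx fun y hy => ?_)
    (by push_cast; linarith) (by ring)
  · rw [endInChart_self] at h
    exact ((congrArg _ (extD_apply (M := M) β x)).trans h).trans
      (congrArg (fun b => torsionOp e (J x) _ (Pi.single k b) (k + 1))
        (inChart_self (M := M) β x))
  · have h1 : Form.inChart (M := M) β x y =
        typeProj (endInChart J x y) p q (Form.inChart (M := M) β x y) := by
      rw [← inChart_typeProj J β p q hy]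
      exact congrArg (fun β : M → E6 [⋀^Fin k]→L[ℝ] ℂ => Form.inChart (M := M) β x y)
        (funext hβ).symm
    rw [h1]
    exact (typeProj_mem_weightForms (endInChart_endInChart hJ hy) _ _ _).1

/-- The component `d^{2,-1}` of the differential is the torsion operator of `J`. -/
theorem deRhamComponent_two_neg_one {ι : Type*} [Fintype ι] (e : Module.Basis ι ℝ E6)
    {J : M → E6 →L[ℝ] E6} (hJ : ∀ x v, J x (J x v) = -v) {x : M}
    (hJd : DifferentiableAt ℝ (endInChart J x) (extChartAt 𝓘(ℝ, E6) x x)) {α : GForm M}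
    (hα : ∀ k, DifferentiableAt ℝ ((α k).inChart x) (extChartAt 𝓘(ℝ, E6) x x)) (k : ℕ) :
    deRhamComponent (M := M) J 2 (-1) α k x = torsionOp e (J x)
      (fun j => fderiv ℝ (endInChart J x) (extChartAt 𝓘(ℝ, E6) x x) (e j))
      (fun k => α k x : MixedForm E6) k := by
  cases k with
  | zero =>
    exact (torsionOp_apply_zero e (J x) _ (fun k => α k x : MixedForm E6)).symm
  | succ k =>
    set y₀ := extChartAt 𝓘(ℝ, E6) x x with hy₀
    have hx := (isOpen_extChartAt_target (I := 𝓘(ℝ, E6)) x).mem_nhds (mem_extChartAt_target x)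
    set T := torsionOp e (J x) (fun j => fderiv ℝ (endInChart J x) y₀ (e j)) with hT
    let T' : (E6 [⋀^Fin k]→L[ℝ] ℂ) →ₗ[ℂ] (E6 [⋀^Fin (k + 1)]→L[ℝ] ℂ) :=
      LinearMap.proj (k + 1) ∘ₗ T ∘ₗ LinearMap.single ℂ (fun k => E6 [⋀^Fin k]→L[ℝ] ℂ) k
    have hT' : ∀ a : MixedForm E6, T a (k + 1) = T' (a k) := by
      intro a
      change T a (k + 1) = T (Pi.single k (a k)) (k + 1)
      exact (torsionOp_single e (J x) _ a k).symm
    have hsum : T (fun k => α k x) (k + 1) =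
        ∑ p ∈ Finset.range (k + 1), T' (typeProj (J x) p ((k : ℤ) - p) (α k x)) := by
      have h := sum_typeProj (hJ x) (V := E6) (α k x)
      rw [← map_sum]
      exact (hT' _).trans (congrArg T' h.symm)
    refine Eq.trans ?_ hsum.symm
    refine Finset.sum_congr rfl fun p _ => ?_
    have hβ : Form.inChart (M := M) (fun y => typeProj (J y) p ((k : ℤ) - p) (α k y)) x =ᶠ[𝓝 y₀]
        fun y => typeProj (endInChart J x y) p ((k : ℤ) - p) ((α k).inChart x y) :=
      Filter.Eventually.mono hx fun y hy => inChart_typeProj J (α k) p _ hy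
    exact typeProj_extD e hJ hJd (β := fun y => typeProj (J y) p ((k : ℤ) - p) (α k y))
      ((differentiableAt_typeProj hJd (hα k) p ((k : ℤ) - p)).congr_of_eventuallyEq hβ)
      (by ring) fun y => typeProj_typeProj (hJ y) _ _ _

end Torsion

/-! ### Conjugation of forms -/

section ConjugateVolume

variable {V : Type*} [NormedAddCommGroup V] [NormedSpace ℝ V]

theorem conjAlt_apply {k : ℕ} (a : V [⋀^Fin k]→L[ℝ] ℂ) (v : Fin k → V) :
    conjAlt a v = (starRingEnd ℂ) (a v) := rfl

theorem conjAlt_mem_formsOfType {J : V →L[ℝ] V} {k p q : ℕ} {a : V [⋀^Fin k]→L[ℝ] ℂ}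
    (ha : a ∈ formsOfType J p q k) : conjAlt a ∈ formsOfType (-J) p q k := by
  induction ha using Submodule.span_induction with
  | zero =>
    convert (formsOfType (-J) p q k).zero_mem
    ext v
    simp [conjAlt_apply]
  | add a b _ _ ha hb =>
    convert (formsOfType (-J) p q k).add_mem ha hb
    ext v
    simp [conjAlt_apply]
  | smul c a _ ha =>
    convert (formsOfType (-J) p q k).smul_mem ((starRingEnd ℂ) c) ha
    ext v
    simp [conjAlt_apply]
  | mem a ha =>
    obtain ⟨h, ξ, h₁, h₂, hdet⟩ := ha
    refine Submodule.subset_span ⟨h, fun i => (Complex.conjCLE : ℂ →L[ℝ] ℂ) ∘L ξ i,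
      fun i hi v => ?_, fun i hi v => ?_, fun v => ?_⟩
    · change (starRingEnd ℂ) (ξ i (-J v)) = Complex.I * (starRingEnd ℂ) (ξ i v)
      rw [map_neg, h₁ i hi]
      simp
    · change (starRingEnd ℂ) (ξ i (-J v)) = -Complex.I * (starRingEnd ℂ) (ξ i v)
      rw [map_neg, h₂ i hi]
      simp
    · rw [conjAlt_apply, hdet, RingHom.map_det]
      rfl

theorem conjAlt_eq {k : ℕ} (a : V [⋀^Fin k]→L[ℝ] ℂ) :
    conjAlt a = reForm a + (-Complex.I) • imForm a := by
  ext v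
  change (starRingEnd ℂ) (a v) = ((a v).re : ℂ) + -Complex.I * ((a v).im : ℂ)
  apply Complex.ext <;> simp

variable {n : ℕ∞ω} in
theorem contDiff_compForm {k : ℕ} (f : ℂ →L[ℝ] ℂ) : ContDiff ℝ n
    fun a : V [⋀^Fin k]→L[ℝ] ℂ => f.compContinuousAlternatingMap a :=
  (ContinuousLinearMap.compContinuousAlternatingMapCLM ℝ V ℂ ℂ (Fin k) f).contDiff

variable {M : Type*} [TopologicalSpace M] [ChartedSpace E6 M]

theorem Form.IsSmooth.compForm {k : ℕ} {α : Form M k} (hα : α.IsSmooth) (f : ℂ →L[ℝ] ℂ) :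
    Form.IsSmooth (M := M) fun x => f.compContinuousAlternatingMap (α x) := fun c =>
  (contDiff_compForm f).comp_contDiffOn (hα c)

end ConjugateVolume

/-! ### The operator `N` of a nearly Kähler manifold -/

section NearlyKahlerEquations

variable {M : Type*} [TopologicalSpace M] [ChartedSpace E6 M] [IsManifold 𝓘(ℝ, E6) ∞ M]

theorem extD_smul {k : ℕ} {α : Form M k} (hα : α.IsSmooth) (c : ℂ) (x : M) :
    extD (fun y => c • α y) x = c • extD α x := by
  rw [extD_apply, extD_apply]
  exact extDeriv_complex_smul c (hα.differentiableAt (mem_extChartAt_target x))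

theorem extD_add {k : ℕ} {α β : Form M k} (hα : α.IsSmooth) (hβ : β.IsSmooth) (x : M) :
    extD (fun y => α y + β y) x = extD α x + extD β x := by
  rw [extD_apply, extD_apply, extD_apply]
  exact extDeriv_add (hα.differentiableAt (mem_extChartAt_target x))
    (hβ.differentiableAt (mem_extChartAt_target x))

variable [RiemannianBundle (fun x : M => TangentSpace 𝓘(ℝ, E6) x)]

/-- The nearly Kähler equations with the constant `lam`. -/
def SU3Structure.IsNearlyKahlerWith (S : SU3Structure M) (lam : ℝ) : Prop :=
  (∀ x, extD S.om x = (3 * lam : ℂ) • reForm (S.Ω x)) ∧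
    ∀ x, extD (fun y => imForm (S.Ω y)) x =
      (-2 * lam : ℂ) • wedge (rfl : 2 + 2 = 4) (S.om x) (S.om x)

variable {S : SU3Structure M} {lam : ℝ}

/-- The real part of `Ω` is closed, as `3 λ Re Ω` is the differential of `ω` and `λ ≠ 0`. -/
theorem SU3Structure.IsNearlyKahlerWith.extD_reForm (h : S.IsNearlyKahlerWith lam) (h0 : lam ≠ 0)
    (x : M) : extD (fun y => reForm (S.Ω y)) x = 0 := by
  have h1 := extD_extD S.smooth_om x
  rw [show extD S.om = fun x => (3 * lam : ℂ) • reForm (S.Ω x) from funext h.1,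
    extD_smul (α := fun x => reForm (S.Ω x)) (S.smooth_Ω.compForm _)] at h1
  exact form_eq_zero_of_smul (V := E6) (by simpa using h0) h1

/-- The differential of `Ω̄` is `-√-1 d Im Ω`; it is of type `(2,2)`, and hence the value of `N` on
`Ω̄`. -/
theorem SU3Structure.IsNearlyKahlerWith.extD_conjΩ (h : S.IsNearlyKahlerWith lam) (h0 : lam ≠ 0)
    (x : M) : extD S.conjΩ x =
      (2 * Complex.I * lam : ℂ) • wedge (rfl : 2 + 2 = 4) (S.om x) (S.om x) := by
  have h1 : S.conjΩ = fun x => reForm (S.Ω x) + (-Complex.I) • imForm (S.Ω x) :=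
    funext fun x => conjAlt_eq (V := E6) (S.Ω x)
  have h2 := extD_smul (S.smooth_Ω.compForm (Complex.ofRealCLM.comp Complex.imCLM)) (-Complex.I) x
  have h3 := h.2 x
  rw [h1, extD_add (α := fun x => reForm (S.Ω x)) (β := fun x => (-Complex.I) • imForm (S.Ω x))
      (S.smooth_Ω.compForm _)
      (S.smooth_Ω.compForm ((-Complex.I) • Complex.ofRealCLM.comp Complex.imCLM)),
    h.extD_reForm h0, zero_add]
  refine h2.trans ((congrArg _ h3).trans ?_)
  rw [smul_smul]
  congr 1
  ring

theorem SU3Structure.smooth_conjΩ (S : SU3Structure M) : S.conjΩ.IsSmooth :=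
  S.smooth_Ω.compForm _

theorem SU3Structure.conjΩ_type (S : SU3Structure M) (x : M) :
    S.conjΩ x ∈ formsOfType (-(S.J x)) 3 0 3 :=
  conjAlt_mem_formsOfType (V := E6) (S.Ω_type x)

/-- The conjugate of a form of type `(3,0)` is of type `(0,3)`. -/
theorem typeProj_zero_three {V : Type*} [NormedAddCommGroup V] [NormedSpace ℝ V]
    [FiniteDimensional ℝ V] {J : V →L[ℝ] V} (hJ : ∀ v, J (J v) = -v) {c : V [⋀^Fin 3]→L[ℝ] ℂ}
    (hc : c ∈ formsOfType J 3 0 3) : typeProj J 0 3 (conjAlt c) = conjAlt c := by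
  have h := typeProj_of_mem (-J) (conjAlt_mem_formsOfType hc) (p' := 3) (q' := 0)
    (by norm_num) (by norm_num) (by norm_num)
  rwa [typeProj_neg hJ, if_pos (by norm_num)] at h

section
variable {V : Type*} [NormedAddCommGroup V] [NormedSpace ℝ V] [FiniteDimensional ℝ V]
  {J : V →L[ℝ] V}

theorem ComplexFrame.wedge_self (F : ComplexFrame J) {c : V [⋀^Fin 2]→L[ℝ] ℂ}
    (hc : c = F.lefschetzOp oneForm 2) :
    wedge (rfl : 2 + 2 = 4) c c = F.lefschetzOp (F.lefschetzOp oneForm) 4 := by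
  rw [F.lefschetzOp_apply_add_two hc _ 2, ← hc]

theorem ComplexFrame.typeProj_wedge_self (F : ComplexFrame J) (hJ : ∀ v, J (J v) = -v)
    {c : V [⋀^Fin 2]→L[ℝ] ℂ} (hc : c = F.lefschetzOp oneForm 2) :
    typeProj J 2 2 (wedge (rfl : 2 + 2 = 4) c c) = wedge (rfl : 2 + 2 = 4) c c := by
  have h : derForm J (F.lefschetzOp (F.lefschetzOp oneForm) 4) = 0 := by
    rw [← derOp_apply, F.derOp_lefschetzOp, F.derOp_lefschetzOp, derOp_oneForm, map_zero, map_zero]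
    rfl
  rw [F.wedge_self hc]
  exact typeProj_eq_self_of_weight hJ (by norm_num) (by rw [h]; simp)

end

/-- On the tangent space at `x`, the operator `N` of a nearly Kähler manifold is the torsion
operator of an adapted frame. -/
theorem SU3Structure.IsNearlyKahlerWith.N_apply (h : S.IsNearlyKahlerWith lam) (h0 : lam ≠ 0)
    {x : M} (F : S.Frame x) {α : GForm M}
    (hα : ∀ k, DifferentiableAt ℝ ((α k).inChart x) (extChartAt 𝓘(ℝ, E6) x x)) :
    (fun k => S.N α k x : MixedForm E6) = F.torsion lam fun k => α k x := by
  have hJd : DifferentiableAt ℝ (endInChart S.J x) (extChartAt 𝓘(ℝ, E6) x x) :=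
    (contDiffAt_endInChart S.smooth_J x).differentiableAt (by norm_num)
  obtain ⟨A, hA⟩ := F.exists_torsionOp_eq (tangentBasis x) (S.J_sq x)
    fun j => fderiv_endInChart S.J_sq hJd (tangentBasis x j)
  refine (funext fun k => deRhamComponent_two_neg_one (tangentBasis x) S.J_sq hJd hα k).trans ?_
  refine F.eq_torsion_of_apply_conj_vol hA ?_ _
  -- the value of the torsion operator on `Ω̄` is the component of type `(2,2)` of `dΩ̄`
  have h1 := typeProj_extD (tangentBasis x) S.J_sq hJd
    (S.smooth_conjΩ.differentiableAt (mem_extChartAt_target x)) (p := 0) (q := 3) (by norm_num)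
    fun y => typeProj_zero_three (S.J_sq y) (S.Ω_type y)
  have h2 := (congrArg (typeProj (V := E6) _ 2 2) (h.extD_conjΩ h0 x)).trans
    ((typeProj_smul _ _ _ _ _).trans
      (congrArg _ ((F.typeProj_wedge_self (S.J_sq x) F.om_eq).trans (F.wedge_self F.om_eq))))
  refine Eq.trans ?_ (h1.symm.trans h2)
  exact (torsionOp_single _ _ _ F.conj.vol 3).symm.trans
    (congrArg (fun b => torsionOp (tangentBasis x) _ _ (Pi.single 3 b) 4) F.conjΩ_eq.symm)

end NearlyKahlerEquations

/-! ### The conjugate structure -/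

section ConjugateStructure

section
variable {V : Type*} [NormedAddCommGroup V] [NormedSpace ℝ V]

theorem wedge_neg_neg {p q n : ℕ} (h : p + q = n) (a : V [⋀^Fin p]→L[ℝ] ℂ)
    (b : V [⋀^Fin q]→L[ℝ] ℂ) : wedge h (-a) (-b) = wedge h a b := by
  have h1 : mulForms h (-a) (-b) = mulForms h a b := by
    ext v
    simp [mulForms_apply]
  rw [wedge, wedge, h1]

theorem ComplexFrame.lefschetzOp_eq_wedge [FiniteDimensional ℝ V] {J : V →L[ℝ] V}
    (F : ComplexFrame J) {c : V [⋀^Fin 2]→L[ℝ] ℂ} (hc : c = F.lefschetzOp oneForm 2)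
    (a : MixedForm V) : F.lefschetzOp a = fun
      | 0 => 0
      | 1 => 0
      | k + 2 => wedge (Nat.add_comm 2 k) c (a k) := by
  have h0 : ∀ k : ℕ, (∀ i, F.t i (F.conj.t i a) k = 0) → F.lefschetzOp a k = 0 := fun k h => by
    simp only [lefschetzOp_apply, Pi.smul_apply, Finset.sum_apply, h, Finset.sum_const_zero]
    exact form_smul_zero _
  funext k
  match k with
  | 0 => exact h0 0 fun i => rfl
  | 1 => exact h0 1 fun i => ContinuousAlternatingMap.ext fun v => by simp [t, extOp, extForm_apply]
  | k + 2 => exact F.lefschetzOp_apply_add_two hc a k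

theorem imForm_conjAlt {k : ℕ} (a : V [⋀^Fin k]→L[ℝ] ℂ) : imForm (conjAlt a) = -imForm a := by
  ext v
  change ((-(a v).im : ℝ) : ℂ) = -((a v).im : ℂ)
  push_cast
  rfl
end

variable {M : Type*} [TopologicalSpace M] [ChartedSpace E6 M]

theorem Form.IsSmooth.neg {k : ℕ} {α : Form M k} (hα : α.IsSmooth) :
    Form.IsSmooth fun x => -α x :=
  fun c => (hα c).neg

/-- Conjugation exchanges the components `d^{i,j}` and `d^{j,i}`: the sum over the types is
reversed. -/
theorem deRhamComponent_neg {J : M → E6 →L[ℝ] E6} (hJ : ∀ x v, J x (J x v) = -v) (i j : ℤ)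
    (α : GForm M) (k : ℕ) (x : M) :
    deRhamComponent (M := M) (fun x => -J x) i j α k x = deRhamComponent (M := M) J j i α k x := by
  cases k with
  | zero => rfl
  | succ k =>
    let g : ℕ → E6 [⋀^Fin (k + 1)]→L[ℝ] ℂ := fun p =>
      typeProj (J x) ((p : ℤ) + j) ((k : ℤ) - p + i)
        (extD (M := M) (fun y => typeProj (V := E6) (J y) p ((k : ℤ) - p) (α k y)) x)
    change _ = ∑ p ∈ Finset.range (k + 1), g p
    rw [← Finset.sum_range_reflect]
    refine Finset.sum_congr rfl fun p hp => ?_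
    have hp' : p ≤ k := Nat.lt_succ_iff.1 (Finset.mem_range.1 hp)
    have h1 : (fun y => typeProj (V := E6) (-J y) p ((k : ℤ) - p) (α k y)) =
        fun y => typeProj (V := E6) (J y) ((k : ℤ) - p) p (α k y) :=
      funext fun y => typeProj_neg (hJ y) _ _ _
    have h2 : ((k + 1 - 1 - p : ℕ) : ℤ) = (k : ℤ) - p := by omega
    simp only [g, h2, sub_sub_cancel]
    refine (typeProj_neg (hJ x) _ _ _).trans ?_
    exact congrArg (fun β : M → E6 [⋀^Fin k]→L[ℝ] ℂ =>
      typeProj (J x) ((k : ℤ) - p + j) ((p : ℤ) + i) (extD (M := M) β x)) h1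

variable [IsManifold 𝓘(ℝ, E6) ∞ M]

theorem extD_neg {k : ℕ} {α : Form M k} (hα : α.IsSmooth) (x : M) :
    extD (fun y => -α y) x = -extD α x := by
  have h := extD_smul hα (-1) x
  have h1 : (fun y => (-1 : ℂ) • α y) = fun y => -α y :=
    funext fun y => neg_one_smul ℂ (M := (E6 [⋀^Fin k]→L[ℝ] ℂ)) (α y)
  rw [h1] at h
  exact h.trans (neg_one_smul ℂ (M := (E6 [⋀^Fin (k + 1)]→L[ℝ] ℂ)) (extD α x))

variable [RiemannianBundle (fun x : M => TangentSpace 𝓘(ℝ, E6) x)]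

/-- The structure defined by the conjugate almost complex structure `-J`, with the Hermitian form
`-ω` and the complex volume form `Ω̄`. -/
def SU3Structure.conj (S : SU3Structure M) : SU3Structure M where
  J x := -S.J x
  smooth_J := S.smooth_J.neg_section
  J_sq x v := by simp [S.J_sq]
  inner_J x v w := by simp [S.inner_J]
  om x := -S.om x
  smooth_om := S.smooth_om.neg
  om_apply x v w := by
    rw [ContinuousAlternatingMap.neg_apply, S.om_apply]
    simp
  Ω := S.conjΩ
  smooth_Ω := S.smooth_conjΩ
  Ω_type := S.conjΩ_type
  normalized x := by
    obtain ⟨u, h1, h2, h3⟩ := S.normalized x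
    refine ⟨u, h1, fun i j => by simp [h2], ?_⟩
    change (starRingEnd ℂ) (S.Ω x u) = 1
    rw [h3, map_one]

variable {S : SU3Structure M} {lam : ℝ}

/-- The conjugate structure is nearly Kähler for the constant `-λ`: both `ω` and `Im Ω` change sign,
whereas `Re Ω` and `ω ∧ ω` do not. -/
theorem SU3Structure.IsNearlyKahlerWith.conj (h : S.IsNearlyKahlerWith lam) :
    S.conj.IsNearlyKahlerWith (-lam) := by
  refine ⟨fun x => ?_, fun x => ?_⟩
  · refine ((extD_neg S.smooth_om x).trans (congrArg Neg.neg (h.1 x))).trans ?_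
    have h1 : 3 * ((-lam : ℝ) : ℂ) = -(3 * lam) := by
      push_cast
      ring
    rw [h1]
    exact (form_neg_smul (V := E6) (3 * lam) _).symm
  · have h1 : (fun y => imForm (S.conj.Ω y)) = fun y => -imForm (S.Ω y) :=
      funext fun y => imForm_conjAlt (V := E6) (S.Ω y)
    rw [h1]
    refine ((extD_neg (S.smooth_Ω.compForm _) x).trans (congrArg Neg.neg (h.2 x))).trans ?_
    have h2 : -2 * ((-lam : ℝ) : ℂ) = -(-2 * lam) := by
      push_cast
      ring
    rw [h2]
    exact ((congrArg _ (wedge_neg_neg (V := E6) (rfl : 2 + 2 = 4) (S.om x) (S.om x))).trans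
      (form_neg_smul (V := E6) (-2 * lam) _)).symm

theorem SU3Structure.conj_N (S : SU3Structure M) : S.conj.N = S.Nbar :=
  funext fun α => funext fun k => funext fun x => deRhamComponent_neg S.J_sq 2 (-1) α k x

theorem SU3Structure.conj_Nbar (S : SU3Structure M) : S.conj.Nbar = S.N :=
  funext fun α => funext fun k => funext fun x => deRhamComponent_neg S.J_sq (-1) 2 α k x

/-- The conjugate of an adapted frame. -/
def SU3Structure.Frame.conj {x : M} (F : S.Frame x) : S.conj.Frame x where
  toComplexFrame := F.toComplexFrame.conj
  unitary := F.unitary.conj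
  om_eq := by
    have h := congrFun (F.toComplexFrame.conj_lefschetzOp oneForm) 2
    exact (congrArg Neg.neg F.om_eq).trans h.symm
  Ω_u := by
    change (starRingEnd ℂ) (S.Ω x F.u) = 1
    rw [F.Ω_u, map_one]

/-- On the tangent space at `x` the operator `L_ω` is the Lefschetz operator of an adapted frame. -/
theorem SU3Structure.Frame.L_apply {x : M} (F : S.Frame x) (α : GForm M) :
    (fun k => S.L α k x : MixedForm E6) = F.lefschetzOp fun k => α k x := by
  refine Eq.trans (funext fun k => ?_) (F.lefschetzOp_eq_wedge F.om_eq _).symm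
  match k with
  | 0 => rfl
  | 1 => rfl
  | k + 2 => rfl

end ConjugateStructure

/-! ### Hermitian adjoints are computed pointwise -/

section SmoothForms

/-- A map into the space of forms is smooth as soon as its values on all vectors are. -/
theorem contDiffAt_form {W : Type*} [NormedAddCommGroup W] [NormedSpace ℝ W] {k : ℕ} {n : ℕ∞ω}
    {g : W → E6 [⋀^Fin k]→L[ℝ] ℂ} {y : W} (h : ∀ v, ContDiffAt ℝ n (fun y => g y v) y) :
    ContDiffAt ℝ n g y := by
  let e := (EuclideanSpace.basisFun (Fin 6) ℝ).toBasis
  let L : (E6 [⋀^Fin k]→L[ℝ] ℂ) →ₗ[ℝ] ((Fin k → Fin 6) → ℂ) :=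
    { toFun := fun a f => a fun i => e (f i)
      map_add' := fun a b => rfl
      map_smul' := fun c a => rfl }
  have hL : LinearMap.ker L = ⊥ := by
    rw [LinearMap.ker_eq_bot]
    intro a b hab
    refine ContinuousAlternatingMap.toAlternatingMap_injective ?_
    exact Module.Basis.ext_alternating e fun v _ => congrFun hab v
  obtain ⟨G, hG⟩ := L.exists_leftInverse_of_injective hL
  have h1 : g = fun y => G.toContinuousLinearMap (L (g y)) :=
    funext fun y => (LinearMap.congr_fun hG (g y)).symm
  rw [h1]
  exact G.toContinuousLinearMap.contDiff.contDiffAt.comp y (contDiffAt_pi.2 fun f => h _)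

variable {M : Type*} [TopologicalSpace M] [ChartedSpace E6 M] [IsManifold 𝓘(ℝ, E6) ∞ M] [T2Space M]

/-- Every form on the tangent space at `x` is the value at `x` of a smooth form: cut off a form with
constant coefficients in a chart. -/
theorem exists_isSmooth_apply_eq (x : M) {k : ℕ} (a : E6 [⋀^Fin k]→L[ℝ] ℂ) :
    ∃ α : M → E6 [⋀^Fin k]→L[ℝ] ℂ, Form.IsSmooth (M := M) α ∧ α x = a := by
  obtain ⟨ψ⟩ : Nonempty (SmoothBumpFunction 𝓘(ℝ, E6) x) := inferInstance
  refine ⟨fun y => ψ y • a.compContinuousLinearMap (chartDeriv x y), fun c z hz =>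
    ContDiffAt.contDiffWithinAt (contDiffAt_form fun v => ?_), ?_⟩
  · have hcont := continuousAt_extChartAt_symm'' (I := 𝓘(ℝ, E6)) hz
    by_cases hp : (extChartAt 𝓘(ℝ, E6) c).symm z ∈ (extChartAt 𝓘(ℝ, E6) x).source
    · set φ : E6 → E6 := fun z => extChartAt 𝓘(ℝ, E6) x ((extChartAt 𝓘(ℝ, E6) c).symm z)
      have hφ : ContDiffAt ℝ ∞ (fderiv ℝ φ) z :=
        (contDiffAt_chart_change hz hp).fderiv_right (m := ∞) (by simp)
      have hψ : ContDiffAt ℝ ∞ (fun z => ψ ((extChartAt 𝓘(ℝ, E6) c).symm z)) z :=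
        contMDiffAt_iff_contDiffAt.1 (ψ.contMDiff.contMDiffAt.comp z
          ((contMDiffOn_extChartAt_symm c).contMDiffAt ((isOpen_extChartAt_target c).mem_nhds hz)))
      have h1 : ContDiffAt ℝ ∞ (fun z => ψ ((extChartAt 𝓘(ℝ, E6) c).symm z) •
          a fun i => fderiv ℝ φ z (v i)) z := by
        refine hψ.smul (a.toContinuousMultilinearMap.contDiff.contDiffAt.comp z
          (contDiffAt_pi.2 fun i => hφ.clm_apply contDiffAt_const))
      refine h1.congr_of_eventuallyEq ?_
      filter_upwards [(isOpen_extChartAt_target (I := 𝓘(ℝ, E6)) c).mem_nhds hz,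
        hcont.preimage_mem_nhds ((isOpen_extChartAt_source (I := 𝓘(ℝ, E6)) x).mem_nhds hp)]
        with w hw hwp
      rw [fderiv_chart_change hw hwp]
      rfl
    · have hs : (extChartAt 𝓘(ℝ, E6) c).symm z ∉ tsupport ψ := fun h =>
        hp (ψ.tsupport_subset_extChartAt_source h)
      refine (contDiffAt_const (c := (0 : ℂ))).congr_of_eventuallyEq ?_
      filter_upwards [hcont.eventually (notMem_tsupport_iff_eventuallyEq.1 hs)] with w hw
      change ψ _ • _ = (0 : ℂ)
      rw [hw]
      exact zero_smul ℝ _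
  · change ψ x • a.compContinuousLinearMap (chartDeriv x x) = a
    rw [ψ.eq_one, one_smul, chartDeriv_self]
    rfl

theorem exists_isSmooth_mixedForm_eq (x : M) (a : MixedForm E6) :
    ∃ α : GForm M, α.IsSmooth ∧ (fun k => α k x : MixedForm E6) = a := by
  choose α hα hx using fun k => exists_isSmooth_apply_eq x (a k)
  exact ⟨α, hα, funext hx⟩

variable [RiemannianBundle (fun x : M => TangentSpace 𝓘(ℝ, E6) x)]

/-- An operator that is given by endomorphisms of the spaces of forms at the points of `M` has the
adjoint given by the adjoint endomorphisms. -/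
theorem hermitianAdjoint_apply {A : GForm M → GForm M} {x : M} {T T' : Module.End ℂ (MixedForm E6)}
    (hA : ∀ α : GForm M, α.IsSmooth → (fun k => A α k x : MixedForm E6) = T fun k => α k x)
    (hT : IsAdj (tangentBasis x) T T') (β : GForm M) :
    (fun k => hermitianAdjoint A β k x : MixedForm E6) = T' fun k => β k x := by
  have h : ∃ w : (k : ℕ) → (TangentSpace 𝓘(ℝ, E6) x) [⋀^Fin k]→L[ℝ] ℂ,
      ∀ α : GForm M, α.IsSmooth →
        fiberInner x (fun k => A α k x) (fun k => β k x) = fiberInner x (fun k => α k x) w := by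
    refine ⟨T' fun k => β k x, fun α hα => ?_⟩
    refine (fiberInner_eq x _ _).trans (Eq.trans ?_ (fiberInner_eq x _ _).symm)
    rw [hA α hα]
    exact hT _ _
  have h1 : (fun k => hermitianAdjoint A β k x : MixedForm E6) = h.choose :=
    funext fun k => dif_pos h
  rw [h1]
  refine eq_of_formInner_eq (tangentBasis x) (card_fin_finrank_tangentSpace x) fun a => ?_
  obtain ⟨α, hα, rfl⟩ := exists_isSmooth_mixedForm_eq x a
  refine ((fiberInner_eq x _ _).symm.trans (h.choose_spec α hα).symm).trans ?_
  refine (fiberInner_eq x _ _).trans ?_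
  rw [hA α hα]
  exact hT _ _

/-- The adjoint of an operator given by endomorphisms of the spaces of forms at the points of `M`
exists, provided that these endomorphisms have adjoints. -/
theorem isHermitianAdjoint_hermitianAdjoint {A : GForm M → GForm M}
    (h : ∀ x : M, ∃ T T' : Module.End ℂ (MixedForm E6), IsAdj (tangentBasis x) T T' ∧
      ∀ α : GForm M, α.IsSmooth → (fun k => A α k x : MixedForm E6) = T fun k => α k x) :
    IsHermitianAdjoint A (hermitianAdjoint A) := by
  intro α β hα x
  obtain ⟨T, T', hT, hA⟩ := h x
  refine (fiberInner_eq x _ _).trans (Eq.trans ?_ (fiberInner_eq x _ _).symm)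
  rw [hA α hα, hermitianAdjoint_apply hA hT]
  exact hT _ _

end SmoothForms

/-! ### The operator `Λ_ω` preserves smooth forms -/

section Smoothness

/-- The standard basis of the model space. -/
def stdBasis : Module.Basis (Fin 6) ℝ E6 := (EuclideanSpace.basisFun (Fin 6) ℝ).toBasis

/-- The endomorphism `u ↦ ∑ⱼ Re c(u, eⱼ) eⱼ` of the model space defined by a two-form `c`. -/
def twoFormMap (c : E6 [⋀^Fin 2]→L[ℝ] ℂ) : E6 →L[ℝ] E6 :=
  ∑ j, ((Complex.reCLM ∘L ContinuousAlternatingMap.apply ℝ E6 ℂ ![stdBasis j]) ∘L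
    c.curryLeft).smulRight (stdBasis j)

theorem twoFormMap_apply (c : E6 [⋀^Fin 2]→L[ℝ] ℂ) (u : E6) :
    twoFormMap c u = ∑ j, (c ![u, stdBasis j]).re • stdBasis j := by
  simp only [twoFormMap, sum_apply]
  rfl

theorem repr_twoFormMap (c : E6 [⋀^Fin 2]→L[ℝ] ℂ) (u : E6) (j : Fin 6) :
    stdBasis.repr (twoFormMap c u) j = (c ![u, stdBasis j]).re := by
  rw [twoFormMap_apply]
  simp only [map_sum, map_smul, Module.Basis.repr_self, Finsupp.coe_finsetSum, Finset.sum_apply,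
    Finsupp.coe_smul, Pi.smul_apply, smul_eq_mul]
  rw [Finset.sum_eq_single_of_mem j (Finset.mem_univ j) fun i _ hi => by
    rw [Finsupp.single_eq_of_ne (Ne.symm hi), mul_zero]]
  simp

/-- A real-valued two-form is recovered from its map `twoFormMap`. -/
theorem twoForm_apply_eq_repr {c : E6 [⋀^Fin 2]→L[ℝ] ℂ} (hc : ∀ v w, (c ![v, w]).im = 0)
    (u w : E6) :
    c ![u, w] = ((∑ j, stdBasis.repr w j * stdBasis.repr (twoFormMap c u) j : ℝ) : ℂ) := by
  have h1 : ∀ w, c ![u, w] = ((c ![u, w]).re : ℂ) := fun w =>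
    Complex.ext rfl (by simpa using hc u w)
  have h2 : c ![u, w] = ∑ j, (stdBasis.repr w j : ℂ) * c ![u, stdBasis j] := by
    have h := map_sum ((ContinuousMultilinearMap.ofSubsingleton ℝ E6 ℂ (0 : Fin 1)).symm
      (c.curryLeft u).toContinuousMultilinearMap) (fun j => stdBasis.repr w j • stdBasis j)
        Finset.univ
    rw [stdBasis.sum_repr] at h
    have h3 : ∀ v, (ContinuousMultilinearMap.ofSubsingleton ℝ E6 ℂ (0 : Fin 1)).symm
        (c.curryLeft u).toContinuousMultilinearMap v = c ![u, v] := fun v => by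
      change c _ = c _
      congr 1
      funext i
      fin_cases i <;> rfl
    simp only [map_smul] at h
    simp only [h3, Complex.real_smul] at h
    exact h
  rw [h2]
  push_cast
  refine Finset.sum_congr rfl fun j _ => ?_
  rw [repr_twoFormMap, ← h1]

theorem contDiffOn_form_apply {W : Type*} [NormedAddCommGroup W] [NormedSpace ℝ W] {k : ℕ}
    {n : ℕ∞ω} {g : W → E6 [⋀^Fin k]→L[ℝ] ℂ} {s : Set W} (h : ContDiffOn ℝ n g s) (v : Fin k → E6) :
    ContDiffOn ℝ n (fun y => g y v) s :=
  (ContinuousAlternatingMap.apply ℝ E6 ℂ v).contDiff.comp_contDiffOn h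

theorem contDiffAt_curryLeft {W : Type*} [NormedAddCommGroup W] [NormedSpace ℝ W] {k : ℕ}
    {n : ℕ∞ω} {g : W → E6 [⋀^Fin (k + 1)]→L[ℝ] ℂ} {u : W → E6} {y : W} (hg : ContDiffAt ℝ n g y)
    (hu : ContDiffAt ℝ n u y) : ContDiffAt ℝ n (fun y => (g y).curryLeft (u y)) y := by
  refine contDiffAt_form fun v => ?_
  have h1 : ∀ y, (g y).curryLeft (u y) v = ∑ i, (stdBasis.repr (u y) i : ℂ) *
      g y (Matrix.vecCons (stdBasis i) v) := by
    intro y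
    conv_lhs => rw [← stdBasis.sum_repr (u y), map_sum, ContinuousAlternatingMap.sum_apply]
    refine Finset.sum_congr rfl fun i _ => ?_
    rw [map_smul]
    exact Complex.real_smul
  simp only [h1]
  exact ContDiffAt.sum fun i _ => ((Complex.ofRealCLM ∘L
    (stdBasis.coord i).toContinuousLinearMap).contDiff.contDiffAt.comp y hu).mul
      ((ContinuousAlternatingMap.apply ℝ E6 ℂ
        (Matrix.vecCons (stdBasis i) v)).contDiff.contDiffAt.comp y hg)

theorem contDiffOn_twoFormMap {W : Type*} [NormedAddCommGroup W] [NormedSpace ℝ W]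
    {n : ℕ∞ω} {g : W → E6 [⋀^Fin 2]→L[ℝ] ℂ} {s : Set W} (h : ContDiffOn ℝ n g s) :
    ContDiffOn ℝ n (fun y => twoFormMap (g y)) s := by
  refine contDiffOn_clm_apply.2 fun u => ?_
  simp only [twoFormMap_apply]
  exact ContDiffOn.sum fun j _ => (Complex.reCLM.contDiff.comp_contDiffOn
    (contDiffOn_form_apply h _)).smul contDiffOn_const

variable {M : Type*} [TopologicalSpace M] [ChartedSpace E6 M] [IsManifold 𝓘(ℝ, E6) ∞ M]
  [RiemannianBundle (fun x : M => TangentSpace 𝓘(ℝ, E6) x)] {S : SU3Structure M}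

/-- On the tangent space at `x` the operator `Λ_ω` is the adjoint Lefschetz operator of an adapted
frame. -/
theorem SU3Structure.Frame.Lam_apply [T2Space M] {x : M} (F : S.Frame x) (α : GForm M) :
    (fun k => S.Lam α k x : MixedForm E6) = F.lambdaOp fun k => α k x :=
  hermitianAdjoint_apply (fun α _ => F.L_apply α)
    (F.unitary.isAdj_lefschetzOp (card_fin_finrank_tangentSpace x)) α

/-- The derivative at `y` of the inverse of the chart around `c`, as an isomorphism. -/
def chartSymmDerivEquiv {c : M} {y : E6} (hy : y ∈ (extChartAt 𝓘(ℝ, E6) c).target) : E6 ≃L[ℝ] E6 :=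
  ContinuousLinearEquiv.equivOfInverse (chartSymmDeriv c y)
    (chartDeriv c ((extChartAt 𝓘(ℝ, E6) c).symm y))
    (fun v => congrArg (fun L : E6 →L[ℝ] E6 => L v) (chartDeriv_comp_chartSymmDeriv hy))
    (fun v => congrArg (fun L : E6 →L[ℝ] E6 => L v) (chartSymmDeriv_comp_chartDeriv hy))

theorem SU3Structure.inChart_om_apply (S : SU3Structure M) {c : M} {y : E6}
    (hy : y ∈ (extChartAt 𝓘(ℝ, E6) c).target)
    (F : S.Frame ((extChartAt 𝓘(ℝ, E6) c).symm y)) (v w : E6) :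
    S.om.inChart c y ![v, w] = F.lefschetzOp oneForm 2
      ![chartSymmDerivEquiv hy v, chartSymmDerivEquiv hy w] := by
  refine Eq.trans ?_ (congrArg (fun b : E6 [⋀^Fin 2]→L[ℝ] ℂ => b _) F.om_eq)
  refine congrArg (S.om _ : E6 [⋀^Fin 2]→L[ℝ] ℂ) (funext fun i => ?_)
  fin_cases i <;> rfl

theorem SU3Structure.inChart_om_im (S : SU3Structure M) (c : M) (y v w : E6) :
    (S.om.inChart c y ![v, w]).im = 0 := by
  have h : S.om.inChart c y ![v, w] = S.om ((extChartAt 𝓘(ℝ, E6) c).symm y)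
      ![chartSymmDeriv c y v, chartSymmDeriv c y w] := by
    refine congrArg (S.om _ : E6 [⋀^Fin 2]→L[ℝ] ℂ) (funext fun i => ?_)
    fin_cases i <;> rfl
  exact (congrArg Complex.im (h.trans (S.om_apply _ _ _))).trans (Complex.ofReal_im _)

/-- The Hermitian form is nondegenerate. -/
theorem SU3Structure.isInvertible_twoFormMap (S : SU3Structure M) {c : M} {y : E6}
    (hy : y ∈ (extChartAt 𝓘(ℝ, E6) c).target) : (twoFormMap (S.om.inChart c y)).IsInvertible := by
  have hinj : Function.Injective (twoFormMap (S.om.inChart c y)).toLinearMap := by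
    rw [← LinearMap.ker_eq_bot, LinearMap.ker_eq_bot']
    intro u hu
    obtain ⟨F⟩ := S.nonempty_frame ((extChartAt 𝓘(ℝ, E6) c).symm y)
    refine (chartSymmDerivEquiv hy).map_eq_zero_iff.1
      (F.lefschetzOp_oneForm_nondegenerate fun w => ?_)
    obtain ⟨w, rfl⟩ := (chartSymmDerivEquiv hy).surjective w
    rw [← S.inChart_om_apply hy F, twoForm_apply_eq_repr (S.inChart_om_im c y)]
    have hu' : twoFormMap (S.om.inChart c y) u = 0 := hu
    simp [hu']
  exact ⟨(LinearEquiv.ofInjectiveEndo _ hinj).toContinuousLinearEquiv, by ext; rfl⟩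

/-- The adjoint of the Lefschetz operator in a chart, in terms of the inverse of the coefficient
matrix of the Hermitian form. -/
theorem SU3Structure.inChart_Lam [T2Space M] (S : SU3Structure M) (α : GForm M) (k : ℕ) {c : M}
    {y : E6} (hy : y ∈ (extChartAt 𝓘(ℝ, E6) c).target) (v : Fin k → E6) :
    (S.Lam α k).inChart c y v = (-2⁻¹ : ℂ) * ∑ j, (((α (k + 2)).inChart c y).curryLeft
      (stdBasis j)).curryLeft ((twoFormMap (S.om.inChart c y)).inverse (stdBasis j)) v := by
  obtain ⟨F⟩ := S.nonempty_frame ((extChartAt 𝓘(ℝ, E6) c).symm y)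
  set φ := chartSymmDerivEquiv hy with hφ
  have hB := S.isInvertible_twoFormMap hy
  set u := fun j => (twoFormMap (S.om.inChart c y)).inverse (stdBasis j) with hu
  have h1 := F.lambdaOp_eq (stdBasis.map φ.toLinearEquiv) (v := fun j => φ (u j)) (fun j w => by
    obtain ⟨w, rfl⟩ := φ.surjective w
    rw [← S.inChart_om_apply hy F, twoForm_apply_eq_repr (S.inChart_om_im c y)]
    have h2 : twoFormMap (S.om.inChart c y) (u j) = stdBasis j := hB.self_apply_inverse _
    rw [h2]
    simp [Finsupp.single_apply]) fun k => α k ((extChartAt 𝓘(ℝ, E6) c).symm y)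
  have h2 := congrArg (fun b : E6 [⋀^Fin k]→L[ℝ] ℂ => b (φ ∘ v))
    (congrFun ((F.Lam_apply α).trans h1) k)
  refine Eq.trans h2 ?_
  simp only [Pi.smul_apply, Finset.sum_apply, ContinuousAlternatingMap.smul_apply,
    ContinuousAlternatingMap.sum_apply, smul_eq_mul]
  congr 1
  refine Finset.sum_congr rfl fun j _ => ?_
  refine congrArg (α (k + 2) _ : E6 [⋀^Fin (k + 2)]→L[ℝ] ℂ) (funext fun i => ?_)
  refine Fin.cases rfl (fun i => ?_) i
  exact Fin.cases rfl (fun i => rfl) i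

/-- The operator `Λ_ω` preserves smoothness, by the formula in charts and the smoothness of the
inverse of a matrix. This is needed to apply `N`, which is only defined by differentiation, to `Λ_ω
α`. -/
theorem SU3Structure.isSmooth_Lam [T2Space M] (S : SU3Structure M) {α : GForm M}
    (hα : α.IsSmooth) : (S.Lam α).IsSmooth := by
  intro k c y hy
  refine (contDiffAt_form fun v => ?_).contDiffWithinAt
  have ht := (isOpen_extChartAt_target (I := 𝓘(ℝ, E6)) c).mem_nhds hy
  have hu : ∀ j, ContDiffAt ℝ ∞
      (fun y => (twoFormMap (S.om.inChart c y)).inverse (stdBasis j)) y := fun j =>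
    (((S.isInvertible_twoFormMap hy).contDiffAt_map_inverse).comp y
      ((contDiffOn_twoFormMap (S.smooth_om c)).contDiffAt ht)).clm_apply contDiffAt_const
  have hβ : ∀ j, ContDiffAt ℝ ∞ (fun y => (((α (k + 2)).inChart c y).curryLeft
      (stdBasis j)).curryLeft ((twoFormMap (S.om.inChart c y)).inverse (stdBasis j)) v) y :=
    fun j => (ContinuousAlternatingMap.apply ℝ E6 ℂ v).contDiff.contDiffAt.comp y
      (contDiffAt_curryLeft (contDiffAt_curryLeft ((hα (k + 2)).contDiffAt hy) contDiffAt_const)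
        (hu j))
  have h : ContDiffAt ℝ ∞ (fun y => (-2⁻¹ : ℂ) * ∑ j, (((α (k + 2)).inChart c y).curryLeft
      (stdBasis j)).curryLeft ((twoFormMap (S.om.inChart c y)).inverse (stdBasis j)) v) y :=
    contDiffAt_const.mul (ContDiffAt.sum fun j _ => hβ j)
  exact h.congr_of_eventuallyEq (Filter.Eventually.mono ht fun z hz => S.inChart_Lam α k hz v)

end Smoothness

/-! ### The commutator identities -/

section Commutators

variable {M : Type*} [TopologicalSpace M] [ChartedSpace E6 M]

theorem Form.IsSmooth.differentiableAt_self {k : ℕ} {α : Form M k} (hα : α.IsSmooth) (x : M) :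
    DifferentiableAt ℝ (α.inChart x) (extChartAt 𝓘(ℝ, E6) x x) :=
  hα.differentiableAt (mem_extChartAt_target x)

theorem gForm_ext {α β : GForm M}
    (h : ∀ x, (fun k => α k x : MixedForm E6) = fun k => β k x) : α = β :=
  funext fun k => funext fun x => congrFun (h x) k

theorem gForm_neg_smul (c : ℂ) (α : GForm M) : (-c) • α = -(c • α) :=
  gForm_ext fun x => funext fun k => form_neg_smul (V := E6) c (α k x)

variable [IsManifold 𝓘(ℝ, E6) ∞ M] [RiemannianBundle (fun x : M => TangentSpace 𝓘(ℝ, E6) x)]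
  {S : SU3Structure M} {lam : ℝ}

theorem SU3Structure.conj_Nadj (S : SU3Structure M) : S.conj.Nadj = S.Nbaradj :=
  congrArg hermitianAdjoint S.conj_N

theorem SU3Structure.conj_L (S : SU3Structure M) (α : GForm M) : S.conj.L α = -S.L α := by
  refine gForm_ext fun x => ?_
  obtain ⟨F⟩ := S.nonempty_frame x
  exact (F.conj.L_apply α).trans ((F.conj_lefschetzOp _).trans
    (congrArg Neg.neg (F.L_apply α).symm))

theorem SU3Structure.IsNearlyKahlerWith.N_neg (h : S.IsNearlyKahlerWith lam) (h0 : lam ≠ 0)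
    {α : GForm M} (hα : α.IsSmooth) : S.N (-α) = -S.N α := by
  refine gForm_ext fun x => ?_
  obtain ⟨F⟩ := S.nonempty_frame x
  exact (h.N_apply h0 F fun k => (hα k).neg.differentiableAt_self x).trans
    ((map_neg (F.torsion lam) fun k => α k x).trans
      (congrArg Neg.neg (h.N_apply h0 F fun k => (hα k).differentiableAt_self x).symm))

variable [T2Space M]

/-- On the tangent space at `x` the operator `N^*` is the adjoint torsion of an adapted frame. The
form `α` need not be smooth. -/
theorem SU3Structure.IsNearlyKahlerWith.Nadj_apply (h : S.IsNearlyKahlerWith lam) (h0 : lam ≠ 0)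
    {x : M} (F : S.Frame x) (α : GForm M) :
    (fun k => S.Nadj α k x : MixedForm E6) = F.torsionAdj lam fun k => α k x :=
  hermitianAdjoint_apply (fun _ hα => h.N_apply h0 F fun k => (hα k).differentiableAt_self x)
    (F.unitary.isAdj_torsion (card_fin_finrank_tangentSpace x) lam) α

theorem SU3Structure.IsNearlyKahlerWith.isHermitianAdjoint_Nadj (h : S.IsNearlyKahlerWith lam)
    (h0 : lam ≠ 0) : IsHermitianAdjoint S.N S.Nadj := by
  refine isHermitianAdjoint_hermitianAdjoint fun x => ?_
  obtain ⟨F⟩ := S.nonempty_frame x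
  exact ⟨_, _, F.unitary.isAdj_torsion (card_fin_finrank_tangentSpace x) lam,
    fun _ hα => h.N_apply h0 F fun k => (hα k).differentiableAt_self x⟩

theorem SU3Structure.isHermitianAdjoint_Lam (S : SU3Structure M) :
    IsHermitianAdjoint S.L S.Lam := by
  refine isHermitianAdjoint_hermitianAdjoint fun x => ?_
  obtain ⟨F⟩ := S.nonempty_frame x
  exact ⟨_, _, F.unitary.isAdj_lefschetzOp (card_fin_finrank_tangentSpace x),
    fun α _ => F.L_apply α⟩

/-- The operators are given pointwise, and `N̄` is the operator `N` of the conjugate structure, so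
that the identity is the one in a frame. -/
theorem SU3Structure.IsNearlyKahlerWith.commutator_L_Nadj (h : S.IsNearlyKahlerWith lam)
    (h0 : lam ≠ 0) {α : GForm M} (hα : α.IsSmooth) :
    commutator S.L S.Nadj α = (2 * Complex.I) • S.Nbar α := by
  refine gForm_ext fun x => ?_
  obtain ⟨F⟩ := S.nonempty_frame x
  have h1 := (F.L_apply (S.Nadj α)).trans (congrArg F.lefschetzOp (h.Nadj_apply h0 F α))
  have h2 := (h.Nadj_apply h0 F (S.L α)).trans (congrArg (F.torsionAdj lam) (F.L_apply α))
  have h3 := h.conj.N_apply (neg_ne_zero.2 h0) F.conj fun k => (hα k).differentiableAt_self x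
  rw [S.conj_N] at h3
  have h4 := F.lefschetzOp_torsionAdj lam fun k => α k x
  rw [← Complex.ofReal_neg] at h4
  exact (congrArg₂ (fun a b : MixedForm E6 => a - b) h1 h2).trans
    (h4.trans (congrArg (fun a : MixedForm E6 => (2 * Complex.I) • a) h3.symm))

theorem SU3Structure.IsNearlyKahlerWith.commutator_Lam_N (h : S.IsNearlyKahlerWith lam)
    (h0 : lam ≠ 0) {α : GForm M} (hα : α.IsSmooth) :
    commutator S.Lam S.N α = (2 * Complex.I) • S.Nbaradj α := by
  refine gForm_ext fun x => ?_
  obtain ⟨F⟩ := S.nonempty_frame x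
  have h1 := (F.Lam_apply (S.N α)).trans (congrArg F.lambdaOp
    (h.N_apply h0 F fun k => (hα k).differentiableAt_self x))
  have h2 := (h.N_apply h0 F fun k => (S.isSmooth_Lam hα k).differentiableAt_self x).trans
    (congrArg (F.torsion lam) (F.Lam_apply α))
  have h3 := h.conj.Nadj_apply (neg_ne_zero.2 h0) F.conj α
  have h4 := F.unitary.lambdaOp_torsion (card_fin_finrank_tangentSpace x) lam fun k => α k x
  rw [← Complex.ofReal_neg] at h4
  rw [S.conj_Nadj] at h3
  exact (congrArg₂ (fun a b : MixedForm E6 => a - b) h1 h2).trans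
    (h4.trans (congrArg (fun a : MixedForm E6 => (2 * Complex.I) • a) h3.symm))

theorem SU3Structure.conj_Lam (S : SU3Structure M) (α : GForm M) : S.conj.Lam α = -S.Lam α := by
  refine gForm_ext fun x => ?_
  obtain ⟨F⟩ := S.nonempty_frame x
  exact (F.conj.Lam_apply α).trans ((F.conj_lambdaOp _).trans
    (congrArg Neg.neg (F.Lam_apply α).symm))

theorem SU3Structure.IsNearlyKahlerWith.Nadj_neg (h : S.IsNearlyKahlerWith lam) (h0 : lam ≠ 0)
    (α : GForm M) : S.Nadj (-α) = -S.Nadj α := by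
  refine gForm_ext fun x => ?_
  obtain ⟨F⟩ := S.nonempty_frame x
  exact (h.Nadj_apply h0 F (-α)).trans ((map_neg (F.torsionAdj lam) fun k => α k x).trans
    (congrArg Neg.neg (h.Nadj_apply h0 F α).symm))

/-- This is `commutator_L_Nadj` for the conjugate structure, whose Lefschetz operator is `-L_ω`. -/
theorem SU3Structure.IsNearlyKahlerWith.commutator_L_Nbaradj (h : S.IsNearlyKahlerWith lam)
    (h0 : lam ≠ 0) {α : GForm M} (hα : α.IsSmooth) :
    commutator S.L S.Nbaradj α = (-2 * Complex.I) • S.N α := by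
  have h1 := h.conj.commutator_L_Nadj (neg_ne_zero.2 h0) hα
  rw [commutator, S.conj_L, S.conj_L, h.conj.Nadj_neg (neg_ne_zero.2 h0), S.conj_Nadj,
    S.conj_Nbar] at h1
  have h2 := congrArg Neg.neg h1
  rw [commutator, neg_mul, gForm_neg_smul, ← h2]
  abel

/-- This is `commutator_Lam_N` for the conjugate structure, whose adjoint Lefschetz operator is
`-Λ_ω`. -/
theorem SU3Structure.IsNearlyKahlerWith.commutator_Lam_Nbar (h : S.IsNearlyKahlerWith lam)
    (h0 : lam ≠ 0) {α : GForm M} (hα : α.IsSmooth) :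
    commutator S.Lam S.Nbar α = (-2 * Complex.I) • S.Nadj α := by
  have h1 := h.conj.commutator_Lam_N (neg_ne_zero.2 h0) hα
  have h3 : S.conj.Nbaradj = S.Nadj := congrArg hermitianAdjoint S.conj_Nbar
  rw [commutator, S.conj_Lam, S.conj_Lam, h.conj.N_neg (neg_ne_zero.2 h0) (S.isSmooth_Lam hα),
    S.conj_N, h3] at h1
  have h2 := congrArg Neg.neg h1
  rw [commutator, neg_mul, gForm_neg_smul, ← h2]
  abel

end Commutators

end NearlyKahler

end

theorem mainTheorem8 {M : Type*} [TopologicalSpace M] [T2Space M] [SecondCountableTopology M]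
    [ChartedSpace NearlyKahler.E6 M] [IsManifold 𝓘(ℝ, NearlyKahler.E6) ∞ M]
    [RiemannianBundle (fun x : M => TangentSpace 𝓘(ℝ, NearlyKahler.E6) x)]
    [IsContMDiffRiemannianBundle 𝓘(ℝ, NearlyKahler.E6) ∞ NearlyKahler.E6
      (fun x : M => TangentSpace 𝓘(ℝ, NearlyKahler.E6) x)]
    (S : NearlyKahler.SU3Structure M) (hS : S.IsNearlyKahler) :
    NearlyKahler.IsHermitianAdjoint S.N S.Nadj ∧
    NearlyKahler.IsHermitianAdjoint S.Nbar S.Nbaradj ∧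
    NearlyKahler.IsHermitianAdjoint S.L S.Lam ∧
    ∀ α : NearlyKahler.GForm M, α.IsSmooth →
      NearlyKahler.commutator S.L S.Nadj α = (2 * Complex.I) • S.Nbar α ∧
      NearlyKahler.commutator S.L S.Nbaradj α = (-2 * Complex.I) • S.N α ∧
      NearlyKahler.commutator S.Lam S.N α = (2 * Complex.I) • S.Nbaradj α ∧
      NearlyKahler.commutator S.Lam S.Nbar α = (-2 * Complex.I) • S.Nadj α := by
  obtain ⟨lam, h0, h1, h2⟩ := hS
  have h : S.IsNearlyKahlerWith lam := ⟨h1, h2⟩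
  refine ⟨h.isHermitianAdjoint_Nadj h0, ?_, S.isHermitianAdjoint_Lam, fun α hα =>
    ⟨h.commutator_L_Nadj h0 hα, h.commutator_L_Nbaradj h0 hα, h.commutator_Lam_N h0 hα,
      h.commutator_Lam_Nbar h0 hα⟩⟩
  have h3 := h.conj.isHermitianAdjoint_Nadj (neg_ne_zero.2 h0)
  rwa [NearlyKahler.SU3Structure.conj_N, NearlyKahler.SU3Structure.conj_Nadj] at h3
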